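/- **Setting.** An instance of the rank-maximal matching problem is a finite bipartite graph $G=(\mathcal A\cup\mathcal P,E)$ (applicants and posts) in which every edge has a rank, a positive integer. Let $n=|\mathcal A|+|\mathcal P|$ and $m=|E|$. The signature of a matching is the sequence whose $k$-th entry is its number of rank-$k$ edges; a matching is rank-maximal if its signature is lexicographically largest. For a graph $F$ with a maximum matching $N$, a vertex is even (odd) if some alternating path of even (odd) length leads to it from an unmatched vertex, and unreachable if no alternating path from an unmatched vertex leads to it. Irving et al.'s algorithm starts with $G'_0=\emptyset$, $M_0=\emptyset$. At stage $i\ge 1$ it adds to $G'_{i-1}$ the edges of rank $i$ both of whose end-points were even at all earlier stages, augments $M_{i-1}$ to a maximum matching $M_i$ of the resulting graph, labels the vertices as even, odd, unreachable with respect to $M_i$, and deletes the edges between an odd vertex and an odd or unreachable vertex; what remains is the reduced graph $G'_i$. The *stored information* for $r$ stages is: for each vertex the first stage $\le r$ at which it is odd or unreachable (if any) and which of the two it then is, and for each edge the stage $\le r$ at which it is deleted (if any), where an edge of rank $>i$ is deleted at stage $i$ when an end-point is odd or unreachable at stage $i$. **Vertex-deletion algorithm.** Let $d$ be an applicant or a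 post of $G$, $H=G-d$, $M$ a rank-maximal matching of $G$ and $M_i$ the set of its edges of rank $\le i$. For $i=1,\dots,r$ the algorithm forms a graph $H'_i$ and a matching $M'_i$, starting from $H'_0=M'_0=\emptyset$ and $S=T=\emptyset$, as follows. 1. $H'_i$ is initialized as $H'_{i-1}$ together with those rank-$i$ edges that are present at stage $i$ of the execution on $G$ (before the deletions of that stage) or are incident to a vertex of $S$, except for the edges incident to $d$ or to a vertex of $T$. 2. If $d$ is unmatched in $M_i$, then $M'_i=M_i$. If $d$ is matched in $M$ to $w$ by an edge of rank $j$ and $i=j$: when $w$ is odd at stage $j$ of the execution on $G$, $M'_j$ is $M_j\setminus\{dw\}$ augmented along an augmenting path in $H'_j$ starting at $w$; when $w$ is unreachable or even, $M'_j=M_j\setminus\{dw\}$. If $i>j$: take $M'_{i-1}$ together with the edges of $M_i$ that avoid $d$ and are disjoint from $M'_{i-1}$; augment it once, along an augmenting path in $H'_i$ starting at a vertex that is matched in $M_i$ but not in this matching, if there is such a path; the result is $M'_i$. 3. Recompute the labels in $H'_i$ with respect to $M'_i$, and delete from $H'_i$ the edges between an odd vertex and an odd or unreachable vertex. Add the odd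 and unreachable vertices to $T$. Add to $S$ the vertices that are odd or unreachable at stage $i$ of the execution on $G$ and even now, and remove from $S$ all vertices of $T$. **Theorem.** Let $r\ge1$ be an integer such that no rank-maximal matching of $G$ or of $H$ uses an edge of rank larger than $r$ (for instance, $r$ the largest rank of an edge). The algorithm can be executed, and every execution correctly updates the matching and the reduced graphs: the sequences $M'_i$ and $H'_i$, $1\le i\le r$, are the matchings and reduced graphs of an execution of Irving et al.'s algorithm on $H$, every execution of that algorithm on $H$ has the reduced graphs $H'_1,\dots,H'_r$, and $M'_r$ is a rank-maximal matching of $H$. Moreover, the algorithm runs in time $O(r(m+n))$: there are a program of a random access machine (unit cost, indirect addressing, only successor and predecessor as arithmetic) and an absolute constant $C$ such that, given $G$ (vertices and edges numbered, each edge with its end-points and rank), $d$, $r$, $M$ and the stored information for the execution on $G$, the program halts after at most $C\,r(m+n)$ steps with the matching $M'_r$ and the stored information for $H$ resulting from an execution of the algorithm. -/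

import Mathlib

universe u v

/-! ## Instances, matchings, rank-maximality -/

/-- A rank-maximal matching instance: a finite bipartite graph whose edges carry ranks `≥ 1`. -/
structure RankInstance (A : Type u) (P : Type v) where
  applicants : Set A
  posts : Set P
  edges : Set (A × P)
  rank : A × P → ℕ
  applicants_finite : applicants.Finite
  posts_finite : posts.Finite
  edges_subset : edges ⊆ applicants ×ˢ posts
  one_le_rank : ∀ e ∈ edges, 1 ≤ rank e

/-- The edge `e` has the end-points `x` and `y`. -/
def Joins {A : Type u} {P : Type v} (e : A × P) (x y : A ⊕ P) : Prop :=
  (x = Sum.inl e.1 ∧ y = Sum.inr e.2) ∨ (x = Sum.inr e.2 ∧ y = Sum.inl e.1)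

/-- The vertex `x` is an end-point of the edge `e`. -/
def Incident {A : Type u} {P : Type v} (e : A × P) (x : A ⊕ P) : Prop :=
  x = Sum.inl e.1 ∨ x = Sum.inr e.2

/-- `M` is a matching in the graph with edge set `F`. -/
def IsMatching {A : Type u} {P : Type v} (F M : Set (A × P)) : Prop :=
  M ⊆ F ∧ ∀ e ∈ M, ∀ f ∈ M, ∀ x, Incident e x → Incident f x → e = f

/-- `M` is a matching of maximum cardinality in the (finite) graph with edge set `F`. -/
def IsMaximumMatching {A : Type u} {P : Type v} (F M : Set (A × P)) : Prop :=
  IsMatching F M ∧ ∀ N, IsMatching F N → N.ncard ≤ M.ncard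

def Matched {A : Type u} {P : Type v} (M : Set (A × P)) (x : A ⊕ P) : Prop :=
  ∃ e ∈ M, Incident e x

/-- `p 0, …, p k` is an alternating path of length `k` in the graph with edge set `F`: its vertices
are distinct, and its edges are alternately outside and inside `M`, the first one being outside
(as it has to be when `p 0` is unmatched). -/
def IsAltPath {A : Type u} {P : Type v} (F M : Set (A × P)) (k : ℕ) (p : ℕ → A ⊕ P) : Prop :=
  Set.InjOn p (Set.Iic k) ∧
    ∀ t < k, ∃ e ∈ F, Joins e (p t) (p (t + 1)) ∧ (e ∈ M ↔ Odd t)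

def pathEdges {A : Type u} {P : Type v} (k : ℕ) (p : ℕ → A ⊕ P) : Set (A × P) :=
  {e | ∃ t < k, Joins e (p t) (p (t + 1))}

/-- `M'` arises from `M` by augmenting along an augmenting path of the graph with edge set `F` that
starts at the vertex `x`. -/
def AugmentsFrom {A : Type u} {P : Type v} (F M : Set (A × P)) (x : A ⊕ P)
    (M' : Set (A × P)) : Prop :=
  ∃ k p, p 0 = x ∧ Odd k ∧ IsAltPath F M k p ∧ ¬ Matched M (p 0) ∧ ¬ Matched M (p k) ∧
    M' = symmDiff M (pathEdges k p)

/-- One augmentation step. -/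
def Augments {A : Type u} {P : Type v} (F M M' : Set (A × P)) : Prop :=
  ∃ x, AugmentsFrom F M x M'

/-- The edges of `M` of rank at most `i`. -/
def upToRank {A : Type u} {P : Type v} (rank : A × P → ℕ) (M : Set (A × P)) (i : ℕ) :
    Set (A × P) :=
  {e ∈ M | rank e ≤ i}

namespace RankInstance

variable {A : Type u} {P : Type v}

def vertices (I : RankInstance A P) : Set (A ⊕ P) :=
  Sum.inl '' I.applicants ∪ Sum.inr '' I.posts

noncomputable def numVertices (I : RankInstance A P) : ℕ := I.applicants.ncard + I.posts.ncard

noncomputable def numEdges (I : RankInstance A P) : ℕ := I.edges.ncard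

/-- The instance without the vertex `d` (an applicant or a post) and the edges incident to it. -/
def delete (I : RankInstance A P) (d : A ⊕ P) : RankInstance A P where
  applicants := {a ∈ I.applicants | Sum.inl a ≠ d}
  posts := {p ∈ I.posts | Sum.inr p ≠ d}
  edges := {e ∈ I.edges | ¬ Incident e d}
  rank := I.rank
  applicants_finite := I.applicants_finite.subset (Set.sep_subset _ _)
  posts_finite := I.posts_finite.subset (Set.sep_subset _ _)
  edges_subset := fun e he => by
    have h := I.edges_subset he.1
    exact ⟨⟨h.1, fun h' => he.2 (Or.inl h'.symm)⟩, ⟨h.2, fun h' => he.2 (Or.inr h'.symm)⟩⟩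
  one_le_rank := fun e he => I.one_le_rank e he.1

/-- The `k`-th entry of the signature of `M`. -/
noncomputable def signature (I : RankInstance A P) (M : Set (A × P)) (k : ℕ) : ℕ :=
  {e ∈ M | I.rank e = k}.ncard

/-- The matching `M` has a better signature than `N` (lexicographic order). -/
def Better (I : RankInstance A P) (M N : Set (A × P)) : Prop :=
  ∃ k, (∀ i < k, I.signature M i = I.signature N i) ∧ I.signature N k < I.signature M k

def RankMaximal (I : RankInstance A P) (M : Set (A × P)) : Prop :=
  IsMatching I.edges M ∧ ∀ N, IsMatching I.edges N → ¬ I.Better N M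

/-! ## Even, odd and unreachable vertices -/

/-- `x` is even: there is an alternating path of even length from an unmatched vertex to `x`. -/
def IsEven (I : RankInstance A P) (F M : Set (A × P)) (x : A ⊕ P) : Prop :=
  ∃ k p, p 0 ∈ I.vertices ∧ ¬ Matched M (p 0) ∧ IsAltPath F M k p ∧ p k = x ∧ Even k

/-- `x` is odd: there is an alternating path of odd length from an unmatched vertex to `x`. -/
def IsOdd (I : RankInstance A P) (F M : Set (A × P)) (x : A ⊕ P) : Prop :=
  ∃ k p, p 0 ∈ I.vertices ∧ ¬ Matched M (p 0) ∧ IsAltPath F M k p ∧ p k = x ∧ Odd k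

/-- `x` is unreachable: there is no alternating path from an unmatched vertex to `x`. -/
def IsUnreachable (I : RankInstance A P) (F M : Set (A × P)) (x : A ⊕ P) : Prop :=
  x ∈ I.vertices ∧
    ¬ ∃ k p, p 0 ∈ I.vertices ∧ ¬ Matched M (p 0) ∧ IsAltPath F M k p ∧ p k = x

end RankInstance

/-- The data produced stage by stage: at stage `i`, the graph `pre i` in which the matching `M i` is
computed and the vertices are labelled, and the reduced graph `red i` that is left once the
odd–odd and odd–unreachable edges have been deleted from `pre i`. -/
structure Trace (A : Type u) (P : Type v) where
  M : ℕ → Set (A × P)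
  pre : ℕ → Set (A × P)
  red : ℕ → Set (A × P)

namespace RankInstance

variable {A : Type u} {P : Type v}

def OddAt (I : RankInstance A P) (t : Trace A P) (i : ℕ) (x : A ⊕ P) : Prop :=
  I.IsOdd (t.pre i) (t.M i) x

def EvenAt (I : RankInstance A P) (t : Trace A P) (i : ℕ) (x : A ⊕ P) : Prop :=
  I.IsEven (t.pre i) (t.M i) x

def UnreachableAt (I : RankInstance A P) (t : Trace A P) (i : ℕ) (x : A ⊕ P) : Prop :=
  I.IsUnreachable (t.pre i) (t.M i) x

/-- `x` is odd or unreachable at stage `i`. -/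
def BlockedAt (I : RankInstance A P) (t : Trace A P) (i : ℕ) (x : A ⊕ P) : Prop :=
  I.OddAt t i x ∨ I.UnreachableAt t i x

/-- The set `T` after stage `i`: the vertices that were odd or unreachable at one of the stages
`1, …, i`. All their edges of rank larger than that stage are deleted. -/
def closedBy (I : RankInstance A P) (t : Trace A P) (i : ℕ) : Set (A ⊕ P) :=
  {x | ∃ k, 1 ≤ k ∧ k ≤ i ∧ I.BlockedAt t k x}

/-- The edges between an odd vertex and an odd or unreachable vertex at stage `i`. -/
def uselessEdges (I : RankInstance A P) (t : Trace A P) (i : ℕ) : Set (A × P) :=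
  {e | ∃ x y, Joins e x y ∧ I.OddAt t i x ∧ I.BlockedAt t i y}

/-- `t` records the first `r` stages of an execution of the algorithm of Irving et al. on `I`. -/
structure IsIrvingRun (I : RankInstance A P) (r : ℕ) (t : Trace A P) : Prop where
  M_zero : t.M 0 = ∅
  red_zero : t.red 0 = ∅
  /-- Edges of rank `i + 1` are added, unless they have been deleted at an earlier stage. -/
  pre_succ : ∀ i < r, t.pre (i + 1) = t.red i ∪
    {e ∈ I.edges | I.rank e = i + 1 ∧ ∀ x, Incident e x → x ∉ I.closedBy t i}
  /-- The matching is augmented to a maximum matching. -/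
  augmented : ∀ i < r, Relation.ReflTransGen (Augments (t.pre (i + 1))) (t.M i) (t.M (i + 1))
  maximum : ∀ i < r, IsMaximumMatching (t.pre (i + 1)) (t.M (i + 1))
  red_succ : ∀ i < r, t.red (i + 1) = t.pre (i + 1) \ I.uselessEdges t (i + 1)

/-! ## The vertex-deletion algorithm -/

/-- The set `S` after stage `i` of the deletion of `d` (`g` is the stored trace of the instance `I`,
`t` the trace under construction): the vertices that have changed from odd or unreachable to
even at some stage and have not been odd or unreachable in the new instance so far. -/
def reopened (I : RankInstance A P) (d : A ⊕ P) (g t : Trace A P) : ℕ → Set (A ⊕ P)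
  | 0 => ∅
  | i + 1 => (reopened I d g t i ∪
      {x | I.BlockedAt g (i + 1) x ∧ (I.delete d).EvenAt t (i + 1) x}) \
        (I.delete d).closedBy t (i + 1)

/-- The matching with which stage `i` starts, after the stage at which `d` was matched: the
matching of stage `i - 1` with the edges of `M` of rank at most `i` that are disjoint from it. -/
def carried (I : RankInstance A P) (M : Set (A × P)) (d : A ⊕ P) (t : Trace A P) (i : ℕ) :
    Set (A × P) :=
  t.M (i - 1) ∪ {e ∈ upToRank I.rank M i | ¬ Incident e d ∧
    ∀ x, Incident e x → ¬ Matched (t.M (i - 1)) x}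

/-- The vertices of the new instance that have lost their partner at stage `i`: they are matched in
`M` by an edge of rank at most `i` and unmatched when stage `i` starts. -/
def freed (I : RankInstance A P) (M : Set (A × P)) (d : A ⊕ P) (t : Trace A P) (i : ℕ) :
    Set (A ⊕ P) :=
  {x ∈ (I.delete d).vertices | Matched (upToRank I.rank M i) x ∧ ¬ Matched (I.carried M d t i) x}

/-- `t` is the trace of an execution of the vertex-deletion algorithm: the vertex `d` is deleted from
`I`, and the algorithm is given the number `r` of stages, the rank-maximal matching `M` of `I` and
the stored trace `g` of `I`. -/
structure IsDeletionRun (I : RankInstance A P) (r : ℕ) (M : Set (A × P)) (g : Trace A P)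
    (d : A ⊕ P) (t : Trace A P) : Prop where
  M_zero : t.M 0 = ∅
  red_zero : t.red 0 = ∅
  /-- The graph of stage `i + 1` is made from that of stage `i` and from the stored graph: the edges of
  rank `i + 1` of the stored graph and those on the vertices in `S` are added, except for the
  edges on `d` and on the vertices in `T`. -/
  pre_succ : ∀ i < r, t.pre (i + 1) = t.red i ∪
    {e ∈ (I.delete d).edges | I.rank e = i + 1 ∧
      (e ∈ g.pre (i + 1) ∨ ∃ x ∈ I.reopened d g t i, Incident e x) ∧
      ∀ x, Incident e x → x ∉ (I.delete d).closedBy t i}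
  /-- Labels are recomputed, and the odd–odd and odd–unreachable edges are deleted. -/
  red_succ : ∀ i < r, t.red (i + 1) = t.pre (i + 1) \ (I.delete d).uselessEdges t (i + 1)
  /-- As long as `d` is unmatched (for ever, if `d` is unmatched in `M`), the matching is kept. -/
  before : ∀ i ≤ r, ¬ Matched (upToRank I.rank M i) d → t.M i = upToRank I.rank M i
  /-- At the stage at which `d` was matched, to the vertex `w` by the edge `e`: if `w` was odd, the
  matching without `e` is augmented along a path that starts at `w`. -/
  atOdd : ∀ e ∈ M, ∀ w, Joins e d w → I.OddAt g (I.rank e) w →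
    AugmentsFrom (t.pre (I.rank e)) (upToRank I.rank M (I.rank e) \ {e}) w (t.M (I.rank e))
  /-- If `w` was unreachable or even, there is no augmentation at this stage. -/
  atUnreachable : ∀ e ∈ M, ∀ w, Joins e d w → I.UnreachableAt g (I.rank e) w →
    t.M (I.rank e) = upToRank I.rank M (I.rank e) \ {e}
  atEven : ∀ e ∈ M, ∀ w, Joins e d w → I.EvenAt g (I.rank e) w →
    t.M (I.rank e) = upToRank I.rank M (I.rank e) \ {e}
  /-- At every later stage, the matching is augmented once, along a path that starts at a vertex that
  has lost its partner, if there is such a path; otherwise it is not augmented. -/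
  afterAugment : ∀ e ∈ M, Incident e d → ∀ i ≤ r, I.rank e < i →
    (∃ x ∈ I.freed M d t i, ∃ N, AugmentsFrom (t.pre i) (I.carried M d t i) x N) →
    ∃ x ∈ I.freed M d t i, AugmentsFrom (t.pre i) (I.carried M d t i) x (t.M i)
  afterKeep : ∀ e ∈ M, Incident e d → ∀ i ≤ r, I.rank e < i →
    (¬ ∃ x ∈ I.freed M d t i, ∃ N, AugmentsFrom (t.pre i) (I.carried M d t i) x N) →
    t.M i = I.carried M d t i

/-! ## The stored information -/

/-- The stage (among `1, …, r`) at which the edge `e` is deleted, and `0` if it never is: either an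
end-point of `e` is odd or unreachable at a stage smaller than the rank of `e`, or `e` is missing
from the reduced graph of a stage at least its rank. -/
noncomputable def edgeStage (I : RankInstance A P) (r : ℕ) (t : Trace A P) (e : A × P) : ℕ :=
  sInf {k | 1 ≤ k ∧ k ≤ r ∧
    ((k < I.rank e ∧ ∃ x, Incident e x ∧ I.BlockedAt t k x) ∨ (I.rank e ≤ k ∧ e ∉ t.red k))}

/-- The first stage (among `1, …, r`) at which `x` is odd or unreachable, and `0` if there is none. -/
noncomputable def vertexStage (I : RankInstance A P) (r : ℕ) (t : Trace A P) (x : A ⊕ P) : ℕ :=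
  sInf {k | 1 ≤ k ∧ k ≤ r ∧ I.BlockedAt t k x}

end RankInstance

/-! ## A random access machine

Programs have finitely many registers and finitely many arrays of natural numbers, with indirect
addressing. The only arithmetic operations are successor and predecessor, so that all numbers stay
below the largest input number plus the running time plus a constant; each elementary operation
costs one step. -/

/-- The memory: registers, and cells of arrays (array number, then index). -/
structure Store where
  reg : ℕ → ℕ
  cell : ℕ → ℕ → ℕ

def Store.setReg (s : Store) (x n : ℕ) : Store :=
  { s with reg := Function.update s.reg x n }

def Store.setCell (s : Store) (a i n : ℕ) : Store :=
  { s with cell := Function.update s.cell a (Function.update (s.cell a) i n) }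

inductive Expr where
  | lit (n : ℕ)
  | reg (x : ℕ)
  | cell (a : ℕ) (i : Expr)
  | succ (e : Expr)
  | pred (e : Expr)

def Expr.eval (s : Store) : Expr → ℕ
  | .lit n => n
  | .reg x => s.reg x
  | .cell a i => s.cell a (i.eval s)
  | .succ e => e.eval s + 1
  | .pred e => e.eval s - 1

/-- The number of elementary operations in the evaluation of an expression. -/
def Expr.cost : Expr → ℕ
  | .lit _ => 1
  | .reg _ => 1
  | .cell _ i => i.cost + 1
  | .succ e => e.cost + 1
  | .pred e => e.cost + 1

inductive Test where
  | eq (e f : Expr)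
  | lt (e f : Expr)

def Test.holds (s : Store) : Test → Prop
  | .eq e f => e.eval s = f.eval s
  | .lt e f => e.eval s < f.eval s

def Test.cost : Test → ℕ
  | .eq e f => e.cost + f.cost + 1
  | .lt e f => e.cost + f.cost + 1

inductive Prog where
  | skip
  | setReg (x : ℕ) (e : Expr)
  | setCell (a : ℕ) (i e : Expr)
  | seq (p q : Prog)
  | ite (c : Test) (p q : Prog)
  | loop (c : Test) (p : Prog)

/-- `Exec p s s' t`: the program `p`, started with memory `s`, halts with memory `s'` after `t`
steps. -/
inductive Exec : Prog → Store → Store → ℕ → Prop where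
  | skip (s : Store) : Exec .skip s s 1
  | setReg (s : Store) (x : ℕ) (e : Expr) :
      Exec (.setReg x e) s (s.setReg x (e.eval s)) (e.cost + 1)
  | setCell (s : Store) (a : ℕ) (i e : Expr) :
      Exec (.setCell a i e) s (s.setCell a (i.eval s) (e.eval s)) (i.cost + e.cost + 1)
  | seq {p q : Prog} {s₁ s₂ s₃ : Store} {t₁ t₂ : ℕ} (h₁ : Exec p s₁ s₂ t₁)
      (h₂ : Exec q s₂ s₃ t₂) : Exec (.seq p q) s₁ s₃ (t₁ + t₂)
  | iteTrue {c : Test} {p q : Prog} {s s' : Store} {t : ℕ} (hc : c.holds s)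
      (h : Exec p s s' t) : Exec (.ite c p q) s s' (c.cost + t)
  | iteFalse {c : Test} {p q : Prog} {s s' : Store} {t : ℕ} (hc : ¬ c.holds s)
      (h : Exec q s s' t) : Exec (.ite c p q) s s' (c.cost + t)
  | loopStop {c : Test} {p : Prog} {s : Store} (hc : ¬ c.holds s) :
      Exec (.loop c p) s s c.cost
  | loopStep {c : Test} {p : Prog} {s₁ s₂ s₃ : Store} {t₁ t₂ : ℕ} (hc : c.holds s₁)
      (h₁ : Exec p s₁ s₂ t₁) (h₂ : Exec (.loop c p) s₂ s₃ t₂) :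
      Exec (.loop c p) s₁ s₃ (c.cost + t₁ + t₂)

/-! ## Memory layout -/

/-- A numbering of the vertices by `0, …, n - 1` and of the edges by `0, …, m - 1`. -/
structure CellNumbering {A : Type u} {P : Type v} (I : RankInstance A P) where
  vertex : A ⊕ P → ℕ
  edge : A × P → ℕ
  vertex_bijOn : Set.BijOn vertex I.vertices (Set.Iio I.numVertices)
  edge_bijOn : Set.BijOn edge I.edges (Set.Iio I.numEdges)

/-- The memory `s` holds, under the numbering `ν`, the instance `I`, the matching `M` and the stored
information on the trace `t`. The cell of an edge holds in array 0 its applicant, in array 1 its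
post, in array 2 its rank, in array 3 one bit telling whether it is in `M`, and in array 4 the
stage at which it is deleted. The cell of a vertex holds in array 5 the stage at which it becomes
odd or unreachable and in array 6 one bit telling which of the two happens then. The program may
find anything in all other cells. -/
structure Store.Holds {A : Type u} {P : Type v} {G : RankInstance A P} (s : Store)
    (ν : CellNumbering G) (I : RankInstance A P) (r : ℕ) (M : Set (A × P)) (t : Trace A P) : Prop where
  applicant : ∀ e ∈ I.edges, s.cell 0 (ν.edge e) = ν.vertex (Sum.inl e.1)
  post : ∀ e ∈ I.edges, s.cell 1 (ν.edge e) = ν.vertex (Sum.inr e.2)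
  rank : ∀ e ∈ I.edges, s.cell 2 (ν.edge e) = I.rank e
  mem : ∀ e ∈ I.edges, e ∈ M → s.cell 3 (ν.edge e) = 1
  notMem : ∀ e ∈ I.edges, e ∉ M → s.cell 3 (ν.edge e) = 0
  edgeStage : ∀ e ∈ I.edges, s.cell 4 (ν.edge e) = I.edgeStage r t e
  vertexStage : ∀ x ∈ I.vertices, s.cell 5 (ν.vertex x) = I.vertexStage r t x
  odd : ∀ x ∈ I.vertices, I.vertexStage r t x ≠ 0 →
    I.OddAt t (I.vertexStage r t x) x → s.cell 6 (ν.vertex x) = 0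
  unreachable : ∀ x ∈ I.vertices, I.vertexStage r t x ≠ 0 →
    I.UnreachableAt t (I.vertexStage r t x) x → s.cell 6 (ν.vertex x) = 1

/-- The input of the update program: `G`, `M` and the stored information are in the arrays, and the
first four registers hold the numbers of vertices, edges and stages and the vertex `d`. -/
structure Store.IsInput {A : Type u} {P : Type v} {G : RankInstance A P} (s : Store)
    (ν : CellNumbering G) (r : ℕ) (M : Set (A × P)) (g : Trace A P) (d : A ⊕ P) : Prop where
  holds : s.Holds ν G r M g
  numVertices : s.reg 0 = G.numVertices
  numEdges : s.reg 1 = G.numEdges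
  stages : s.reg 2 = r
  deleted : s.reg 3 = ν.vertex d

/-!
Why the vertex-deletion algorithm is correct, and why it is fast.

*The graphs are canonical.* In a bipartite graph the labels do not depend on the maximum matching
they are computed from: a vertex is even iff some maximum matching misses it (`isEven_iff`), and
odd iff it has an even neighbour (`isOdd_iff`). Hence the graphs of Irving et al.'s algorithm are
determined by the instance alone; they are defined below without reference to matchings, as
`stageGraph` (before the deletions of a stage) and `reducedGraph` (after them). Among the matchings
that use only edges of rank at most `i`, those with the lexicographically largest signature are
exactly the maximum matchings of the `i`-th stage graph that cover all vertices which were odd or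
unreachable at an earlier stage (`Optimal.isMaximumMatching`, `optimal_of_isMaximumMatching`).

*One path repairs the matching.* Let `d` be covered by an optimal matching `M` for the ranks up to
`i`. In the symmetric difference of `M` and an optimal matching of the instance without `d`, only
the component of `d` matters: exchanging along it shows that some optimal matching of the smaller
instance covers the vertices of `M` except `d`, and either one vertex less or one vertex more
(`Optimal.exists_delete`). So a matching in the smaller stage graph that has lost just `d` and one
more vertex is maximum, unless an augmenting path starts at the lost vertex
(`isMaximumMatching_or_augmentsFrom`). This makes `DeletionState` an invariant: before the rank of
the edge at `d` the matching is unchanged, and afterwards it covers the vertices of `M` except `d`,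
and either one less or one more (`DeletionState.step`). All the cases that the algorithm
distinguishes are instances of one uniform `DeletionStep`; at the rank of the edge at `d`, the
partner of `d` starts an augmenting path iff it was odd in the original instance
(`augmentsFrom_iff_mem_oddSet`). The edges which the algorithm adds because an end-point has become
even again are those by which the stage graphs of the smaller instance exceed the original ones
(`stageGraph_delete_succ`). Together these give `isDeletionRun_of_steps` and
`IsDeletionRun.correct`.

*The program.* Since the graphs are canonical, the program may rebuild those of the smaller instance
from the edges and their ranks, and it needs only `M` from the execution on the given instance. In
every stage it links the edges of the stage graph into adjacency lists, extends the matching by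
edges of `M`, and runs two breadth-first searches for alternating paths: one from the lost vertex,
along whose result it augments, and one from all unmatched vertices, from which the labels and the
deleted edges are read off. A search looks at each edge at most twice, so a stage takes time linear
in the numbers of vertices and edges (`searchLoop_spec`, `augmentLost_spec`, `computeLabels_spec`,
`stageProgram_spec`, `deletionProgram_spec`).

*Memory.* Registers 0 to 3 hold the numbers of vertices, of edges and of stages, and `d`;
register 4 the stage, 5 a loop counter, 6 to 10 and 14 the variables of the search, 11 the lost
vertex plus one (or zero), and 12 is auxiliary. Arrays 0 to 6 are as in the input: end-points and
ranks of the edges, the matching, and the stored information. Array 7 holds the heads of the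
adjacency lists, 8 and 9 the links at the two end-points of each edge, 10 the partners, 11 the
parents in the search, 12 the marks of the even vertices and 13 the queue.
-/

/-! ### Edges, end-points and matchings -/

section Matchings

variable {A : Type u} {P : Type v}

namespace Joins

theorem symm {e : A × P} {x y : A ⊕ P} (h : Joins e x y) : Joins e y x :=
  h.elim (fun h => Or.inr ⟨h.2, h.1⟩) (fun h => Or.inl ⟨h.2, h.1⟩)

theorem incident_left {e : A × P} {x y : A ⊕ P} (h : Joins e x y) : Incident e x :=
  h.elim (fun h => Or.inl h.1) (fun h => Or.inr h.1)

theorem incident_right {e : A × P} {x y : A ⊕ P} (h : Joins e x y) : Incident e y :=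
  h.symm.incident_left

theorem edge_unique {e f : A × P} {x y : A ⊕ P} (h : Joins e x y) (h' : Joins f x y) : e = f := by
  rcases e with ⟨a, p⟩
  rcases f with ⟨b, q⟩
  rcases h with ⟨rfl, rfl⟩ | ⟨rfl, rfl⟩ <;> rcases h' with ⟨h1, h2⟩ | ⟨h1, h2⟩ <;> simp_all

theorem right_unique {e : A × P} {x y z : A ⊕ P} (h : Joins e x y) (h' : Joins e x z) : y = z := by
  rcases h with ⟨rfl, rfl⟩ | ⟨rfl, rfl⟩ <;> rcases h' with ⟨h1, h2⟩ | ⟨h1, h2⟩ <;> simp_all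

theorem isLeft_eq {e : A × P} {x y : A ⊕ P} (h : Joins e x y) : y.isLeft = !x.isLeft := by
  rcases h with ⟨rfl, rfl⟩ | ⟨rfl, rfl⟩ <;> rfl

theorem ne {e : A × P} {x y : A ⊕ P} (h : Joins e x y) : x ≠ y := by
  rintro rfl
  have := h.isLeft_eq
  cases hx : x.isLeft <;> simp [hx] at this

theorem eq_or_eq {e : A × P} {x y z : A ⊕ P} (h : Joins e x y) (hz : Incident e z) :
    z = x ∨ z = y := by
  rcases h with ⟨rfl, rfl⟩ | ⟨rfl, rfl⟩ <;> rcases hz with rfl | rfl <;> simp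

end Joins

theorem joins_mk (e : A × P) : Joins e (Sum.inl e.1) (Sum.inr e.2) := Or.inl ⟨rfl, rfl⟩

theorem Incident.exists_joins {e : A × P} {x : A ⊕ P} (h : Incident e x) : ∃ y, Joins e x y :=
  h.elim (fun h => ⟨_, Or.inl ⟨h, rfl⟩⟩) (fun h => ⟨_, Or.inr ⟨h, rfl⟩⟩)

theorem Matched.mono {M N : Set (A × P)} (h : M ⊆ N) {x : A ⊕ P} (hx : Matched M x) :
    Matched N x :=
  hx.imp fun _ he => ⟨h he.1, he.2⟩

theorem Joins.matched_left {M : Set (A × P)} {e : A × P} {x y : A ⊕ P} (h : Joins e x y)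
    (he : e ∈ M) : Matched M x := ⟨e, he, h.incident_left⟩

theorem Joins.matched_right {M : Set (A × P)} {e : A × P} {x y : A ⊕ P} (h : Joins e x y)
    (he : e ∈ M) : Matched M y := ⟨e, he, h.incident_right⟩

namespace IsMatching

variable {F M N : Set (A × P)}

theorem eq_of_incident (h : IsMatching F M) {e f : A × P} {x : A ⊕ P} (he : e ∈ M) (hf : f ∈ M)
    (hex : Incident e x) (hfx : Incident f x) : e = f := h.2 e he f hf x hex hfx

theorem partner_unique (h : IsMatching F M) {e f : A × P} {x y z : A ⊕ P} (he : e ∈ M)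
    (hf : f ∈ M) (hx : Joins e x y) (hy : Joins f x z) : y = z := by
  obtain rfl := h.eq_of_incident he hf hx.incident_left hy.incident_left
  exact hx.right_unique hy

theorem subset (h : IsMatching F M) (hN : N ⊆ M) : IsMatching F N :=
  ⟨hN.trans h.1, fun e he f hf => h.2 e (hN he) f (hN hf)⟩

theorem of_subset {F' : Set (A × P)} (h : IsMatching F M) (hM : M ⊆ F') : IsMatching F' M :=
  ⟨hM, h.2⟩

theorem mono {F' : Set (A × P)} (h : IsMatching F M) (hF : F ⊆ F') : IsMatching F' M :=
  ⟨h.1.trans hF, h.2⟩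

theorem finite (h : IsMatching F M) (hF : F.Finite) : M.Finite := hF.subset h.1

theorem empty : IsMatching F (∅ : Set (A × P)) :=
  ⟨Set.empty_subset _, fun _ he => absurd he (Set.notMem_empty _)⟩

theorem matched_finite (hM : M.Finite) : {x : A ⊕ P | Matched M x}.Finite := by
  have : {x : A ⊕ P | Matched M x} = Sum.inl '' (Prod.fst '' M) ∪ Sum.inr '' (Prod.snd '' M) := by
    ext x
    constructor
    · rintro ⟨e, he, rfl | rfl⟩
      · exact Or.inl ⟨_, ⟨e, he, rfl⟩, rfl⟩
      · exact Or.inr ⟨_, ⟨e, he, rfl⟩, rfl⟩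
    · rintro (⟨_, ⟨e, he, rfl⟩, rfl⟩ | ⟨_, ⟨e, he, rfl⟩, rfl⟩)
      · exact ⟨e, he, Or.inl rfl⟩
      · exact ⟨e, he, Or.inr rfl⟩
  rw [this]
  exact ((hM.image _).image _).union ((hM.image _).image _)

/-- A finite matching covers twice as many vertices as it has edges. -/
theorem ncard_matched (h : IsMatching F M) (hM : M.Finite) :
    {x : A ⊕ P | Matched M x}.ncard = 2 * M.ncard := by
  have h1 : Set.InjOn (fun e : A × P => (Sum.inl e.1 : A ⊕ P)) M := fun e he f hf hef =>
    h.2 e he f hf _ (Or.inl rfl) (Or.inl hef)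
  have h2 : Set.InjOn (fun e : A × P => (Sum.inr e.2 : A ⊕ P)) M := fun e he f hf hef =>
    h.2 e he f hf _ (Or.inr rfl) (Or.inr hef)
  have : {x : A ⊕ P | Matched M x} = (fun e : A × P => (Sum.inl e.1 : A ⊕ P)) '' M ∪
      (fun e : A × P => (Sum.inr e.2 : A ⊕ P)) '' M := by
    ext x
    constructor
    · rintro ⟨e, he, rfl | rfl⟩
      · exact Or.inl ⟨e, he, rfl⟩
      · exact Or.inr ⟨e, he, rfl⟩
    · rintro (⟨e, he, rfl⟩ | ⟨e, he, rfl⟩)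
      · exact ⟨e, he, Or.inl rfl⟩
      · exact ⟨e, he, Or.inr rfl⟩
  rw [this, Set.ncard_union_eq ?_ (hM.image _) (hM.image _), h1.ncard_image,
    h2.ncard_image, two_mul]
  rw [Set.disjoint_left]
  rintro _ ⟨e, _, rfl⟩ ⟨f, _, hf⟩
  cases hf

/-- A matching that covers at least the vertices of another one is at least as large. -/
theorem ncard_le_of_matched {F' : Set (A × P)} (hM : IsMatching F M) (hN : IsMatching F' N)
    (fM : M.Finite) (fN : N.Finite) (h : ∀ x, Matched M x → Matched N x) :
    M.ncard ≤ N.ncard := by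
  have := Set.ncard_le_ncard (s := {x | Matched M x}) (t := {x | Matched N x}) h
    (matched_finite fN)
  rw [hM.ncard_matched fM, hN.ncard_matched fN] at this
  omega

/-- A smaller matching misses a vertex covered by a larger one. -/
theorem exists_matched_of_ncard_lt {F' : Set (A × P)} (hM : IsMatching F M)
    (hN : IsMatching F' N) (fM : M.Finite) (fN : N.Finite) (h : M.ncard < N.ncard) :
    ∃ x, Matched N x ∧ ¬ Matched M x := by
  by_contra! hc
  exact absurd (hN.ncard_le_of_matched hM fN fM hc) (by omega)

end IsMatching

/-! ### Alternating paths and augmentation -/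

namespace IsAltPath

variable {F M : Set (A × P)} {k : ℕ} {p : ℕ → A ⊕ P}

theorem initial {l : ℕ} (h : IsAltPath F M k p) (hl : l ≤ k) : IsAltPath F M l p :=
  ⟨h.1.mono (Set.Iic_subset_Iic.2 hl), fun t ht => h.2 t (by omega)⟩

theorem isLeft_eq (h : IsAltPath F M k p) {t : ℕ} (ht : t ≤ k) :
    (p t).isLeft = ((p 0).isLeft ^^ decide (Odd t)) := by
  induction t with
  | zero => simp
  | succ t ih =>
    obtain ⟨e, _, he, _⟩ := h.2 t (by omega)
    rw [he.isLeft_eq, ih (by omega)]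
    by_cases ho : Odd t
    · have : ¬ Odd (t + 1) := by rw [Nat.odd_add_one]; simpa using ho
      simp [ho, this]
    · have : Odd (t + 1) := by rw [Nat.odd_add_one]; simpa using ho
      simp [ho, this]

/-- A new vertex extends an alternating path. -/
theorem extend (h : IsAltPath F M k p) {e : A × P} {z : A ⊕ P} (he : e ∈ F)
    (hj : Joins e (p k) z) (hM : e ∈ M ↔ Odd k) (hz : ∀ t ≤ k, p t ≠ z) :
    IsAltPath F M (k + 1) (Function.update p (k + 1) z) := by
  have hp : ∀ t ≤ k, Function.update p (k + 1) z t = p t := fun t ht =>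
    Function.update_of_ne (by omega) _ _
  constructor
  · intro s hs t ht hst
    simp only [Set.mem_Iic] at hs ht
    rcases Nat.lt_or_ge k s with hs' | hs' <;> rcases Nat.lt_or_ge k t with ht' | ht'
    · omega
    · obtain rfl : s = k + 1 := by omega
      rw [hp t ht', Function.update_self] at hst
      exact absurd hst.symm (hz t ht')
    · obtain rfl : t = k + 1 := by omega
      rw [hp s hs', Function.update_self] at hst
      exact absurd hst (hz s hs')
    · rw [hp s hs', hp t ht'] at hst
      exact h.1 hs' ht' hst
  · intro t ht
    rcases Nat.lt_or_ge t k with ht' | ht'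
    · rw [hp t ht'.le, hp (t + 1) ht']
      exact h.2 t ht'
    · obtain rfl : t = k := by omega
      rw [hp t le_rfl, Function.update_self]
      exact ⟨e, he, hj, hM⟩

end IsAltPath

theorem mem_symmDiff_pathEdges {F M : Set (A × P)} {k : ℕ} {p : ℕ → A ⊕ P}
    (hp : IsAltPath F M k p) {e : A × P} :
    e ∈ symmDiff M (pathEdges k p) ↔
      (e ∈ M ∧ e ∉ pathEdges k p) ∨ ∃ t < k, Even t ∧ Joins e (p t) (p (t + 1)) := by
  rw [Set.mem_symmDiff]
  refine or_congr Iff.rfl ⟨?_, ?_⟩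
  · rintro ⟨⟨t, ht, hj⟩, he⟩
    obtain ⟨f, _, hfj, hf⟩ := hp.2 t ht
    obtain rfl := hj.edge_unique hfj
    exact ⟨t, ht, by simpa using mt hf.2 he, hj⟩
  · rintro ⟨t, ht, hte, hj⟩
    refine ⟨⟨t, ht, hj⟩, fun he => ?_⟩
    obtain ⟨f, _, hfj, hf⟩ := hp.2 t ht
    obtain rfl := hj.edge_unique hfj
    exact (Nat.not_odd_iff_even.2 hte) (hf.1 he)

/-- An edge of the matching at a vertex of an augmenting path belongs to the path. -/
theorem mem_pathEdges_of_incident {F M : Set (A × P)} {k : ℕ} {p : ℕ → A ⊕ P}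
    (hM : IsMatching F M) (hk : Odd k) (hp : IsAltPath F M k p) (h0 : ¬ Matched M (p 0))
    (h1 : ¬ Matched M (p k)) {e : A × P} (he : e ∈ M) {t : ℕ} (ht : t ≤ k)
    (hx : Incident e (p t)) : e ∈ pathEdges k p := by
  rcases Nat.even_or_odd t with hte | hto
  · rcases t with _ | t
    · exact absurd ⟨e, he, hx⟩ h0
    · obtain ⟨f, _, hfj, hf⟩ := hp.2 t (by omega)
      have : Odd t := by
        by_contra hc
        exact (Nat.not_odd_iff_even.2 hte) (Nat.odd_add_one.2 hc)
      obtain rfl := hM.eq_of_incident he (hf.2 this) hx hfj.incident_right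
      exact ⟨t, by omega, hfj⟩
  · rcases Nat.lt_or_ge t k with htk | htk
    · obtain ⟨f, _, hfj, hf⟩ := hp.2 t htk
      obtain rfl := hM.eq_of_incident he (hf.2 hto) hx hfj.incident_left
      exact ⟨t, htk, hfj⟩
    · obtain rfl : t = k := by omega
      exact absurd ⟨e, he, hx⟩ h1

/-- Augmentation along a given path: the result is a matching, and its covered vertices are the old
ones and the two ends of the path. -/
theorem augment_path {F M : Set (A × P)} {k : ℕ} {p : ℕ → A ⊕ P}
    (hM : IsMatching F M) (hk : Odd k) (hp : IsAltPath F M k p) (h0 : ¬ Matched M (p 0))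
    (h1 : ¬ Matched M (p k)) :
    IsMatching F (symmDiff M (pathEdges k p)) ∧
      ∀ z, Matched (symmDiff M (pathEdges k p)) z ↔ Matched M z ∨ z = p 0 ∨ z = p k := by
  have hcov : ∀ t ≤ k, Matched (symmDiff M (pathEdges k p)) (p t) := by
    intro t ht
    rcases Nat.even_or_odd t with hte | hto
    · have htk : t < k := by
        rcases Nat.lt_or_ge t k with h | h
        · exact h
        · obtain rfl : t = k := by omega
          exact absurd hte (Nat.not_even_iff_odd.2 hk)
      obtain ⟨f, _, hfj, _⟩ := hp.2 t htk
      exact ⟨f, (mem_symmDiff_pathEdges hp).2 (Or.inr ⟨t, htk, hte, hfj⟩), hfj.incident_left⟩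
    · obtain ⟨s, rfl⟩ := hto
      obtain ⟨f, _, hfj, _⟩ := hp.2 (2 * s) (by omega)
      exact ⟨f, (mem_symmDiff_pathEdges hp).2 (Or.inr ⟨2 * s, by omega, by simp, hfj⟩),
        hfj.incident_right⟩
  refine ⟨⟨?_, ?_⟩, ?_⟩
  · intro e he
    rcases (mem_symmDiff_pathEdges hp).1 he with he | ⟨t, ht, _, hj⟩
    · exact hM.1 he.1
    · obtain ⟨f, hf, hfj, _⟩ := hp.2 t ht
      obtain rfl := hj.edge_unique hfj
      exact hf
  · have key : ∀ e, (e ∈ M ∧ e ∉ pathEdges k p) → ∀ t < k, ∀ f, Joins f (p t) (p (t + 1)) →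
        ∀ x, Incident e x → Incident f x → False := by
      intro e he t ht f hf x hex hfx
      rcases hf.eq_or_eq hfx with rfl | rfl
      · exact he.2 (mem_pathEdges_of_incident hM hk hp h0 h1 he.1 (by omega) hex)
      · exact he.2 (mem_pathEdges_of_incident hM hk hp h0 h1 he.1 (by omega) hex)
    intro e he f hf x hex hfx
    rcases (mem_symmDiff_pathEdges hp).1 he with he | ⟨t, ht, hte, hj⟩ <;>
      rcases (mem_symmDiff_pathEdges hp).1 hf with hf | ⟨s, hs, hse, hj'⟩
    · exact hM.2 e he.1 f hf.1 x hex hfx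
    · exact (key e he s hs f hj' x hex hfx).elim
    · exact (key f hf t ht e hj x hfx hex).elim
    · have hst : s = t := by
        rw [Nat.even_iff] at hse hte
        rcases hj.eq_or_eq hex with rfl | rfl <;> rcases hj'.eq_or_eq hfx with h | h <;>
          have := hp.1 (by simp only [Set.mem_Iic]; omega)
            (by simp only [Set.mem_Iic]; omega) h <;> omega
      subst hst
      exact hj.edge_unique hj'
  · intro z
    constructor
    · rintro ⟨e, he, hez⟩
      rcases (mem_symmDiff_pathEdges hp).1 he with he | ⟨t, ht, hte, hj⟩
      · exact Or.inl ⟨e, he.1, hez⟩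
      · have hpath : ∀ s ≤ k, Matched M (p s) ∨ p s = p 0 ∨ p s = p k := by
          intro s hs
          rcases s with _ | s
          · exact Or.inr (Or.inl rfl)
          · rcases Nat.eq_or_lt_of_le hs with rfl | hs
            · exact Or.inr (Or.inr rfl)
            · rcases Nat.even_or_odd s with h | h
              · obtain ⟨f, _, hfj, hf⟩ := hp.2 (s + 1) hs
                exact Or.inl ⟨f, hf.2 (by rw [Nat.odd_add_one]; simpa using h),
                  hfj.incident_left⟩
              · obtain ⟨f, _, hfj, hf⟩ := hp.2 s (by omega)
                exact Or.inl ⟨f, hf.2 h, hfj.incident_right⟩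
        rcases hj.eq_or_eq hez with rfl | rfl
        · exact hpath t (by omega)
        · exact hpath (t + 1) (by omega)
    · rintro (⟨e, he, hez⟩ | rfl | rfl)
      · by_cases hpe : e ∈ pathEdges k p
        · obtain ⟨t, ht, hj⟩ := hpe
          rcases hj.eq_or_eq hez with rfl | rfl
          · exact hcov t (by omega)
          · exact hcov (t + 1) (by omega)
        · exact ⟨e, (mem_symmDiff_pathEdges hp).2 (Or.inl ⟨he, hpe⟩), hez⟩
      · exact hcov 0 (by omega)
      · exact hcov k le_rfl

theorem AugmentsFrom.spec {F M M' : Set (A × P)} {x : A ⊕ P} (h : AugmentsFrom F M x M')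
    (hM : IsMatching F M) : IsMatching F M' ∧ ¬ Matched M x ∧ ∃ y, y ≠ x ∧ ¬ Matched M y ∧
      (∃ e ∈ F, Incident e y) ∧ ∀ z, Matched M' z ↔ Matched M z ∨ z = x ∨ z = y := by
  obtain ⟨k, p, rfl, hk, hp, h0, h1, rfl⟩ := h
  have h := augment_path hM hk hp h0 h1
  have hk0 : 0 < k := hk.pos
  refine ⟨h.1, h0, p k, fun hc => ?_, h1, ?_, h.2⟩
  · have := hp.1 (Set.mem_Iic.2 le_rfl) (Set.mem_Iic.2 (Nat.zero_le k)) hc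
    omega
  · obtain ⟨e, he, hj, _⟩ := hp.2 (k - 1) (by omega)
    rw [Nat.sub_add_cancel hk0] at hj
    exact ⟨e, he, hj.incident_right⟩

theorem AugmentsFrom.ncard_lt {F M M' : Set (A × P)} {x : A ⊕ P} (h : AugmentsFrom F M x M')
    (hM : IsMatching F M) (hF : F.Finite) : M'.ncard = M.ncard + 1 := by
  obtain ⟨h1, hx, y, hyx, hy, _, hz⟩ := h.spec hM
  have hfin := IsMatching.matched_finite (hM.finite hF)
  have e1 := h1.ncard_matched (h1.finite hF)
  have : {z | Matched M' z} = insert x (insert y {z | Matched M z}) := by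
    ext z
    simp only [Set.mem_ofPred_eq, Set.mem_insert_iff, hz]
    tauto
  have hy' : y ∉ {z | Matched M z} := hy
  have hx' : x ∉ insert y {z | Matched M z} := fun h =>
    (Set.mem_insert_iff.1 h).elim (fun h => hyx h.symm) hx
  rw [this, Set.ncard_insert_of_notMem hx' (hfin.insert _), Set.ncard_insert_of_notMem hy' hfin,
    hM.ncard_matched (hM.finite hF)] at e1
  omega

/-- A maximum matching admits no augmenting path. -/
theorem IsMaximumMatching.not_augmentsFrom {F M M' : Set (A × P)} {x : A ⊕ P}
    (hM : IsMaximumMatching F M) (hF : F.Finite) : ¬ AugmentsFrom F M x M' := fun h => by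
  have := hM.2 M' (h.spec hM.1).1
  have := h.ncard_lt hM.1 hF
  omega

end Matchings

/-! ### The symmetric difference of two matchings -/

section SymmetricDifference

variable {A : Type u} {P : Type v}

/-- An inclusion-maximal alternating path `p 0, …, p k` in the union of two matchings `M` and `N`,
starting with an edge of `N` at a vertex that `M` misses: a component of their symmetric
difference, read from one of its ends. -/
structure IsComponentPath (M N : Set (A × P)) (k : ℕ) (p : ℕ → A ⊕ P) : Prop where
  pos : 0 < k
  inj : Set.InjOn p (Set.Iic k)
  even_edge : ∀ t < k, Even t → ∃ e ∈ N, Joins e (p t) (p (t + 1))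
  odd_edge : ∀ t < k, Odd t → ∃ e ∈ M, Joins e (p t) (p (t + 1))
  start : ¬ Matched M (p 0)
  stop_odd : Odd k → ¬ Matched M (p k)
  stop_even : Even k → ¬ Matched N (p k)

theorem exists_componentPath {F M N : Set (A × P)} (hM : IsMatching F M) (hN : IsMatching F N)
    (fM : M.Finite) (fN : N.Finite) {x : A ⊕ P} (hxN : Matched N x) (hxM : ¬ Matched M x) :
    ∃ k p, p 0 = x ∧ IsComponentPath M N k p := by
  by_contra hcon
  push Not at hcon
  have all : ∀ k, ∃ p : ℕ → A ⊕ P, p 0 = x ∧ Set.InjOn p (Set.Iic k) ∧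
      (∀ t < k, Even t → ∃ e ∈ N, Joins e (p t) (p (t + 1))) ∧
      (∀ t < k, Odd t → ∃ e ∈ M, Joins e (p t) (p (t + 1))) := by
    intro k
    induction k with
    | zero =>
      refine ⟨fun _ => x, rfl, ?_, by simp, by simp⟩
      intro s hs t ht _
      simp only [Set.mem_Iic] at hs ht
      omega
    | succ k ih =>
      obtain ⟨p, h0, hinj, hev, hod⟩ := ih
      have hne : ∀ s ≤ k, ∀ t ≤ k, p s = p t → s = t := fun s hs t ht h => hinj hs ht h
      -- the path can be prolonged, since otherwise it would be maximal
      have hext : ∃ z, (∀ t ≤ k, p t ≠ z) ∧ (Even k → ∃ e ∈ N, Joins e (p k) z) ∧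
          (Odd k → ∃ e ∈ M, Joins e (p k) z) := by
        rcases Nat.even_or_odd k with hk | hk
        · have hm : Matched N (p k) := by
            by_contra hc
            rcases Nat.eq_zero_or_pos k with rfl | hpos
            · exact hc (h0 ▸ hxN)
            · exact hcon k p h0 ⟨hpos, hinj, hev, hod, h0 ▸ hxM,
                fun h => absurd hk (Nat.not_even_iff_odd.2 h), fun _ => hc⟩
          obtain ⟨e, he, hep⟩ := hm
          obtain ⟨z, hz⟩ := hep.exists_joins
          refine ⟨z, ?_, fun _ => ⟨e, he, hz⟩, fun h => absurd hk (Nat.not_even_iff_odd.2 h)⟩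
          rintro t ht rfl
          rcases Nat.even_or_odd t with h | h
          · rcases Nat.eq_or_lt_of_le ht with rfl | ht
            · exact hz.ne rfl
            · obtain ⟨f, hf, hj⟩ := hev t ht h
              have := hne _ le_rfl _ ht (hN.partner_unique he hf hz.symm hj)
              rw [this, Nat.even_add_one] at hk
              exact hk h
          · obtain ⟨s, rfl⟩ := h
            obtain ⟨f, hf, hj⟩ := hev (2 * s) (by omega) (by simp)
            have := hne _ le_rfl _ (by omega) (hN.partner_unique he hf hz.symm hj.symm)
            omega
        · have hm : Matched M (p k) := by
            by_contra hc
            exact hcon k p h0 ⟨hk.pos, hinj, hev, hod, h0 ▸ hxM, fun _ => hc,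
              fun h => absurd h (Nat.not_even_iff_odd.2 hk)⟩
          obtain ⟨e, he, hep⟩ := hm
          obtain ⟨z, hz⟩ := hep.exists_joins
          refine ⟨z, ?_, fun h => absurd h (Nat.not_even_iff_odd.2 hk), fun _ => ⟨e, he, hz⟩⟩
          rintro t ht rfl
          rcases Nat.even_or_odd t with h | h
          · rcases t with _ | t
            · exact hxM (h0 ▸ hz.matched_right he)
            · obtain ⟨f, hf, hj⟩ := hod t (by omega) (by
                rw [Nat.even_add_one] at h
                simpa using h)
              have := hne _ le_rfl _ (by omega) (hM.partner_unique he hf hz.symm hj.symm)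
              omega
          · rcases Nat.eq_or_lt_of_le ht with rfl | ht
            · exact hz.ne rfl
            · obtain ⟨f, hf, hj⟩ := hod t ht h
              have := hne _ le_rfl _ ht (hM.partner_unique he hf hz.symm hj)
              rw [this, Nat.odd_add_one] at hk
              exact hk h
      obtain ⟨z, hz, hzN, hzM⟩ := hext
      have hp : ∀ t ≤ k, Function.update p (k + 1) z t = p t := fun t ht =>
        Function.update_of_ne (by omega) _ _
      have hlast : Function.update p (k + 1) z (k + 1) = z := Function.update_self ..
      refine ⟨Function.update p (k + 1) z, by rw [hp 0 (by omega), h0], ?_, ?_, ?_⟩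
      · intro s hs t ht hst
        simp only [Set.mem_Iic] at hs ht
        rcases Nat.lt_or_ge k s with hs' | hs' <;> rcases Nat.lt_or_ge k t with ht' | ht'
        · omega
        · obtain rfl : s = k + 1 := by omega
          rw [hp t ht', hlast] at hst
          exact absurd hst.symm (hz t ht')
        · obtain rfl : t = k + 1 := by omega
          rw [hp s hs', hlast] at hst
          exact absurd hst (hz s hs')
        · rw [hp s hs', hp t ht'] at hst
          exact hne s hs' t ht' hst
      · intro t ht hte
        rcases Nat.lt_or_ge t k with ht' | ht'
        · rw [hp t ht'.le, hp (t + 1) ht']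
          exact hev t ht' hte
        · obtain rfl : t = k := by omega
          rw [hp t le_rfl, hlast]
          exact hzN hte
      · intro t ht hte
        rcases Nat.lt_or_ge t k with ht' | ht'
        · rw [hp t ht'.le, hp (t + 1) ht']
          exact hod t ht' hte
        · obtain rfl : t = k := by omega
          rw [hp t le_rfl, hlast]
          exact hzM hte
  have hfin : ({x} ∪ {z : A ⊕ P | Matched M z} ∪ {z | Matched N z}).Finite :=
    ((Set.finite_singleton x).union (IsMatching.matched_finite fM)).union
      (IsMatching.matched_finite fN)
  obtain ⟨p, h0, hinj, hev, hod⟩ :=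
    all ({x} ∪ {z : A ⊕ P | Matched M z} ∪ {z | Matched N z}).ncard
  have hmaps : ∀ t ∈ Set.Iic ({x} ∪ {z : A ⊕ P | Matched M z} ∪ {z | Matched N z}).ncard,
      p t ∈ {x} ∪ {z : A ⊕ P | Matched M z} ∪ {z | Matched N z} := by
    intro t ht
    rcases t with _ | t
    · exact Or.inl (Or.inl h0)
    · rcases Nat.even_or_odd t with h | h
      · obtain ⟨e, he, hj⟩ := hev t ht h
        exact Or.inr (hj.matched_right he)
      · obtain ⟨e, he, hj⟩ := hod t ht h
        exact Or.inl (Or.inr (hj.matched_right he))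
  have := Set.ncard_le_ncard_of_injOn p hmaps hinj hfin
  rw [← Finset.coe_Iic, Set.ncard_coe_finset, Nat.card_Iic] at this
  omega

namespace IsComponentPath

variable {F M N : Set (A × P)} {k : ℕ} {p : ℕ → A ⊕ P}

theorem exists_mem_right (h : IsComponentPath M N k p) {t : ℕ} (ht : t ≤ k)
    (hx : Even k → t ≠ k) : ∃ s ≤ k, ∃ e ∈ N, Joins e (p t) (p s) := by
  rcases Nat.even_or_odd t with hte | ⟨s, rfl⟩
  · have htk : t < k := lt_of_le_of_ne ht fun htk => hx (htk ▸ hte) htk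
    obtain ⟨e, he, hj⟩ := h.even_edge t htk hte
    exact ⟨t + 1, htk, e, he, hj⟩
  · obtain ⟨e, he, hj⟩ := h.even_edge (2 * s) (by omega) (by simp)
    exact ⟨2 * s, by omega, e, he, hj.symm⟩

theorem exists_mem_left (h : IsComponentPath M N k p) {t : ℕ} (ht : t ≤ k) (h0 : t ≠ 0)
    (hx : Odd k → t ≠ k) : ∃ s ≤ k, ∃ e ∈ M, Joins e (p t) (p s) := by
  rcases Nat.even_or_odd t with hte | hto
  · rcases t with _ | t
    · exact absurd rfl h0
    · obtain ⟨e, he, hj⟩ := h.odd_edge t (by omega) (by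
        rw [Nat.even_add_one] at hte
        simpa using hte)
      exact ⟨t, by omega, e, he, hj.symm⟩
  · have htk : t < k := lt_of_le_of_ne ht fun htk => hx (htk ▸ hto) htk
    obtain ⟨e, he, hj⟩ := h.odd_edge t htk hto
    exact ⟨t + 1, htk, e, he, hj⟩

theorem closed (h : IsComponentPath M N k p) (hM : IsMatching F M) (hN : IsMatching F N)
    {e : A × P} (he : e ∈ M ∪ N) {y z : A ⊕ P} (hj : Joins e y z) (hy : y ∈ p '' Set.Iic k) :
    z ∈ p '' Set.Iic k := by
  obtain ⟨t, ht, rfl⟩ := hy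
  rcases he with he | he
  · obtain ⟨s, hs, f, hf, hfj⟩ := h.exists_mem_left ht
      (by rintro rfl; exact h.start (hj.matched_left he))
      (by rintro ho rfl; exact h.stop_odd ho (hj.matched_left he))
    exact ⟨s, hs, (hM.partner_unique he hf hj hfj).symm⟩
  · obtain ⟨s, hs, f, hf, hfj⟩ := h.exists_mem_right ht
      (by rintro ho rfl; exact h.stop_even ho (hj.matched_left he))
    exact ⟨s, hs, (hN.partner_unique he hf hj hfj).symm⟩

theorem isAltPath (h : IsComponentPath M N k p) (hM : IsMatching F M) (hN : IsMatching F N) :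
    IsAltPath F M k p := by
  refine ⟨h.inj, fun t ht => ?_⟩
  rcases Nat.even_or_odd t with hte | hto
  · obtain ⟨e, he, hj⟩ := h.even_edge t ht hte
    refine ⟨e, hN.1 he, hj, fun heM => ?_, fun ho => absurd hte (Nat.not_even_iff_odd.2 ho)⟩
    rcases t with _ | t
    · exact absurd (hj.matched_left heM) h.start
    · obtain ⟨f, hf, hfj⟩ := h.odd_edge t (by omega) (by
        rw [Nat.even_add_one] at hte
        simpa using hte)
      have := h.inj (Set.mem_Iic.2 (by omega)) (Set.mem_Iic.2 (by omega))
        (hM.partner_unique heM hf hj hfj.symm)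
      omega
  · obtain ⟨e, he, hj⟩ := h.odd_edge t ht hto
    exact ⟨e, hM.1 he, hj, fun _ => hto, fun _ => he⟩

/-- Read backwards, a component path with an even number of edges alternates with respect to the
other matching. -/
theorem isAltPath_reverse (h : IsComponentPath M N k p) (hM : IsMatching F M)
    (hN : IsMatching F N) (hk : Even k) : IsAltPath F N k (fun t => p (k - t)) := by
  refine ⟨?_, fun t ht => ?_⟩
  · intro s hs t ht hst
    simp only [Set.mem_Iic] at hs ht
    have := h.inj (Set.mem_Iic.2 (Nat.sub_le k s)) (Set.mem_Iic.2 (Nat.sub_le k t)) hst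
    omega
  · obtain ⟨s, rfl⟩ : ∃ s, k = s + t + 1 := ⟨k - t - 1, by omega⟩
    have e1 : s + t + 1 - t = s + 1 := by omega
    have e2 : s + t + 1 - (t + 1) = s := by omega
    simp only [e1, e2]
    rcases Nat.even_or_odd t with hte | hto
    · have hs : Odd s := by
        rw [Nat.odd_iff]
        rw [Nat.even_iff] at hk hte
        omega
      obtain ⟨e, he, hj⟩ := h.odd_edge s (by omega) hs
      refine ⟨e, hM.1 he, hj.symm, fun heN => ?_, fun ho => absurd hte (Nat.not_even_iff_odd.2 ho)⟩
      obtain ⟨l, rfl⟩ := hs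
      obtain ⟨f, hf, hfj⟩ := h.even_edge (2 * l) (by omega) (by simp)
      have := h.inj (Set.mem_Iic.2 (by omega)) (Set.mem_Iic.2 (by omega))
        (hN.partner_unique heN hf hj hfj.symm)
      omega
    · have hs : Even s := by
        rw [Nat.even_iff] at hk ⊢
        rw [Nat.odd_iff] at hto
        omega
      obtain ⟨e, he, hj⟩ := h.even_edge s (by omega) hs
      exact ⟨e, hN.1 he, hj.symm, fun _ => hto, fun _ => he⟩

end IsComponentPath

/-- The component of the symmetric difference of `M` and `N` that contains a vertex `x` covered by
`N` alone is a path from `x` to some `y`. Either `y` is covered by `N` alone and the path is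
augmenting for `M`, or `y` is covered by `M` alone and the path alternates with respect to `N`. -/
theorem exists_component {F M N : Set (A × P)} (hM : IsMatching F M) (hN : IsMatching F N)
    (hF : F.Finite) {x : A ⊕ P} (hxN : Matched N x) (hxM : ¬ Matched M x) :
    ∃ (C : Set (A ⊕ P)) (y : A ⊕ P), x ∈ C ∧ y ∈ C ∧ y ≠ x ∧
      (∀ e ∈ M ∪ N, ∀ z w, Joins e z w → z ∈ C → w ∈ C) ∧
      (∀ z ∈ C, z ≠ x → z ≠ y → Matched M z ∧ Matched N z) ∧
      ((¬ Matched M y ∧ Matched N y ∧ ∃ k p, p 0 = x ∧ p k = y ∧ Odd k ∧ IsAltPath F M k p) ∨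
       (Matched M y ∧ ¬ Matched N y ∧ ∃ k p, p 0 = y ∧ p k = x ∧ Even k ∧ IsAltPath F N k p)) := by
  obtain ⟨k, p, rfl, h⟩ :=
    exists_componentPath hM hN (hM.finite hF) (hN.finite hF) hxN hxM
  refine ⟨p '' Set.Iic k, p k, ⟨0, by simp, rfl⟩, ⟨k, by simp, rfl⟩, ?_,
    fun e he z w hj hz => h.closed hM hN he hj hz, ?_, ?_⟩
  · intro hc
    have := h.inj (Set.mem_Iic.2 le_rfl) (Set.mem_Iic.2 (Nat.zero_le k)) hc
    have := h.pos
    omega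
  · rintro _ ⟨t, ht, rfl⟩ h0 hk
    have hk' : t ≠ k := by rintro rfl; exact hk rfl
    obtain ⟨_, _, e, he, hj⟩ := h.exists_mem_left ht (by rintro rfl; exact h0 rfl) (fun _ => hk')
    obtain ⟨_, _, f, hf, hfj⟩ := h.exists_mem_right ht (fun _ => hk')
    exact ⟨hj.matched_left he, hfj.matched_left hf⟩
  · rcases Nat.even_or_odd k with hk | hk
    · refine Or.inr ⟨?_, h.stop_even hk, k, _, ?_, ?_, hk, h.isAltPath_reverse hM hN hk⟩
      · obtain ⟨_, _, e, he, hj⟩ := h.exists_mem_left le_rfl h.pos.ne'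
          (fun ho => absurd hk (Nat.not_even_iff_odd.2 ho))
        exact hj.matched_left he
      · simp
      · simp
    · refine Or.inl ⟨h.stop_odd hk, ?_, k, p, rfl, rfl, hk, h.isAltPath hM hN⟩
      obtain ⟨_, _, e, he, hj⟩ := h.exists_mem_right le_rfl
        (fun ho => absurd ho (Nat.not_even_iff_odd.2 hk))
      exact hj.matched_left he

/-- The matching that agrees with `N` on the vertex set `C` and with `M` elsewhere. -/
def exchange (C : Set (A ⊕ P)) (M N : Set (A × P)) : Set (A × P) :=
  {e ∈ M | ∀ x, Incident e x → x ∉ C} ∪ {e ∈ N | ∃ x ∈ C, Incident e x}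

section Exchange

variable {F M N : Set (A × P)} {C : Set (A ⊕ P)}

theorem mem_of_incident_of_closed (hC : ∀ e ∈ M ∪ N, ∀ z w, Joins e z w → z ∈ C → w ∈ C)
    {e : A × P} (he : e ∈ M ∪ N) {x y : A ⊕ P} (hx : Incident e x) (hy : Incident e y)
    (hxC : x ∈ C) : y ∈ C := by
  obtain ⟨z, hz⟩ := hx.exists_joins
  rcases hz.eq_or_eq hy with rfl | rfl
  · exact hxC
  · exact hC e he _ _ hz hxC

theorem isMatching_exchange (hM : IsMatching F M) (hN : IsMatching F N)
    (hC : ∀ e ∈ M ∪ N, ∀ z w, Joins e z w → z ∈ C → w ∈ C) : IsMatching F (exchange C M N) := by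
  refine ⟨?_, ?_⟩
  · rintro e (he | he)
    · exact hM.1 he.1
    · exact hN.1 he.1
  · rintro e (he | he) f (hf | hf) x hex hfx
    · exact hM.2 e he.1 f hf.1 x hex hfx
    · obtain ⟨y, hy, hfy⟩ := hf.2
      exact absurd (mem_of_incident_of_closed hC (Or.inr hf.1) hfy hfx hy) (he.2 x hex)
    · obtain ⟨y, hy, hey⟩ := he.2
      exact absurd (mem_of_incident_of_closed hC (Or.inr he.1) hey hex hy) (hf.2 x hfx)
    · exact hN.2 e he.1 f hf.1 x hex hfx

theorem matched_exchange (hC : ∀ e ∈ M ∪ N, ∀ z w, Joins e z w → z ∈ C → w ∈ C) {z : A ⊕ P} :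
    Matched (exchange C M N) z ↔ (z ∉ C ∧ Matched M z) ∨ (z ∈ C ∧ Matched N z) := by
  constructor
  · rintro ⟨e, he | he, hz⟩
    · exact Or.inl ⟨he.2 z hz, e, he.1, hz⟩
    · obtain ⟨y, hy, hey⟩ := he.2
      exact Or.inr ⟨mem_of_incident_of_closed hC (Or.inr he.1) hey hz hy, e, he.1, hz⟩
  · rintro (⟨hz, e, he, hez⟩ | ⟨hz, e, he, hez⟩)
    · exact ⟨e, Or.inl ⟨he, fun x hx hxC =>
        hz (mem_of_incident_of_closed hC (Or.inl he) hx hez hxC)⟩, hez⟩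
    · exact ⟨e, Or.inr ⟨he, z, hz, hez⟩, hez⟩

/-- Exchanging two matchings on a set of vertices preserves the total number of edges of any
kind. -/
theorem ncard_exchange_add (fM : M.Finite) (fN : N.Finite) (q : A × P → Prop) :
    {e ∈ exchange C M N | q e}.ncard + {e ∈ exchange C N M | q e}.ncard =
      {e ∈ M | q e}.ncard + {e ∈ N | q e}.ncard := by
  have split : ∀ X Y : Set (A × P), X.Finite → Y.Finite →
      {e ∈ exchange C X Y | q e}.ncard = {e ∈ X | q e ∧ ¬ ∃ x ∈ C, Incident e x}.ncard +
        {e ∈ Y | q e ∧ ∃ x ∈ C, Incident e x}.ncard := by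
    intro X Y fX fY
    rw [← Set.ncard_union_eq ?_ (fX.subset fun e he => he.1) (fY.subset fun e he => he.1)]
    · congr 1
      ext e
      constructor
      · rintro ⟨he | he, hq⟩
        · exact Or.inl ⟨he.1, hq, fun ⟨x, hx, hex⟩ => he.2 x hex hx⟩
        · exact Or.inr ⟨he.1, hq, he.2⟩
      · rintro (⟨he, hq, h⟩ | ⟨he, hq, h⟩)
        · exact ⟨Or.inl ⟨he, fun x hx hxC => h ⟨x, hxC, hx⟩⟩, hq⟩
        · exact ⟨Or.inr ⟨he, h⟩, hq⟩
    · rw [Set.disjoint_left]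
      exact fun e he he' => he.2.2 he'.2.2
  have join : ∀ X : Set (A × P), X.Finite →
      {e ∈ X | q e}.ncard = {e ∈ X | q e ∧ ¬ ∃ x ∈ C, Incident e x}.ncard +
        {e ∈ X | q e ∧ ∃ x ∈ C, Incident e x}.ncard := by
    intro X fX
    rw [← Set.ncard_union_eq ?_ (fX.subset fun e he => he.1) (fX.subset fun e he => he.1)]
    · congr 1
      ext e
      constructor
      · rintro ⟨he, hq⟩
        by_cases h : ∃ x ∈ C, Incident e x
        · exact Or.inr ⟨he, hq, h⟩
        · exact Or.inl ⟨he, hq, h⟩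
      · rintro (⟨he, hq, _⟩ | ⟨he, hq, _⟩) <;> exact ⟨he, hq⟩
    · rw [Set.disjoint_left]
      exact fun e he he' => he.2.2 he'.2.2
  rw [split M N fM fN, split N M fN fM, join M fM, join N fN]
  omega

end Exchange

/-- Every matching can be enlarged to a maximum matching that covers all the vertices it covers. -/
theorem IsMatching.exists_maximum {F M : Set (A × P)} (hM : IsMatching F M) (hF : F.Finite) :
    ∃ L, IsMaximumMatching F L ∧ ∀ x, Matched M x → Matched L x := by
  have hfin : {L | IsMatching F L}.Finite := hF.finite_subsets.subset fun L hL => hL.1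
  obtain ⟨L₀, hL₀, hmax₀⟩ := Set.exists_max_image _ (fun L : Set (A × P) => L.ncard) hfin ⟨M, hM⟩
  have hfin' : {L | IsMaximumMatching F L}.Finite := hfin.subset fun L hL => hL.1
  -- among the maximum matchings, one that contains as much as possible of `M`
  obtain ⟨L, hL, hmin⟩ := Set.exists_min_image _ (fun L => (M \ L).ncard) hfin' ⟨L₀, hL₀, hmax₀⟩
  refine ⟨L, hL, ?_⟩
  by_contra! hc
  obtain ⟨x, hxM, hxL⟩ := hc
  obtain ⟨C, y, hxC, hyC, hyx, hC, hC', h⟩ := exists_component hL.1 hM hF hxM hxL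
  rcases h with ⟨hy, _, k, p, rfl, rfl, hk, hp⟩ | ⟨hyL, hyM, _⟩
  · exact hL.not_augmentsFrom hF ⟨k, p, rfl, hk, hp, hxL, hy, rfl⟩
  · have hE := isMatching_exchange hL.1 hM hC
    have hcov : ∀ z, Matched (exchange C L M) z ↔ (Matched L z ∧ z ≠ y) ∨ z = x := by
      intro z
      rw [matched_exchange hC]
      by_cases hzC : z ∈ C
      · by_cases hzx : z = x
        · simp [hzx, hxC, hxM]
        · by_cases hzy : z = y
          · simp [hzy, hyC, hyM, hyx]
          · simp [hzC, hzx, hzy, hC' z hzC hzx hzy]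
      · have hzx : z ≠ x := by rintro rfl; exact hzC hxC
        have hzy : z ≠ y := by rintro rfl; exact hzC hyC
        simp [hzC, hzx, hzy]
    have hfinL := IsMatching.matched_finite (hL.1.finite hF)
    have hcard : (exchange C L M).ncard = L.ncard := by
      have e1 := hE.ncard_matched (hE.finite hF)
      have e2 := hL.1.ncard_matched (hL.1.finite hF)
      have e3 : {z | Matched (exchange C L M) z} = insert x ({z | Matched L z} \ {y}) := by
        ext z
        simp only [Set.mem_ofPred_eq, Set.mem_insert_iff, Set.mem_sdiff,
          Set.mem_singleton_iff, hcov]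
        tauto
      have hx' : x ∉ {z | Matched L z} \ {y} := fun h => hxL h.1
      rw [e3, Set.ncard_insert_of_notMem hx' (hfinL.sdiff),
        Set.ncard_sdiff_singleton_add_one (show y ∈ {z | Matched L z} from hyL) hfinL] at e1
      omega
    have hEmax : IsMaximumMatching F (exchange C L M) := ⟨hE, fun N hN => hcard ▸ hL.2 N hN⟩
    refine absurd (hmin _ hEmax) (not_le.2 (Set.ncard_lt_ncard ?_ ((hM.finite hF).sdiff)))
    constructor
    · rintro e ⟨he, heE⟩
      refine ⟨he, fun heL => heE ?_⟩
      by_cases h : ∃ x ∈ C, Incident e x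
      · exact Or.inr ⟨he, h⟩
      · exact Or.inl ⟨heL, fun x hx hxC => h ⟨x, hxC, hx⟩⟩
    · obtain ⟨e, he, hex⟩ := hxM
      exact fun hsub => (hsub ⟨he, fun heL => hxL ⟨e, heL, hex⟩⟩).2 (Or.inr ⟨he, x, hxC, hex⟩)

end SymmetricDifference

/-! ### Labels that do not depend on a matching -/

namespace RankInstance

variable {A : Type u} {P : Type v} (I : RankInstance A P)

/-- The vertices missed by some maximum matching of `F`: the even vertices, whichever maximum
matching is used for labelling. -/
def evenSet (F : Set (A × P)) : Set (A ⊕ P) :=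
  {x ∈ I.vertices | ∃ N, IsMaximumMatching F N ∧ ¬ Matched N x}

/-- The neighbours of even vertices: the odd vertices. -/
def oddSet (F : Set (A × P)) : Set (A ⊕ P) :=
  {x | ∃ y ∈ I.evenSet F, ∃ e ∈ F, Joins e x y}

/-- The odd and unreachable vertices. -/
def blockedSet (F : Set (A × P)) : Set (A ⊕ P) := I.vertices \ I.evenSet F

/-- The edges between an odd vertex and an odd or unreachable vertex. -/
def uselessSet (F : Set (A × P)) : Set (A × P) :=
  {e | ∃ x y, Joins e x y ∧ x ∈ I.oddSet F ∧ y ∈ I.blockedSet F}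

variable {I}

theorem edges_finite : I.edges.Finite :=
  (I.applicants_finite.prod I.posts_finite).subset I.edges_subset

theorem incident_mem_vertices {e : A × P} (he : e ∈ I.edges) {x : A ⊕ P} (hx : Incident e x) :
    x ∈ I.vertices := by
  have := I.edges_subset he
  rcases hx with rfl | rfl
  · exact Or.inl ⟨_, this.1, rfl⟩
  · exact Or.inr ⟨_, this.2, rfl⟩

theorem matched_mem_vertices {M : Set (A × P)} (hM : M ⊆ I.edges) {x : A ⊕ P}
    (hx : Matched M x) : x ∈ I.vertices := by
  obtain ⟨e, he, hex⟩ := hx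
  exact incident_mem_vertices (hM he) hex

variable {F M : Set (A × P)}

theorem isEven_of_mem_evenSet (hF : F ⊆ I.edges) (hM : IsMaximumMatching F M) {x : A ⊕ P}
    (hx : x ∈ I.evenSet F) : I.IsEven F M x := by
  have fF := I.edges_finite.subset hF
  obtain ⟨hxV, N, hN, hxN⟩ := hx
  by_cases hxM : Matched M x
  · obtain ⟨C, y, -, -, -, -, -, h⟩ := exists_component hN.1 hM.1 fF hxM hxN
    rcases h with ⟨hy, _, k, p, rfl, rfl, hk, hp⟩ | ⟨hyN, hyM, k, p, rfl, rfl, hk, hp⟩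
    · exact absurd ⟨k, p, rfl, hk, hp, hxN, hy, rfl⟩ (hN.not_augmentsFrom fF (x := p 0))
    · exact ⟨k, p, matched_mem_vertices (hN.1.1.trans hF) hyN, hyM, hp, rfl, hk⟩
  · refine ⟨0, fun _ => x, hxV, hxM, ⟨?_, by simp⟩, rfl, by simp⟩
    intro s hs t ht _
    simp only [Set.mem_Iic] at hs ht
    omega

/-- Exchanging a maximum matching along an even alternating path frees the last vertex. -/
theorem exists_maximum_not_matched (hF : F.Finite) (hM : IsMaximumMatching F M) {k : ℕ}
    {p : ℕ → A ⊕ P} (h0 : ¬ Matched M (p 0)) (hp : IsAltPath F M k p) (hk : Even k) :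
    ∃ N, IsMaximumMatching F N ∧ ¬ Matched N (p k) := by
  rcases k with _ | k
  · exact ⟨M, hM, h0⟩
  have hko : Odd k := by
    rw [Nat.even_add_one] at hk
    simpa using hk
  obtain ⟨f, hfF, hfj, hf⟩ := hp.2 k (by omega)
  have hfM := hf.2 hko
  -- the path without its last edge is augmenting once that edge is removed from the matching
  have hsub : M \ {f} ⊆ M := Set.sdiff_subset
  have hM' := hM.1.subset hsub
  have hfree : ∀ z, Matched (M \ {f}) z → Incident f z → False := by
    rintro z ⟨e, he, hez⟩ hz
    exact he.2 (hM.1.eq_of_incident he.1 hfM hez hz)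
  have hp' : IsAltPath F (M \ {f}) k p := by
    refine ⟨(hp.initial (Nat.le_succ k)).1, fun t ht => ?_⟩
    obtain ⟨e, he, hej, hiff⟩ := hp.2 t (by omega)
    have hef : e ≠ f := by
      rintro rfl
      rcases hej.eq_or_eq hfj.incident_right with h | h <;>
        have := hp.1 (by simp) (by simp only [Set.mem_Iic]; omega) h <;> omega
    exact ⟨e, he, hej, fun h => hiff.1 h.1, fun h => ⟨hiff.2 h, hef⟩⟩
  have haug : AugmentsFrom F (M \ {f}) (p 0) (symmDiff (M \ {f}) (pathEdges k p)) :=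
    ⟨k, p, rfl, hko, hp', fun h => h0 (h.mono hsub), fun h => hfree _ h hfj.incident_left, rfl⟩
  have hcard := haug.ncard_lt hM' hF
  rw [Set.ncard_sdiff_singleton_add_one hfM (hM.1.finite hF)] at hcard
  obtain ⟨hm, hcov⟩ := augment_path hM' hko hp' (fun h => h0 (h.mono hsub))
    (fun h => hfree _ h hfj.incident_left)
  refine ⟨_, ⟨hm, fun N hN => hcard ▸ hM.2 N hN⟩, ?_⟩
  rw [hcov]
  rintro (h | h | h)
  · exact hfree _ h hfj.incident_right
  · have := hp.1 (by simp) (by simp) h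
    omega
  · exact hfj.ne h.symm

theorem isEven_iff (hF : F ⊆ I.edges) (hM : IsMaximumMatching F M) {x : A ⊕ P} :
    I.IsEven F M x ↔ x ∈ I.evenSet F := by
  refine ⟨?_, isEven_of_mem_evenSet hF hM⟩
  rintro ⟨k, p, hV, h0, hp, rfl, hk⟩
  refine ⟨?_, exists_maximum_not_matched (I.edges_finite.subset hF) hM h0 hp hk⟩
  rcases k with _ | k
  · exact hV
  · obtain ⟨e, he, hj, _⟩ := hp.2 k (by omega)
    exact incident_mem_vertices (hF he) hj.incident_right

theorem IsOdd.exists_even {x : A ⊕ P} (h : I.IsOdd F M x) :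
    ∃ y, I.IsEven F M y ∧ ∃ e ∈ F, Joins e x y := by
  obtain ⟨k, p, hV, h0, hp, rfl, hk⟩ := h
  obtain ⟨l, rfl⟩ := hk
  obtain ⟨e, he, hj, _⟩ := hp.2 (2 * l) (by omega)
  exact ⟨p (2 * l), ⟨2 * l, p, hV, h0, hp.initial (by omega), rfl, by simp⟩, e, he, hj.symm⟩

theorem IsEven.isOdd (hM : IsMatching F M) {x y : A ⊕ P} (h : I.IsEven F M y) {e : A × P}
    (he : e ∈ F) (hj : Joins e x y) : I.IsOdd F M x := by
  obtain ⟨k, p, hV, h0, hp, rfl, hk⟩ := h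
  by_cases hx : ∃ t ≤ k, p t = x
  · obtain ⟨t, ht, rfl⟩ := hx
    refine ⟨t, p, hV, h0, hp.initial ht, rfl, ?_⟩
    have h1 := hp.isLeft_eq ht
    have h2 := hp.isLeft_eq (le_refl k)
    have h3 := hj.isLeft_eq
    rw [← Nat.not_odd_iff_even] at hk
    simp only [hk, decide_false, Bool.xor_false] at h2
    rw [h1, h2] at h3
    by_contra hc
    cases hb : p 0 <;> simp [hc, hb] at h3
  · push Not at hx
    refine ⟨k + 1, _, ?_, ?_, hp.extend he hj.symm ⟨fun heM => ?_, fun ho => ?_⟩ hx,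
      Function.update_self .., Even.add_one hk⟩
    · rwa [Function.update_of_ne (by omega)]
    · rwa [Function.update_of_ne (by omega)]
    · exfalso
      rcases k with _ | k
      · exact h0 (hj.matched_right heM)
      · obtain ⟨f, _, hfj, hf⟩ := hp.2 k (by omega)
        refine hx k (by omega) (hM.partner_unique (hf.2 ?_) heM hfj.symm hj.symm)
        rw [Nat.even_add_one] at hk
        simpa using hk
    · exact absurd hk (Nat.not_even_iff_odd.2 ho)

theorem IsOdd.isEven (hM : IsMatching F M) {x y : A ⊕ P} (h : I.IsOdd F M y) {e : A × P}
    (he : e ∈ M) (hj : Joins e x y) : I.IsEven F M x := by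
  obtain ⟨k, p, hV, h0, hp, rfl, hk⟩ := h
  by_cases hx : ∃ t ≤ k, p t = x
  · obtain ⟨t, ht, rfl⟩ := hx
    refine ⟨t, p, hV, h0, hp.initial ht, rfl, ?_⟩
    have h1 := hp.isLeft_eq ht
    have h2 := hp.isLeft_eq (le_refl k)
    have h3 := hj.isLeft_eq
    simp only [hk, decide_true, Bool.xor_true] at h2
    rw [h1, h2] at h3
    by_contra hc
    rw [Nat.not_even_iff_odd] at hc
    cases hb : p 0 <;> simp [hc, hb] at h3
  · push Not at hx
    refine ⟨k + 1, _, ?_, ?_, hp.extend (hM.1 he) hj.symm ⟨fun _ => hk, fun _ => he⟩ hx,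
      Function.update_self .., Odd.add_one hk⟩
    · rwa [Function.update_of_ne (by omega)]
    · rwa [Function.update_of_ne (by omega)]

theorem isOdd_iff (hF : F ⊆ I.edges) (hM : IsMaximumMatching F M) {x : A ⊕ P} :
    I.IsOdd F M x ↔ x ∈ I.oddSet F := by
  constructor
  · intro h
    obtain ⟨y, hy, e, he, hj⟩ := h.exists_even
    exact ⟨y, (isEven_iff hF hM).1 hy, e, he, hj⟩
  · rintro ⟨y, hy, e, he, hj⟩
    exact ((isEven_iff hF hM).2 hy).isOdd hM.1 he hj

/-- A vertex missed by a maximum matching cannot be reached along an odd alternating path, since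
the path would be augmenting. -/
theorem notMem_oddSet_of_mem_evenSet (hF : F ⊆ I.edges) {x : A ⊕ P} (hx : x ∈ I.evenSet F) :
    x ∉ I.oddSet F := by
  intro ho
  obtain ⟨_, N, hN, hxN⟩ := hx
  obtain ⟨k, p, _, h0, hp, rfl, hk⟩ := (isOdd_iff hF hN).2 ho
  exact hN.not_augmentsFrom (I.edges_finite.subset hF) ⟨k, p, rfl, hk, hp, h0, hxN, rfl⟩

theorem oddSet_subset_blockedSet (hF : F ⊆ I.edges) : I.oddSet F ⊆ I.blockedSet F := by
  intro x hx
  refine ⟨?_, fun h => notMem_oddSet_of_mem_evenSet hF h hx⟩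
  obtain ⟨y, _, e, he, hj⟩ := hx
  exact incident_mem_vertices (hF he) hj.incident_left

theorem isUnreachable_iff (hF : F ⊆ I.edges) (hM : IsMaximumMatching F M) {x : A ⊕ P} :
    I.IsUnreachable F M x ↔ x ∈ I.blockedSet F ∧ x ∉ I.oddSet F := by
  rw [← isOdd_iff hF hM, blockedSet, Set.mem_sdiff, ← isEven_iff hF hM]
  constructor
  · rintro ⟨hV, h⟩
    refine ⟨⟨hV, ?_⟩, ?_⟩
    · rintro ⟨k, p, h1, h2, h3, h4, _⟩
      exact h ⟨k, p, h1, h2, h3, h4⟩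
    · rintro ⟨k, p, h1, h2, h3, h4, _⟩
      exact h ⟨k, p, h1, h2, h3, h4⟩
  · rintro ⟨⟨hV, he⟩, ho⟩
    refine ⟨hV, ?_⟩
    rintro ⟨k, p, h1, h2, h3, h4⟩
    rcases Nat.even_or_odd k with h | h
    · exact he ⟨k, p, h1, h2, h3, h4, h⟩
    · exact ho ⟨k, p, h1, h2, h3, h4, h⟩

theorem matched_of_mem_blockedSet (hM : IsMaximumMatching F M) {x : A ⊕ P}
    (hx : x ∈ I.blockedSet F) : Matched M x := by
  by_contra hc
  exact hx.2 ⟨hx.1, M, hM, hc⟩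

/-- Partners of odd vertices in a maximum matching are even. -/
theorem mem_evenSet_of_joins (hF : F ⊆ I.edges) (hM : IsMaximumMatching F M) {e : A × P}
    (he : e ∈ M) {x y : A ⊕ P} (hj : Joins e x y) (hx : x ∈ I.oddSet F) : y ∈ I.evenSet F :=
  (isEven_iff hF hM).1 (((isOdd_iff hF hM).2 hx).isEven hM.1 he hj.symm)

/-- A maximum matching contains no useless edge. -/
theorem subset_sdiff_uselessSet (hF : F ⊆ I.edges) (hM : IsMaximumMatching F M) :
    M ⊆ F \ I.uselessSet F := fun _ he =>
  ⟨hM.1.1 he, fun ⟨_, _, hj, hx, hy⟩ => hy.2 (mem_evenSet_of_joins hF hM he hj hx)⟩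

/-- A matching without useless edges that covers all odd and unreachable vertices is maximum: an
augmenting path would alternate between even and odd vertices and end at an odd one. -/
theorem isMaximumMatching_of_covers (hF : F ⊆ I.edges) (hM : IsMatching F M)
    (hu : ∀ e ∈ M, e ∉ I.uselessSet F) (hc : ∀ x ∈ I.blockedSet F, Matched M x) :
    IsMaximumMatching F M := by
  have fF := I.edges_finite.subset hF
  obtain ⟨L, hL, hcov⟩ := hM.exists_maximum fF
  refine ⟨hM, fun N hN => (hL.2 N hN).trans ?_⟩
  by_contra! hlt
  obtain ⟨x, hxL, hxM⟩ := hM.exists_matched_of_ncard_lt hL.1 (hM.finite fF) (hL.1.finite fF) hlt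
  obtain ⟨C, y, -, -, -, -, -, h⟩ := exists_component hM hL.1 fF hxL hxM
  have heven : ∀ z ∈ I.vertices, ¬ Matched M z → z ∈ I.evenSet F := fun z hz hzM => by
    by_contra h
    exact hzM (hc z ⟨hz, h⟩)
  have hLV : ∀ z, Matched L z → z ∈ I.vertices := fun z hz =>
    matched_mem_vertices (hL.1.1.trans hF) hz
  rcases h with ⟨hyM, hyL, k, p, rfl, rfl, hk, hp⟩ | ⟨hyM, hyL, _⟩
  · have hlab : ∀ t ≤ k, (Even t → p t ∈ I.evenSet F) ∧ (Odd t → p t ∈ I.oddSet F) := by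
      intro t ht
      induction t with
      | zero => exact ⟨fun _ => heven _ (hLV _ hxL) hxM, fun h => absurd h (by simp)⟩
      | succ t ih =>
        obtain ⟨e, he, hj, hiff⟩ := hp.2 t ht
        have ih := ih (by omega)
        constructor
        · intro hte
          have hto : Odd t := by
            rw [Nat.even_add_one] at hte
            simpa using hte
          by_contra hc'
          exact hu e (hiff.2 hto) ⟨_, _, hj, ih.2 hto,
            incident_mem_vertices (hF he) hj.incident_right, hc'⟩
        · intro hto
          have hte : Even t := by
            rw [Nat.odd_add_one] at hto
            simpa using hto
          exact ⟨_, ih.1 hte, e, he, hj.symm⟩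
    exact notMem_oddSet_of_mem_evenSet hF (heven _ (hLV _ hyL) hyM) ((hlab k le_rfl).2 hk)
  · exact hyL (hcov y hyM)

end RankInstance

/-! ### Signatures in lexicographic order -/

namespace RankInstance

variable {A : Type u} {P : Type v} {I : RankInstance A P} {i : ℕ} {M N : Set (A × P)}

/-- The signature of `M` as an element of the lexicographically ordered set of sequences. -/
noncomputable def lexSignature (I : RankInstance A P) (M : Set (A × P)) : Lex (ℕ → ℕ) :=
  toLex (I.signature M)

theorem better_iff : I.Better M N ↔ I.lexSignature N < I.lexSignature M := by
  refine exists_congr fun k => and_congr (forall₂_congr fun i _ => ?_) Iff.rfl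
  exact eq_comm

/-- The edges of rank at most `i`. -/
def edgesUpTo (I : RankInstance A P) (i : ℕ) : Set (A × P) := {e ∈ I.edges | I.rank e ≤ i}

/-- `N` has a lexicographically largest signature among the matchings of edges of rank at most
`i`. -/
def Optimal (I : RankInstance A P) (i : ℕ) (N : Set (A × P)) : Prop :=
  IsMatching (I.edgesUpTo i) N ∧
    ∀ L, IsMatching (I.edgesUpTo i) L → I.lexSignature L ≤ I.lexSignature N

theorem edgesUpTo_subset : I.edgesUpTo i ⊆ I.edges := fun _ h => h.1

theorem edgesUpTo_finite : (I.edgesUpTo i).Finite := I.edges_finite.subset edgesUpTo_subset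

theorem edgesUpTo_mono {j : ℕ} (h : i ≤ j) : I.edgesUpTo i ⊆ I.edgesUpTo j :=
  fun _ he => ⟨he.1, he.2.trans h⟩

theorem exists_lexSignature_max {F : Set (A × P)} (hF : F.Finite) :
    ∃ N, IsMatching F N ∧ ∀ L, IsMatching F L → I.lexSignature L ≤ I.lexSignature N :=
  Set.exists_max_image _ I.lexSignature
    (hF.finite_subsets.subset fun L (hL : IsMatching F L) => hL.1) ⟨∅, IsMatching.empty⟩

theorem exists_optimal : ∃ N, I.Optimal i N := exists_lexSignature_max edgesUpTo_finite

theorem rankMaximal_iff : I.RankMaximal M ↔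
    IsMatching I.edges M ∧ ∀ L, IsMatching I.edges L → I.lexSignature L ≤ I.lexSignature M := by
  refine and_congr Iff.rfl (forall₂_congr fun L _ => ?_)
  rw [better_iff]
  exact not_lt

theorem exists_rankMaximal : ∃ N, I.RankMaximal N := by
  obtain ⟨N, h⟩ := exists_lexSignature_max (I := I) I.edges_finite
  exact ⟨N, rankMaximal_iff.2 h⟩

theorem upToRank_subset : upToRank I.rank M i ⊆ M := fun _ h => h.1

theorem isMatching_upToRank (hM : IsMatching I.edges M) :
    IsMatching (I.edgesUpTo i) (upToRank I.rank M i) :=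
  (hM.subset upToRank_subset).of_subset fun _ he => ⟨hM.1 he.1, he.2⟩

theorem signature_upToRank {k : ℕ} (hk : k ≤ i) :
    I.signature (upToRank I.rank M i) k = I.signature M k := by
  unfold signature
  congr 1
  ext e
  exact ⟨fun h => ⟨h.1.1, h.2⟩, fun h => ⟨⟨h.1, h.2.le.trans hk⟩, h.2⟩⟩

theorem signature_eq_zero {k : ℕ} (hM : M ⊆ I.edgesUpTo i) (hk : i < k) :
    I.signature M k = 0 := by
  have : {e ∈ M | I.rank e = k} = ∅ := by
    ext e
    simp only [Set.mem_ofPred_eq, Set.mem_empty_iff_false, iff_false, not_and]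
    intro he
    have := (hM he).2
    omega
  rw [signature, this, Set.ncard_empty]

/-- The edges of small rank of a matching with a lexicographically largest signature form such a
matching, too. -/
theorem optimal_upToRank_of_max {F : Set (A × P)} (hF : F ⊆ I.edges) (hM : IsMatching F M)
    (hi : I.edgesUpTo i ⊆ F) (h : ∀ L, IsMatching F L → I.lexSignature L ≤ I.lexSignature M) :
    I.Optimal i (upToRank I.rank M i) := by
  refine ⟨isMatching_upToRank (hM.mono hF), fun L hL => ?_⟩
  by_contra! hlt
  refine not_lt.2 (h L (hL.mono hi)) ?_
  obtain ⟨k, hk, hk'⟩ := hlt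
  change ∀ j < k, I.signature _ j = I.signature L j at hk
  change I.signature _ k < I.signature L k at hk'
  have hki : k ≤ i := by
    by_contra! hc
    rw [signature_eq_zero hL.1 hc] at hk'
    omega
  refine ⟨k, fun j hj => ?_, ?_⟩
  · have := hk j hj
    rwa [signature_upToRank (by omega)] at this
  · rwa [signature_upToRank hki] at hk'

theorem Optimal.upToRank {j : ℕ} (h : I.Optimal i N) (hj : j ≤ i) :
    I.Optimal j (upToRank I.rank N j) :=
  optimal_upToRank_of_max edgesUpTo_subset h.1 (edgesUpTo_mono hj) h.2

theorem RankMaximal.optimal_upToRank (h : I.RankMaximal M) :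
    I.Optimal i (_root_.upToRank I.rank M i) :=
  optimal_upToRank_of_max subset_rfl h.1 edgesUpTo_subset (rankMaximal_iff.1 h).2

theorem Optimal.rankMaximal (h : I.Optimal i N)
    (hr : ∀ L, I.RankMaximal L → ∀ e ∈ L, I.rank e ≤ i) : I.RankMaximal N := by
  obtain ⟨L, hL⟩ := I.exists_rankMaximal
  refine rankMaximal_iff.2 ⟨h.1.mono edgesUpTo_subset, fun L' hL' => ?_⟩
  exact ((rankMaximal_iff.1 hL).2 L' hL').trans
    (h.2 L (hL.1.of_subset fun e he => ⟨hL.1.1 he, hr L hL e he⟩))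

theorem Optimal.signature_eq (hM : I.Optimal i M) (hN : I.Optimal i N) :
    I.signature M = I.signature N :=
  toLex.injective (le_antisymm (hN.2 M hM.1) (hM.2 N hN.1))

theorem Optimal.of_signature_eq (hM : I.Optimal i M) (hN : IsMatching (I.edgesUpTo i) N)
    (h : I.signature N = I.signature M) : I.Optimal i N :=
  ⟨hN, fun L hL => (hM.2 L hL).trans (le_of_eq (congrArg toLex h.symm))⟩

/-- The edges of rank at most `i + 1` are those of rank at most `i` and those of rank `i + 1`. -/
theorem ncard_upToRank_succ (hM : M.Finite) :
    (_root_.upToRank I.rank M (i + 1)).ncard =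
      (_root_.upToRank I.rank M i).ncard + I.signature M (i + 1) := by
  rw [signature, ← Set.ncard_union_eq ?_ (hM.subset fun e he => he.1)
    (hM.subset fun e he => he.1)]
  · congr 1
    ext e
    constructor
    · rintro ⟨he, hr⟩
      rcases Nat.lt_or_ge i (I.rank e) with h | h
      · exact Or.inr ⟨he, by omega⟩
      · exact Or.inl ⟨he, h⟩
    · rintro (⟨he, hr⟩ | ⟨he, hr⟩)
      · exact ⟨he, by omega⟩
      · exact ⟨he, by omega⟩
  · rw [Set.disjoint_left]
    intro e he he'
    have := he.2
    have := he'.2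
    omega

theorem upToRank_zero (hM : M ⊆ I.edges) : _root_.upToRank I.rank M 0 = ∅ := by
  ext e
  simp only [_root_.upToRank, Set.mem_ofPred_eq, Set.mem_empty_iff_false, iff_false, not_and]
  intro he
  have := I.one_le_rank e (hM he)
  omega

theorem upToRank_eq_self (hM : M ⊆ I.edgesUpTo i) : _root_.upToRank I.rank M i = M :=
  Set.Subset.antisymm upToRank_subset fun _ he => ⟨he, (hM he).2⟩

theorem ncard_upToRank_congr (hM : M ⊆ I.edges) (hN : N ⊆ I.edges)
    (h : ∀ k ≤ i, I.signature M k = I.signature N k) :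
    (_root_.upToRank I.rank M i).ncard = (_root_.upToRank I.rank N i).ncard := by
  induction i with
  | zero => rw [upToRank_zero hM, upToRank_zero hN]
  | succ i ih =>
    rw [ncard_upToRank_succ (I.edges_finite.subset hM),
      ncard_upToRank_succ (I.edges_finite.subset hN), ih fun k hk => h k (by omega), h _ le_rfl]

theorem signature_eq_of_ncard (hM : M ⊆ I.edgesUpTo i) (hN : N ⊆ I.edgesUpTo i)
    (h : ∀ k ≤ i, (_root_.upToRank I.rank M k).ncard = (_root_.upToRank I.rank N k).ncard) :
    I.signature M = I.signature N := by
  have fM := I.edgesUpTo_finite.subset hM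
  have fN := I.edgesUpTo_finite.subset hN
  funext k
  rcases Nat.lt_or_ge i k with hk | hk
  · rw [signature_eq_zero hM hk, signature_eq_zero hN hk]
  · rcases k with _ | k
    · have : ∀ L ⊆ I.edgesUpTo i, I.signature L 0 = 0 := by
        intro L hL
        rw [← signature_upToRank le_rfl, upToRank_zero (hL.trans edgesUpTo_subset)]
        simp [signature]
      rw [this M hM, this N hN]
    · have h1 := h (k + 1) hk
      rw [ncard_upToRank_succ fM, ncard_upToRank_succ fN, h k (by omega)] at h1
      omega

/-! ### The reduced graphs, without reference to an execution -/

/-- The edges that survive the first `i` stages of the algorithm of Irving et al., including those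
of rank larger than `i`, which are yet to be added to the graph. -/
def alive (I : RankInstance A P) : ℕ → Set (A × P)
  | 0 => I.edges
  | i + 1 => {e ∈ I.alive i |
      (I.rank e ≤ i + 1 → e ∉ I.uselessSet {e ∈ I.alive i | I.rank e ≤ i + 1}) ∧
      (i + 1 < I.rank e → ∀ x, Incident e x →
        x ∉ I.blockedSet {e ∈ I.alive i | I.rank e ≤ i + 1})}

/-- The graph of stage `i` before the deletions of that stage. -/
def stageGraph (I : RankInstance A P) (i : ℕ) : Set (A × P) :=
  {e ∈ I.alive (i - 1) | I.rank e ≤ i}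

/-- The graph that remains after stage `i`. -/
def reducedGraph (I : RankInstance A P) (i : ℕ) : Set (A × P) := {e ∈ I.alive i | I.rank e ≤ i}

/-- The vertices that are odd or unreachable at one of the stages `1, …, i`. -/
def closedSet (I : RankInstance A P) (i : ℕ) : Set (A ⊕ P) :=
  {x | ∃ k, 1 ≤ k ∧ k ≤ i ∧ x ∈ I.blockedSet (I.stageGraph k)}

theorem mem_alive_succ {e : A × P} : e ∈ I.alive (i + 1) ↔ e ∈ I.alive i ∧
    (I.rank e ≤ i + 1 → e ∉ I.uselessSet (I.stageGraph (i + 1))) ∧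
    (i + 1 < I.rank e → ∀ x, Incident e x → x ∉ I.blockedSet (I.stageGraph (i + 1))) := Iff.rfl

theorem alive_succ_subset : I.alive (i + 1) ⊆ I.alive i := fun _ h => h.1

theorem alive_anti {j : ℕ} (h : i ≤ j) : I.alive j ⊆ I.alive i := by
  induction h with
  | refl => exact subset_rfl
  | step _ ih => exact alive_succ_subset.trans ih

theorem alive_subset_edges : I.alive i ⊆ I.edges := alive_anti (Nat.zero_le i)

theorem stageGraph_subset_edgesUpTo : I.stageGraph i ⊆ I.edgesUpTo i :=
  fun _ h => ⟨alive_subset_edges h.1, h.2⟩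

theorem stageGraph_subset_edges : I.stageGraph i ⊆ I.edges :=
  stageGraph_subset_edgesUpTo.trans edgesUpTo_subset

theorem stageGraph_finite : (I.stageGraph i).Finite := I.edges_finite.subset stageGraph_subset_edges

theorem reducedGraph_zero : I.reducedGraph 0 = ∅ := by
  ext e
  simp only [reducedGraph, Set.mem_ofPred_eq, Set.mem_empty_iff_false, iff_false, not_and]
  intro he
  have := I.one_le_rank e he
  omega

theorem reducedGraph_succ :
    I.reducedGraph (i + 1) = I.stageGraph (i + 1) \ I.uselessSet (I.stageGraph (i + 1)) := by
  ext e
  constructor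
  · rintro ⟨he, hr⟩
    exact ⟨⟨he.1, hr⟩, he.2.1 hr⟩
  · rintro ⟨⟨he, hr⟩, hu⟩
    exact ⟨⟨he, fun _ => hu, fun h => absurd h (not_lt.2 hr)⟩, hr⟩

theorem closedSet_mono {j : ℕ} (h : i ≤ j) : I.closedSet i ⊆ I.closedSet j :=
  fun _ ⟨k, h1, h2, h3⟩ => ⟨k, h1, h2.trans h, h3⟩

theorem mem_closedSet_succ {x : A ⊕ P} : x ∈ I.closedSet (i + 1) ↔
    x ∈ I.closedSet i ∨ x ∈ I.blockedSet (I.stageGraph (i + 1)) := by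
  constructor
  · rintro ⟨k, h1, h2, h3⟩
    rcases Nat.eq_or_lt_of_le h2 with rfl | h
    · exact Or.inr h3
    · exact Or.inl ⟨k, h1, by omega, h3⟩
  · rintro (h | h)
    · exact closedSet_mono (Nat.le_succ i) h
    · exact ⟨i + 1, by omega, le_rfl, h⟩

theorem notMem_closedSet_zero {x : A ⊕ P} : x ∉ I.closedSet 0 := by
  rintro ⟨k, h1, h2, _⟩
  omega

/-- An edge whose end-points have always been even is not deleted. -/
theorem mem_alive_of_notMem_closedSet {e : A × P} (he : e ∈ I.edges)
    (h : ∀ x, Incident e x → x ∉ I.closedSet i) : e ∈ I.alive i := by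
  induction i with
  | zero => exact he
  | succ i ih =>
    have h' : ∀ x, Incident e x → x ∉ I.closedSet i ∧ x ∉ I.blockedSet (I.stageGraph (i + 1)) :=
      fun x hx => not_or.1 (mt mem_closedSet_succ.2 (h x hx))
    exact ⟨ih fun x hx => (h' x hx).1,
      fun _ ⟨x, y, hj, _, hy⟩ => (h' y hj.incident_right).2 hy, fun _ x hx => (h' x hx).2⟩

/-- The edges of rank larger than `i` that survive are those with two end-points that have always
been even. -/
theorem mem_alive_iff_of_lt_rank {e : A × P} (he : e ∈ I.edges) (hr : i < I.rank e) :
    e ∈ I.alive i ↔ ∀ x, Incident e x → x ∉ I.closedSet i := by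
  refine ⟨?_, mem_alive_of_notMem_closedSet he⟩
  rintro hal x hx ⟨k, h1, h2, h3⟩
  obtain ⟨k, rfl⟩ : ∃ l, k = l + 1 := ⟨k - 1, by omega⟩
  exact (alive_anti h2 hal).2.2 (by omega) x hx h3

theorem stageGraph_succ : I.stageGraph (i + 1) = I.reducedGraph i ∪
    {e ∈ I.edges | I.rank e = i + 1 ∧ ∀ x, Incident e x → x ∉ I.closedSet i} := by
  ext e
  constructor
  · rintro ⟨he, hr⟩
    rcases Nat.lt_or_ge i (I.rank e) with h | h
    · exact Or.inr ⟨alive_subset_edges he, by omega,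
        (mem_alive_iff_of_lt_rank (alive_subset_edges he) h).1 he⟩
    · exact Or.inl ⟨he, h⟩
  · rintro (⟨he, hr⟩ | ⟨he, hr, h⟩)
    · exact ⟨he, by omega⟩
    · exact ⟨mem_alive_of_notMem_closedSet he h, by omega⟩

/-- A matching of stage `i` that covers all vertices closed earlier consists, up to every earlier
rank, of a maximum matching of that stage. -/
theorem isMaximumMatching_upToRank {k : ℕ} (hM : IsMatching (I.stageGraph i) M)
    (hc : ∀ x ∈ I.closedSet (i - 1), Matched M x) (h1 : 1 ≤ k) (hk : k < i) :
    IsMaximumMatching (I.stageGraph k) (_root_.upToRank I.rank M k) := by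
  obtain ⟨k, rfl⟩ : ∃ l, k = l + 1 := ⟨k - 1, by omega⟩
  have hsub : ∀ e ∈ M, e ∈ I.alive (k + 1) := fun e he => alive_anti (by omega) (hM.1 he).1
  refine isMaximumMatching_of_covers stageGraph_subset_edges
    ((hM.subset upToRank_subset).of_subset fun e he => ⟨(hsub e he.1).1, he.2⟩)
    (fun e he => (hsub e he.1).2.1 he.2) fun x hx => ?_
  obtain ⟨e, he, hex⟩ := hc x ⟨k + 1, h1, by omega, hx⟩
  refine ⟨e, ⟨he, ?_⟩, hex⟩
  by_contra! hlt
  exact (hsub e he).2.2 hlt x hex hx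

/-- Rank-maximal matchings of the edges of rank at most `i` are maximum matchings of stage `i` and
cover the vertices closed earlier. -/
theorem Optimal.isMaximumMatching (h : I.Optimal i N) :
    IsMaximumMatching (I.stageGraph i) N ∧ ∀ x ∈ I.closedSet (i - 1), Matched N x := by
  induction i generalizing N with
  | zero =>
    have : N = ∅ := by
      rw [← upToRank_eq_self h.1.1, upToRank_zero (h.1.1.trans edgesUpTo_subset)]
    subst this
    refine ⟨⟨IsMatching.empty, fun L hL => ?_⟩, fun x hx => absurd hx notMem_closedSet_zero⟩
    have := upToRank_eq_self (hL.1.trans stageGraph_subset_edgesUpTo)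
    rw [← this, upToRank_zero (hL.1.trans stageGraph_subset_edges)]
  | succ i ih =>
    obtain ⟨hmax, hcov⟩ := ih (h.upToRank (Nat.le_succ i))
    have hNE := h.1.1.trans edgesUpTo_subset
    have hcl : ∀ x ∈ I.closedSet i, Matched (_root_.upToRank I.rank N i) x := by
      intro x hx
      rcases i with _ | i
      · exact absurd hx notMem_closedSet_zero
      · rcases mem_closedSet_succ.1 hx with hx | hx
        · exact hcov x hx
        · exact matched_of_mem_blockedSet hmax hx
    have hred : _root_.upToRank I.rank N i ⊆ I.reducedGraph i := by
      rcases i with _ | i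
      · rw [upToRank_zero hNE]
        exact Set.empty_subset _
      · rw [reducedGraph_succ]
        exact subset_sdiff_uselessSet stageGraph_subset_edges hmax
    have hsub : N ⊆ I.stageGraph (i + 1) := by
      rw [stageGraph_succ]
      intro e he
      rcases Nat.lt_or_ge i (I.rank e) with hr | hr
      · refine Or.inr ⟨hNE he, le_antisymm (h.1.1 he).2 hr, fun x hx hxc => ?_⟩
        obtain ⟨f, hf, hfx⟩ := hcl x hxc
        obtain rfl := h.1.eq_of_incident he hf.1 hx hfx
        exact not_lt.2 hf.2 hr
      · exact Or.inl (hred ⟨he, hr⟩)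
    have hN : IsMatching (I.stageGraph (i + 1)) N := h.1.of_subset hsub
    have hclN : ∀ x ∈ I.closedSet i, Matched N x := fun x hx => (hcl x hx).mono upToRank_subset
    refine ⟨⟨hN, fun L hL => ?_⟩, hclN⟩
    -- a larger matching covering the same vertices would have a better signature
    obtain ⟨L', hL', hcov'⟩ := hN.exists_maximum stageGraph_finite
    refine (hL'.2 L hL).trans ?_
    by_contra! hlt
    have hL'E := hL'.1.1.trans stageGraph_subset_edgesUpTo
    have hcard : ∀ k ≤ i,
        (_root_.upToRank I.rank L' k).ncard = (_root_.upToRank I.rank N k).ncard := by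
      intro k hk
      rcases Nat.eq_zero_or_pos k with rfl | hpos
      · rw [upToRank_zero hNE, upToRank_zero (hL'E.trans edgesUpTo_subset)]
      · have m1 := isMaximumMatching_upToRank hN hclN hpos (Nat.lt_succ_of_le hk)
        have m2 := isMaximumMatching_upToRank hL'.1 (fun x hx => hcov' x (hclN x hx)) hpos
          (Nat.lt_succ_of_le hk)
        exact le_antisymm (m1.2 _ m2.1) (m2.2 _ m1.1)
    have hsig : ∀ k ≤ i, I.signature L' k = I.signature N k := by
      intro k hk
      have := congrFun (signature_eq_of_ncard (i := i)
        (isMatching_upToRank (hL'.1.mono stageGraph_subset_edges)).1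
        (isMatching_upToRank (h.1.mono edgesUpTo_subset)).1 fun l hl => ?_) k
      · rwa [signature_upToRank hk, signature_upToRank hk] at this
      · have hmin : ∀ X : Set (A × P), _root_.upToRank I.rank (_root_.upToRank I.rank X i) l =
            _root_.upToRank I.rank X l := fun X => by
          ext e
          exact ⟨fun h => ⟨h.1.1, h.2⟩, fun h => ⟨⟨h.1, h.2.trans hl⟩, h.2⟩⟩
        rw [hmin, hmin]
        exact hcard l hl
    have hbetter : I.lexSignature N < I.lexSignature L' := by
      refine ⟨i + 1, fun j hj => (hsig j (by omega)).symm, ?_⟩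
      change I.signature N (i + 1) < I.signature L' (i + 1)
      have e1 := ncard_upToRank_succ (I := I) (i := i) (hN.finite stageGraph_finite)
      have e2 := ncard_upToRank_succ (I := I) (i := i) (hL'.1.finite stageGraph_finite)
      rw [upToRank_eq_self h.1.1, ← hcard i le_rfl] at e1
      rw [upToRank_eq_self hL'E] at e2
      omega
    exact not_le.2 hbetter (h.2 L' (hL'.1.mono stageGraph_subset_edgesUpTo))

/-- Conversely, maximum matchings of stage `i` that cover the vertices closed earlier are
rank-maximal. -/
theorem optimal_of_isMaximumMatching (hN : IsMaximumMatching (I.stageGraph i) N)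
    (hc : ∀ x ∈ I.closedSet (i - 1), Matched N x) : I.Optimal i N := by
  obtain ⟨L, hL⟩ := I.exists_optimal (i := i)
  obtain ⟨hLmax, hLc⟩ := hL.isMaximumMatching
  have hNE := hN.1.1.trans stageGraph_subset_edgesUpTo
  refine hL.of_signature_eq (hN.1.mono stageGraph_subset_edgesUpTo)
    (signature_eq_of_ncard hNE hL.1.1 fun k hk => ?_)
  rcases Nat.eq_zero_or_pos k with rfl | hpos
  · rw [upToRank_zero (hNE.trans edgesUpTo_subset),
      upToRank_zero (hL.1.1.trans edgesUpTo_subset)]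
  rcases Nat.eq_or_lt_of_le hk with rfl | hk
  · rw [upToRank_eq_self hNE, upToRank_eq_self hL.1.1]
    exact le_antisymm (hLmax.2 _ hN.1) (hN.2 _ hLmax.1)
  · have m1 := isMaximumMatching_upToRank hN.1 hc hpos hk
    have m2 := isMaximumMatching_upToRank hLmax.1 hLc hpos hk
    exact le_antisymm (m2.2 _ m1.1) (m1.2 _ m2.1)

end RankInstance

/-! ### Executions of the algorithm of Irving et al. -/

namespace RankInstance

variable {A : Type u} {P : Type v} {I : RankInstance A P} {t : Trace A P} {r i : ℕ}

/-- At stage `i`, the trace has the graph of that stage and a maximum matching of it. -/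
def FollowsAt (I : RankInstance A P) (t : Trace A P) (i : ℕ) : Prop :=
  t.pre i = I.stageGraph i ∧ IsMaximumMatching (I.stageGraph i) (t.M i)

namespace FollowsAt

theorem oddAt_iff (h : I.FollowsAt t i) {x : A ⊕ P} :
    I.OddAt t i x ↔ x ∈ I.oddSet (I.stageGraph i) := by
  rw [OddAt, h.1, isOdd_iff stageGraph_subset_edges h.2]

theorem evenAt_iff (h : I.FollowsAt t i) {x : A ⊕ P} :
    I.EvenAt t i x ↔ x ∈ I.evenSet (I.stageGraph i) := by
  rw [EvenAt, h.1, isEven_iff stageGraph_subset_edges h.2]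

theorem unreachableAt_iff (h : I.FollowsAt t i) {x : A ⊕ P} :
    I.UnreachableAt t i x ↔
      x ∈ I.blockedSet (I.stageGraph i) ∧ x ∉ I.oddSet (I.stageGraph i) := by
  rw [UnreachableAt, h.1, isUnreachable_iff stageGraph_subset_edges h.2]

theorem blockedAt_iff (h : I.FollowsAt t i) {x : A ⊕ P} :
    I.BlockedAt t i x ↔ x ∈ I.blockedSet (I.stageGraph i) := by
  rw [BlockedAt, h.oddAt_iff, h.unreachableAt_iff]
  constructor
  · rintro (h | h)
    · exact oddSet_subset_blockedSet stageGraph_subset_edges h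
    · exact h.1
  · intro h
    by_cases ho : x ∈ I.oddSet (I.stageGraph i)
    · exact Or.inl ho
    · exact Or.inr ⟨h, ho⟩

theorem uselessEdges_eq (h : I.FollowsAt t i) :
    I.uselessEdges t i = I.uselessSet (I.stageGraph i) := by
  ext e
  simp only [uselessEdges, uselessSet, Set.mem_ofPred_eq, h.oddAt_iff, h.blockedAt_iff]

end FollowsAt

theorem closedBy_eq (h : ∀ k, 1 ≤ k → k ≤ i → I.FollowsAt t k) :
    I.closedBy t i = I.closedSet i := by
  ext x
  refine exists_congr fun k => ?_
  constructor
  · rintro ⟨h1, h2, h3⟩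
    exact ⟨h1, h2, (h k h1 h2).blockedAt_iff.1 h3⟩
  · rintro ⟨h1, h2, h3⟩
    exact ⟨h1, h2, (h k h1 h2).blockedAt_iff.2 h3⟩

theorem IsIrvingRun.follows (h : I.IsIrvingRun r t) :
    ∀ i ≤ r, t.red i = I.reducedGraph i ∧ ∀ k, 1 ≤ k → k ≤ i → I.FollowsAt t k := by
  intro i
  induction i with
  | zero => exact fun _ => ⟨h.red_zero.trans reducedGraph_zero.symm, fun k h1 h2 => by omega⟩
  | succ i ih =>
    intro hi
    obtain ⟨hred, hfol⟩ := ih (by omega)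
    have hpre : t.pre (i + 1) = I.stageGraph (i + 1) := by
      rw [h.pre_succ i (by omega), hred, closedBy_eq hfol, stageGraph_succ]
    have hf : I.FollowsAt t (i + 1) := ⟨hpre, hpre ▸ h.maximum i (by omega)⟩
    refine ⟨?_, fun k h1 h2 => ?_⟩
    · rw [h.red_succ i (by omega), hf.uselessEdges_eq, hpre, reducedGraph_succ]
    · rcases Nat.eq_or_lt_of_le h2 with rfl | h2
      · exact hf
      · exact hfol k h1 (by omega)

theorem maximum_subset_reducedGraph {N : Set (A × P)} (h : IsMaximumMatching (I.stageGraph i) N) :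
    N ⊆ I.reducedGraph i := by
  rcases i with _ | i
  · exact h.1.1
  · rw [reducedGraph_succ]
    exact subset_sdiff_uselessSet stageGraph_subset_edges h

theorem reducedGraph_subset_stageGraph_succ : I.reducedGraph i ⊆ I.stageGraph (i + 1) := by
  rw [stageGraph_succ]
  exact Set.subset_union_left

end RankInstance

section Chains

variable {A : Type u} {P : Type v} {F M N : Set (A × P)}

/-- An edge with unmatched end-points is an augmenting path. -/
theorem augments_insert {e : A × P} (he : e ∈ F) (hx : ∀ x, Incident e x → ¬ Matched M x) :
    Augments F M (insert e M) := by
  have heM : e ∉ M := fun h => hx _ (Or.inl rfl) ⟨e, h, Or.inl rfl⟩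
  refine ⟨Sum.inl e.1, 1, fun t => if t = 0 then Sum.inl e.1 else Sum.inr e.2, by simp, by simp,
    ⟨?_, ?_⟩, by simpa using hx _ (Or.inl rfl), by simpa using hx _ (Or.inr rfl), ?_⟩
  · intro s hs t ht hst
    simp only [Set.mem_Iic] at hs ht
    by_cases h1 : s = 0 <;> by_cases h2 : t = 0 <;> simp [h1, h2] at hst <;> omega
  · intro t ht
    obtain rfl : t = 0 := by omega
    exact ⟨e, he, by simpa using joins_mk e, by simpa using heM⟩
  · have : pathEdges 1 (fun t => if t = 0 then (Sum.inl e.1 : A ⊕ P) else Sum.inr e.2) = {e} := by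
      ext f
      constructor
      · rintro ⟨t, ht, hj⟩
        obtain rfl : t = 0 := by omega
        simp only [if_true] at hj
        exact hj.edge_unique (by simpa using joins_mk e)
      · rintro rfl
        exact ⟨0, by simp, by simpa using joins_mk f⟩
    rw [this]
    ext f
    rw [Set.mem_insert_iff, Set.mem_symmDiff, Set.mem_singleton_iff]
    constructor
    · rintro (rfl | hf)
      · exact Or.inr ⟨rfl, heM⟩
      · exact Or.inl ⟨hf, by rintro rfl; exact heM hf⟩
    · rintro (h | h)
      · exact Or.inr h.1
      · exact Or.inl h.1

theorem reflTransGen_augments_of_subset (hN : IsMatching F N) (hMN : M ⊆ N) (fN : N.Finite) :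
    Relation.ReflTransGen (Augments F) M N := by
  have key : ∀ D : Set (A × P), D.Finite → IsMatching F (D ∪ M) →
      Relation.ReflTransGen (Augments F) M (D ∪ M) := by
    intro D fD
    induction D, fD using Set.Finite.induction_on with
    | empty =>
      intro _
      rw [Set.empty_union]
    | insert heD _ ih =>
      rename_i e D _
      intro h
      have hsub : D ∪ M ⊆ insert e D ∪ M := Set.union_subset_union_left _ (Set.subset_insert _ _)
      have ih := ih (h.subset hsub)
      by_cases heM : e ∈ M
      · have : insert e D ∪ M = D ∪ M := by
          ext f
          simp only [Set.mem_union, Set.mem_insert_iff]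
          constructor
          · rintro ((rfl | h) | h)
            · exact Or.inr heM
            · exact Or.inl h
            · exact Or.inr h
          · rintro (h | h)
            · exact Or.inl (Or.inr h)
            · exact Or.inr h
        rwa [this]
      · refine ih.tail ?_
        rw [Set.insert_union] at h ⊢
        refine augments_insert (h.1 (Set.mem_insert _ _)) ?_
        rintro x hx ⟨f, hf, hfx⟩
        obtain rfl := h.2 e (Set.mem_insert _ _) f (Set.mem_insert_of_mem _ hf) x hx hfx
        exact hf.elim heD heM
  have := key N fN (by rwa [Set.union_eq_self_of_subset_right hMN])
  rwa [Set.union_eq_self_of_subset_right hMN] at this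

end Chains

/-! ### The effect of a deletion on rank-maximal matchings -/

section Deletion

variable {A : Type u} {P : Type v}

/-- `N` covers the vertices covered by `M`, except for `d` and `x`. -/
def LosesPair (M N : Set (A × P)) (d x : A ⊕ P) : Prop :=
  x ≠ d ∧ Matched M x ∧ ∀ z, Matched N z ↔ Matched M z ∧ z ≠ d ∧ z ≠ x

/-- `N` covers the vertices covered by `M`, but `y` in the place of `d`. -/
def Replaces (M N : Set (A × P)) (d y : A ⊕ P) : Prop :=
  y ≠ d ∧ ¬ Matched M y ∧ ∀ z, Matched N z ↔ (Matched M z ∧ z ≠ d) ∨ z = y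

variable {M N F F' : Set (A × P)} {d x y : A ⊕ P}

theorem LosesPair.ncard_eq (h : LosesPair M N d x) (hM : IsMatching F M) (hN : IsMatching F' N)
    (fM : M.Finite) (fN : N.Finite) (hd : Matched M d) : M.ncard = N.ncard + 1 := by
  have fV := IsMatching.matched_finite fM
  have e1 := hM.ncard_matched fM
  have e2 := hN.ncard_matched fN
  have : {z | Matched N z} = ({z | Matched M z} \ {d}) \ {x} := by
    ext z
    simp only [Set.mem_ofPred_eq, Set.mem_sdiff, Set.mem_singleton_iff, h.2.2]
    tauto
  have h1 := Set.ncard_sdiff_singleton_add_one (show d ∈ {z | Matched M z} from hd) fV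
  have h2 := Set.ncard_sdiff_singleton_add_one
    (show x ∈ {z | Matched M z} \ {d} from ⟨h.2.1, h.1⟩) fV.sdiff
  rw [this] at e2
  omega

theorem Replaces.ncard_eq (h : Replaces M N d y) (hM : IsMatching F M) (hN : IsMatching F' N)
    (fM : M.Finite) (fN : N.Finite) (hd : Matched M d) : M.ncard = N.ncard := by
  have fV := IsMatching.matched_finite fM
  have e1 := hM.ncard_matched fM
  have e2 := hN.ncard_matched fN
  have : {z | Matched N z} = insert y ({z | Matched M z} \ {d}) := by
    ext z
    simp only [Set.mem_ofPred_eq, Set.mem_insert_iff, Set.mem_sdiff, Set.mem_singleton_iff, h.2.2]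
    tauto
  have h1 := Set.ncard_sdiff_singleton_add_one (show d ∈ {z | Matched M z} from hd) fV
  have h2 : y ∉ {z | Matched M z} \ {d} := fun hy => h.2.1 hy.1
  rw [this, Set.ncard_insert_of_notMem h2 fV.sdiff] at e2
  omega

namespace RankInstance

variable {I : RankInstance A P} {i : ℕ}

theorem mem_vertices_delete : x ∈ (I.delete d).vertices ↔ x ∈ I.vertices ∧ x ≠ d := by
  constructor
  · rintro (⟨a, ha, rfl⟩ | ⟨p, hp, rfl⟩)
    · exact ⟨Or.inl ⟨a, ha.1, rfl⟩, ha.2⟩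
    · exact ⟨Or.inr ⟨p, hp.1, rfl⟩, hp.2⟩
  · rintro ⟨⟨a, ha, rfl⟩ | ⟨p, hp, rfl⟩, h⟩
    · exact Or.inl ⟨a, ⟨ha, h⟩, rfl⟩
    · exact Or.inr ⟨p, ⟨hp, h⟩, rfl⟩

theorem not_matched_of_subset_delete (hN : N ⊆ (I.delete d).edges) : ¬ Matched N d :=
  fun ⟨_, he, hd⟩ => (hN he).2 hd

theorem edgesUpTo_delete_subset : (I.delete d).edgesUpTo i ⊆ I.edgesUpTo i :=
  fun _ h => ⟨h.1.1, h.2⟩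

theorem subset_edgesUpTo_delete (hN : N ⊆ I.edgesUpTo i) (hd : ¬ Matched N d) :
    N ⊆ (I.delete d).edgesUpTo i :=
  fun e he => ⟨⟨(hN he).1, fun h => hd ⟨e, he, h⟩⟩, (hN he).2⟩

theorem Optimal.delete (h : I.Optimal i N) (hd : ¬ Matched N d) : (I.delete d).Optimal i N :=
  ⟨h.1.of_subset (subset_edgesUpTo_delete h.1.1 hd),
    fun L hL => h.2 L (hL.mono edgesUpTo_delete_subset)⟩

/-- Deleting a covered vertex `d` changes a suitable rank-maximal matching only in the component of
`d` in a symmetric difference, a path from `d`. So one more covered vertex is lost, or another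
vertex is covered in the place of `d`. -/
theorem Optimal.exists_delete (hM : I.Optimal i M) (hd : Matched M d) :
    ∃ N, (I.delete d).Optimal i N ∧ ((∃ x, LosesPair M N d x) ∨ ∃ y, Replaces M N d y) := by
  obtain ⟨L, hL⟩ := (I.delete d).exists_optimal (i := i)
  have hLd : ¬ Matched L d := not_matched_of_subset_delete (hL.1.1.trans edgesUpTo_subset)
  have hL' := hL.1.mono edgesUpTo_delete_subset
  obtain ⟨C, y, hdC, hyC, hyd, hC, hC', h⟩ :=
    exists_component hL' hM.1 I.edgesUpTo_finite hd hLd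
  have hCs : ∀ e ∈ M ∪ L, ∀ z w, Joins e z w → z ∈ C → w ∈ C := fun e he => hC e he.symm
  have hN := isMatching_exchange hM.1 hL' hCs
  have hN' := isMatching_exchange hL' hM.1 hC
  have hNd : ¬ Matched (exchange C M L) d := by
    rw [matched_exchange hCs]
    rintro (h | h)
    · exact h.1 hdC
    · exact hLd h.2
  refine ⟨exchange C M L, ⟨hN.of_subset (subset_edgesUpTo_delete hN.1 hNd), fun X hX => ?_⟩, ?_⟩
  · refine (hL.2 X hX).trans ?_
    -- what the exchange does not lose on this side it would gain on the other side
    by_contra! hlt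
    refine not_lt.2 (hM.2 _ hN') ?_
    obtain ⟨k, hk, hk'⟩ := hlt
    change ∀ j < k, I.signature _ j = I.signature L j at hk
    change I.signature _ k < I.signature L k at hk'
    have hsum : ∀ j, I.signature (exchange C M L) j + I.signature (exchange C L M) j =
        I.signature M j + I.signature L j := fun j =>
      ncard_exchange_add (hM.1.finite edgesUpTo_finite) (hL'.finite edgesUpTo_finite) _
    refine ⟨k, fun j hj => ?_, ?_⟩
    · change I.signature M j = I.signature (exchange C L M) j
      have := hk j hj
      have := hsum j
      omega
    · change I.signature M k < I.signature (exchange C L M) k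
      have := hsum k
      omega
  · have hout : ∀ z, z ∉ C → z ≠ d ∧ z ≠ y := fun z hz =>
      ⟨by rintro rfl; exact hz hdC, by rintro rfl; exact hz hyC⟩
    rcases h with ⟨hyL, hyM, _⟩ | ⟨hyL, hyM, _⟩
    · refine Or.inl ⟨y, hyd, hyM, fun z => ?_⟩
      rw [matched_exchange hCs]
      by_cases hzC : z ∈ C
      · by_cases hzd : z = d
        · simp [hzd, hdC, hLd]
        · by_cases hzy : z = y
          · simp [hzy, hyC, hyL]
          · simp [hzC, hzd, hzy, hC' z hzC hzd hzy]
      · simp [hzC, hout z hzC]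
    · refine Or.inr ⟨y, hyd, hyM, fun z => ?_⟩
      rw [matched_exchange hCs]
      by_cases hzC : z ∈ C
      · by_cases hzd : z = d
        · simp [hzd, hdC, hLd, hyd.symm]
        · by_cases hzy : z = y
          · simp [hzy, hyC, hyL]
          · simp [hzC, hzd, hzy, hC' z hzC hzd hzy]
      · simp [hzC, hout z hzC]

section Finish

variable {C : Set (A × P)}

theorem isMaximumMatching_of_replaces (hM : I.Optimal i M) (hd : Matched M d)
    (hC : IsMatching ((I.delete d).stageGraph i) C) (h : Replaces M C d y) :
    IsMaximumMatching ((I.delete d).stageGraph i) C := by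
  have fM := hM.1.finite edgesUpTo_finite
  have fC := hC.finite stageGraph_finite
  refine ⟨hC, fun L hL => ?_⟩
  obtain ⟨N, hN, hcase⟩ := hM.exists_delete hd
  have fN := hN.1.finite edgesUpTo_finite
  have h1 := hN.isMaximumMatching.1.2 L hL
  have h2 := h.ncard_eq hM.1 hC fM fC hd
  rcases hcase with ⟨x, hx⟩ | ⟨z, hz⟩
  · have := hx.ncard_eq hM.1 hN.1 fM fN hd
    omega
  · have := hz.ncard_eq hM.1 hN.1 fM fN hd
    omega

theorem replaces_of_augmentsFrom (hC : IsMatching ((I.delete d).stageGraph i) C)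
    (h : LosesPair M C d x)
    (hN : AugmentsFrom ((I.delete d).stageGraph i) C x N) : ∃ y, Replaces M N d y := by
  obtain ⟨_, _, y, hyx, hy, ⟨e, he, hey⟩, hcov⟩ := hN.spec hC
  have hyd : y ≠ d := by
    rintro rfl
    exact (stageGraph_subset_edges he).2 hey
  have hyM : ¬ Matched M y := fun hc => hy ((h.2.2 y).2 ⟨hc, hyd, hyx⟩)
  refine ⟨y, hyd, hyM, fun z => ?_⟩
  rw [hcov, h.2.2]
  by_cases hzx : z = x
  · simp [hzx, h.1, h.2.1]
  · simp [hzx]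

/-- A matching that has lost only the partner `x` of `d` is maximum, unless an augmenting path
starts at `x`: only `x` distinguishes it from a matching in which `d` is replaced. -/
theorem isMaximumMatching_or_augmentsFrom (hM : I.Optimal i M) (hd : Matched M d)
    (hC : IsMatching ((I.delete d).stageGraph i) C) (h : LosesPair M C d x) :
    IsMaximumMatching ((I.delete d).stageGraph i) C ∨
      ∃ N, AugmentsFrom ((I.delete d).stageGraph i) C x N := by
  have fM := hM.1.finite edgesUpTo_finite
  have fC := hC.finite stageGraph_finite
  obtain ⟨N, hN, hcase⟩ := hM.exists_delete hd
  have fN := hN.1.finite edgesUpTo_finite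
  have hNmax := hN.isMaximumMatching.1
  rcases hcase with ⟨z, hz⟩ | ⟨y, hy⟩
  · refine Or.inl ⟨hC, fun L hL => (hNmax.2 L hL).trans ?_⟩
    have h1 := hz.ncard_eq hM.1 hN.1 fM fN hd
    have h2 := h.ncard_eq hM.1 hC fM fC hd
    omega
  · refine Or.inr ?_
    have hxN : Matched N x := (hy.2.2 x).2 (Or.inl ⟨h.2.1, h.1⟩)
    have hxC : ¬ Matched C x := fun hc => ((h.2.2 x).1 hc).2.2 rfl
    obtain ⟨_, w, -, -, -, -, -, hw⟩ := exists_component hC hNmax.1 stageGraph_finite hxN hxC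
    rcases hw with ⟨hw, _, k, p, rfl, rfl, hk, hp⟩ | ⟨hwC, hwN, _⟩
    · exact ⟨_, k, p, rfl, hk, hp, hxC, hw, rfl⟩
    · exact absurd ((hy.2.2 w).2 (Or.inl ⟨((h.2.2 w).1 hwC).1, ((h.2.2 w).1 hwC).2.1⟩)) hwN

end Finish

end RankInstance

end Deletion

/-! ### One stage of the vertex-deletion algorithm -/

section DeletionStages

variable {A : Type u} {P : Type v}

namespace RankInstance

/-- The matching with which stage `i` starts, as a function of the matching `L` of the previous
stage. -/
def carry (I : RankInstance A P) (M : Set (A × P)) (d : A ⊕ P) (L : Set (A × P)) (i : ℕ) :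
    Set (A × P) :=
  L ∪ {e ∈ upToRank I.rank M i | ¬ Incident e d ∧ ∀ x, Incident e x → ¬ Matched L x}

/-- The vertices that are matched in `M` by an edge of rank at most `i`, but unmatched when stage
`i` starts. -/
def lost (I : RankInstance A P) (M : Set (A × P)) (d : A ⊕ P) (L : Set (A × P)) (i : ℕ) :
    Set (A ⊕ P) :=
  {x ∈ (I.delete d).vertices | Matched (upToRank I.rank M i) x ∧ ¬ Matched (I.carry M d L i) x}

/-- The matching `N` results from `L` by a stage of the vertex-deletion algorithm. This form, which
does not refer to the labels of `d`'s partner, describes all stages: before `d` is matched no vertex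
is lost, and at the stage at which `d` is matched only its partner is. -/
def DeletionStep (I : RankInstance A P) (M : Set (A × P)) (d : A ⊕ P) (i : ℕ)
    (L N : Set (A × P)) : Prop :=
  (∃ x ∈ I.lost M d L i, AugmentsFrom ((I.delete d).stageGraph i) (I.carry M d L i) x N) ∨
    ((¬ ∃ x ∈ I.lost M d L i, ∃ N',
      AugmentsFrom ((I.delete d).stageGraph i) (I.carry M d L i) x N') ∧ N = I.carry M d L i)

/-- The invariant of the vertex-deletion algorithm: after stage `i` its matching `L` is a maximum
matching of the stage, covers the vertices closed so far, and differs from the edges of `M` of rank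
at most `i` only as described in `LosesPair` and `Replaces`. -/
structure DeletionState (I : RankInstance A P) (M : Set (A × P)) (d : A ⊕ P) (i : ℕ)
    (L : Set (A × P)) : Prop where
  maximum : IsMaximumMatching ((I.delete d).stageGraph i) L
  covers : ∀ x ∈ (I.delete d).closedSet i, Matched L x
  cases : (¬ Matched (upToRank I.rank M i) d ∧ L = upToRank I.rank M i) ∨
    (Matched (upToRank I.rank M i) d ∧ ((∃ x, LosesPair (upToRank I.rank M i) L d x) ∨
      ∃ y, Replaces (upToRank I.rank M i) L d y))

variable {I : RankInstance A P} {M L N : Set (A × P)} {d x y w : A ⊕ P} {i : ℕ}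

theorem upToRank_mono {j : ℕ} (h : i ≤ j) : upToRank I.rank M i ⊆ upToRank I.rank M j :=
  fun _ he => ⟨he.1, he.2.trans h⟩

theorem matched_carry_iff : Matched (I.carry M d L i) x ↔ Matched L x ∨
    ∃ e ∈ upToRank I.rank M i, ¬ Incident e d ∧ (∀ z, Incident e z → ¬ Matched L z) ∧
      Incident e x := by
  constructor
  · rintro ⟨e, he | ⟨he, hd, hz⟩, hx⟩
    · exact Or.inl ⟨e, he, hx⟩
    · exact Or.inr ⟨e, he, hd, hz, hx⟩
  · rintro (⟨e, he, hx⟩ | ⟨e, he, hd, hz, hx⟩)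
    · exact ⟨e, Or.inl he, hx⟩
    · exact ⟨e, Or.inr ⟨he, hd, hz⟩, hx⟩

theorem isMatching_carry (hM : I.RankMaximal M) (hL : I.DeletionState M d i L) :
    IsMatching ((I.delete d).stageGraph (i + 1)) (I.carry M d L (i + 1)) := by
  refine ⟨?_, ?_⟩
  · rintro e (he | ⟨he, hd, hz⟩)
    · exact reducedGraph_subset_stageGraph_succ (maximum_subset_reducedGraph hL.maximum he)
    · exact ⟨mem_alive_of_notMem_closedSet (I := I.delete d) ⟨hM.1.1 he.1, hd⟩
        fun x hx hc => hz x hx (hL.covers x hc), he.2⟩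
  · rintro e (he | he) f (hf | hf) x hex hfx
    · exact hL.maximum.1.2 e he f hf x hex hfx
    · exact absurd ⟨e, he, hex⟩ (hf.2.2 x hfx)
    · exact absurd ⟨f, hf, hfx⟩ (he.2.2 x hex)
    · exact hM.1.2 e he.1.1 f hf.1.1 x hex hfx

theorem carry_cases (hM : I.RankMaximal M) (hL : I.DeletionState M d i L) :
    (¬ Matched (upToRank I.rank M (i + 1)) d ∧
      I.carry M d L (i + 1) = upToRank I.rank M (i + 1)) ∨
    (Matched (upToRank I.rank M (i + 1)) d ∧
      ((∃ x, LosesPair (upToRank I.rank M (i + 1)) (I.carry M d L (i + 1)) d x) ∨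
        ∃ y, Replaces (upToRank I.rank M (i + 1)) (I.carry M d L (i + 1)) d y)) := by
  have hsub : upToRank I.rank M i ⊆ upToRank I.rank M (i + 1) := upToRank_mono (Nat.le_succ i)
  have huniq : ∀ e ∈ upToRank I.rank M (i + 1), ∀ f ∈ upToRank I.rank M (i + 1), ∀ x,
      Incident e x → Incident f x → e = f := fun e he f hf => hM.1.2 e he.1 f hf.1
  have hnew : ∀ e ∈ upToRank I.rank M (i + 1), e ∉ upToRank I.rank M i → ∀ x, Incident e x →
      ¬ Matched (upToRank I.rank M i) x := by
    rintro e he hei x hx ⟨f, hf, hfx⟩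
    obtain rfl := huniq e he f (hsub hf) x hx hfx
    exact hei hf
  rcases hL.cases with ⟨hd, rfl⟩ | ⟨hd, ⟨x, hxd, hxM, hx⟩ | ⟨y, hyd, hyM, hy⟩⟩
  · by_cases hd' : Matched (upToRank I.rank M (i + 1)) d
    · obtain ⟨e, he, hed⟩ := hd'
      obtain ⟨w, hj⟩ := hed.exists_joins
      have hei : e ∉ upToRank I.rank M i := fun h => hd ⟨e, h, hed⟩
      refine Or.inr ⟨⟨e, he, hed⟩, Or.inl ⟨w, hj.ne.symm, hj.matched_right he, fun z => ?_⟩⟩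
      rw [matched_carry_iff]
      constructor
      · rintro (⟨f, hf, hfz⟩ | ⟨f, hf, hfd, hfu, hfz⟩)
        · refine ⟨⟨f, hsub hf, hfz⟩, ?_, ?_⟩
          · rintro rfl
            exact hd ⟨f, hf, hfz⟩
          · rintro rfl
            obtain rfl := huniq e he f (hsub hf) _ hj.incident_right hfz
            exact hei hf
        · refine ⟨⟨f, hf, hfz⟩, ?_, ?_⟩
          · rintro rfl
            exact hfd hfz
          · rintro rfl
            obtain rfl := huniq e he f hf _ hj.incident_right hfz
            exact hfd hed
      · rintro ⟨⟨f, hf, hfz⟩, hzd, hzw⟩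
        by_cases hfi : f ∈ upToRank I.rank M i
        · exact Or.inl ⟨f, hfi, hfz⟩
        · refine Or.inr ⟨f, hf, fun hfd => ?_, hnew f hf hfi, hfz⟩
          obtain rfl := huniq e he f hf _ hed hfd
          exact (hj.eq_or_eq hfz).elim hzd hzw
    · refine Or.inl ⟨hd', Set.Subset.antisymm ?_ ?_⟩
      · rintro e (he | he)
        · exact hsub he
        · exact he.1
      · intro e he
        by_cases hei : e ∈ upToRank I.rank M i
        · exact Or.inl hei
        · exact Or.inr ⟨he, fun h => hd' ⟨e, he, h⟩, hnew e he hei⟩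
  · refine Or.inr ⟨hd.mono hsub, Or.inl ⟨x, hxd, hxM.mono hsub, fun z => ?_⟩⟩
    rw [matched_carry_iff]
    constructor
    · rintro (h | ⟨f, hf, hfd, hfu, hfz⟩)
      · have := (hx z).1 h
        exact ⟨this.1.mono hsub, this.2⟩
      · refine ⟨⟨f, hf, hfz⟩, ?_, ?_⟩
        · rintro rfl
          exact hfd hfz
        · rintro rfl
          obtain ⟨e, he, hez⟩ := hxM
          obtain rfl := huniq f hf e (hsub he) _ hfz hez
          obtain ⟨u, hu⟩ := hfz.exists_joins
          refine hfu u hu.incident_right ((hx u).2 ⟨⟨f, he, hu.incident_right⟩, ?_, hu.ne.symm⟩)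
          rintro rfl
          exact hfd hu.incident_right
    · rintro ⟨⟨f, hf, hfz⟩, hzd, hzx⟩
      by_cases hfi : f ∈ upToRank I.rank M i
      · exact Or.inl ((hx z).2 ⟨⟨f, hfi, hfz⟩, hzd, hzx⟩)
      · exact Or.inr ⟨f, hf, fun hfd => hnew f hf hfi d hfd hd,
          fun u hu hLu => hnew f hf hfi u hu ((hx u).1 hLu).1, hfz⟩
  · by_cases hy' : Matched (upToRank I.rank M (i + 1)) y
    · obtain ⟨e, he, hey⟩ := hy'
      obtain ⟨w, hj⟩ := hey.exists_joins
      have hei : e ∉ upToRank I.rank M i := fun h => hyM ⟨e, h, hey⟩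
      have hwM := hnew e he hei w hj.incident_right
      refine Or.inr ⟨hd.mono hsub, Or.inl ⟨w, ?_, hj.matched_right he, fun z => ?_⟩⟩
      · rintro rfl
        exact hwM hd
      rw [matched_carry_iff]
      constructor
      · rintro (h | ⟨f, hf, hfd, hfu, hfz⟩)
        · rcases (hy z).1 h with ⟨hz, hzd⟩ | rfl
          · refine ⟨hz.mono hsub, hzd, ?_⟩
            rintro rfl
            exact hwM hz
          · exact ⟨⟨e, he, hey⟩, hyd, hj.ne⟩
        · refine ⟨⟨f, hf, hfz⟩, ?_, ?_⟩
          · rintro rfl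
            exact hfd hfz
          · rintro rfl
            obtain rfl := huniq e he f hf _ hj.incident_right hfz
            exact hfu y hey ((hy y).2 (Or.inr rfl))
      · rintro ⟨⟨f, hf, hfz⟩, hzd, hzw⟩
        by_cases hfi : f ∈ upToRank I.rank M i
        · exact Or.inl ((hy z).2 (Or.inl ⟨⟨f, hfi, hfz⟩, hzd⟩))
        · by_cases hfy : Incident f y
          · obtain rfl := huniq e he f hf _ hey hfy
            rcases hj.eq_or_eq hfz with rfl | rfl
            · exact Or.inl ((hy z).2 (Or.inr rfl))
            · exact absurd rfl hzw
          · refine Or.inr ⟨f, hf, fun hfd => hnew f hf hfi d hfd hd, fun u hu hLu => ?_, hfz⟩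
            rcases (hy u).1 hLu with ⟨h, _⟩ | rfl
            · exact hnew f hf hfi u hu h
            · exact hfy hu
    · refine Or.inr ⟨hd.mono hsub, Or.inr ⟨y, hyd, hy', fun z => ?_⟩⟩
      rw [matched_carry_iff]
      constructor
      · rintro (h | ⟨f, hf, hfd, hfu, hfz⟩)
        · exact ((hy z).1 h).imp (fun h => ⟨h.1.mono hsub, h.2⟩) id
        · refine Or.inl ⟨⟨f, hf, hfz⟩, ?_⟩
          rintro rfl
          exact hfd hfz
      · rintro (⟨⟨f, hf, hfz⟩, hzd⟩ | rfl)
        · by_cases hfi : f ∈ upToRank I.rank M i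
          · exact Or.inl ((hy z).2 (Or.inl ⟨⟨f, hfi, hfz⟩, hzd⟩))
          · refine Or.inr ⟨f, hf, fun hfd => hnew f hf hfi d hfd hd, fun u hu hLu => ?_, hfz⟩
            rcases (hy u).1 hLu with ⟨h, _⟩ | rfl
            · exact hnew f hf hfi u hu h
            · exact hy' ⟨f, hf, hu⟩
        · exact Or.inl ((hy z).2 (Or.inr rfl))

theorem lost_eq_singleton (hM : I.RankMaximal M)
    (h : LosesPair (upToRank I.rank M i) (I.carry M d L i) d x) : I.lost M d L i = {x} := by
  ext z
  constructor
  · rintro ⟨hz, hzM, hzC⟩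
    by_contra hc
    exact hzC ((h.2.2 z).2 ⟨hzM, (mem_vertices_delete.1 hz).2, hc⟩)
  · rintro rfl
    exact ⟨mem_vertices_delete.2
      ⟨matched_mem_vertices (upToRank_subset.trans hM.1.1) h.2.1, h.1⟩, h.2.1,
      fun hc => ((h.2.2 _).1 hc).2.2 rfl⟩

theorem lost_eq_empty (h : ∀ z, Matched (upToRank I.rank M i) z → z ≠ d →
    Matched (I.carry M d L i) z) : I.lost M d L i = ∅ :=
  Set.eq_empty_of_forall_notMem fun z ⟨hz, hzM, hzC⟩ => hzC (h z hzM (mem_vertices_delete.1 hz).2)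

theorem DeletionState.zero (hM : I.RankMaximal M) : I.DeletionState M d 0 ∅ := by
  have h0 : upToRank I.rank M 0 = ∅ := upToRank_zero hM.1.1
  have hd : ¬ Matched (∅ : Set (A × P)) d := fun ⟨_, he, _⟩ => he
  have hopt : (I.delete d).Optimal 0 ∅ :=
    Optimal.delete (h0 ▸ hM.optimal_upToRank (i := 0)) hd
  exact ⟨hopt.isMaximumMatching.1, fun x hx => absurd hx notMem_closedSet_zero,
    Or.inl ⟨h0 ▸ hd, h0.symm⟩⟩

theorem covers_succ (hc : ∀ x ∈ I.closedSet i, Matched L x)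
    (hLN : ∀ x, Matched L x → Matched N x)
    (hN : IsMaximumMatching (I.stageGraph (i + 1)) N) :
    ∀ x ∈ I.closedSet (i + 1), Matched N x := fun x hx =>
  (mem_closedSet_succ.1 hx).elim (fun h => hLN x (hc x h)) (matched_of_mem_blockedSet hN)

/-- A stage preserves the invariant, and its matching results from the previous one by
augmentations. -/
theorem DeletionState.step (hM : I.RankMaximal M) (hL : I.DeletionState M d i L)
    (h : I.DeletionStep M d (i + 1) L N) : I.DeletionState M d (i + 1) N ∧
      Relation.ReflTransGen (Augments ((I.delete d).stageGraph (i + 1))) L N := by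
  have hC := isMatching_carry hM hL
  have hopt := hM.optimal_upToRank (i := i + 1)
  have hLC : L ⊆ I.carry M d L (i + 1) := Set.subset_union_left
  have hchain := reflTransGen_augments_of_subset hC hLC (hC.finite stageGraph_finite)
  have hcov : ∀ N, (∀ z, Matched (I.carry M d L (i + 1)) z → Matched N z) →
      IsMaximumMatching ((I.delete d).stageGraph (i + 1)) N →
      ∀ x ∈ (I.delete d).closedSet (i + 1), Matched N x := fun N hN =>
    covers_succ hL.covers fun z hz => hN z (hz.mono hLC)
  have hid : ∀ z, Matched (I.carry M d L (i + 1)) z → Matched (I.carry M d L (i + 1)) z :=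
    fun _ => id
  rcases carry_cases hM hL with ⟨hd, hCM⟩ | ⟨hd, ⟨x, hx⟩ | ⟨y, hy⟩⟩
  · have hl : I.lost M d L (i + 1) = ∅ := lost_eq_empty fun z hz _ => hCM ▸ hz
    rcases h with ⟨x, hx, _⟩ | ⟨_, rfl⟩
    · rw [hl] at hx
      exact hx.elim
    · have hmax : IsMaximumMatching ((I.delete d).stageGraph (i + 1)) (I.carry M d L (i + 1)) :=
        hCM ▸ (hopt.delete hd).isMaximumMatching.1
      exact ⟨⟨hmax, hcov _ hid hmax, Or.inl ⟨hd, hCM⟩⟩, hchain⟩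
  · have hl : I.lost M d L (i + 1) = {x} := lost_eq_singleton hM hx
    rcases h with ⟨z, hz, haug⟩ | ⟨hno, rfl⟩
    · rw [hl] at hz
      obtain rfl := hz
      obtain ⟨y, hy⟩ := replaces_of_augmentsFrom hC hx haug
      obtain ⟨hN, _, w, _, _, _, hw⟩ := haug.spec hC
      have hmax := isMaximumMatching_of_replaces hopt hd hN hy
      exact ⟨⟨hmax, hcov _ (fun z hz => (hw z).2 (Or.inl hz)) hmax, Or.inr ⟨hd, Or.inr ⟨y, hy⟩⟩⟩,
        hchain.tail ⟨_, haug⟩⟩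
    · rw [hl] at hno
      have hmax := (isMaximumMatching_or_augmentsFrom hopt hd hC hx).resolve_right
        fun ⟨N', hN'⟩ => hno ⟨x, rfl, N', hN'⟩
      exact ⟨⟨hmax, hcov _ hid hmax, Or.inr ⟨hd, Or.inl ⟨x, hx⟩⟩⟩, hchain⟩
  · have hl : I.lost M d L (i + 1) = ∅ :=
      lost_eq_empty fun z hz hzd => (hy.2.2 z).2 (Or.inl ⟨hz, hzd⟩)
    rcases h with ⟨x, hx, _⟩ | ⟨_, rfl⟩
    · rw [hl] at hx
      exact hx.elim
    · have hmax := isMaximumMatching_of_replaces hopt hd hC hy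
      exact ⟨⟨hmax, hcov _ hid hmax, Or.inr ⟨hd, Or.inr ⟨y, hy⟩⟩⟩, hchain⟩

theorem not_matched_upToRank_of_lt (hM : I.RankMaximal M) {e : A × P} (he : e ∈ M)
    (hd : Incident e d) {j : ℕ} (hj : j < I.rank e) : ¬ Matched (upToRank I.rank M j) d := by
  rintro ⟨f, hf, hfd⟩
  obtain rfl := hM.1.2 e he f hf.1 d hd hfd
  exact not_lt.2 hf.2 hj

/-- At the stage at which `d` is matched, exactly its partner is lost. -/
theorem losesPair_carry (hM : I.RankMaximal M) (hL : I.DeletionState M d i L) {e : A × P}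
    (he : e ∈ M) (hr : I.rank e = i + 1) (hj : Joins e d w) :
    LosesPair (upToRank I.rank M (i + 1)) (I.carry M d L (i + 1)) d w ∧
      I.carry M d L (i + 1) = upToRank I.rank M (i + 1) \ {e} := by
  have hd := not_matched_upToRank_of_lt (j := i) hM he hj.incident_left (by omega)
  have heM : e ∈ upToRank I.rank M (i + 1) := ⟨he, hr.le⟩
  obtain rfl : L = upToRank I.rank M i :=
    hL.cases.elim (fun h => h.2) fun h => absurd h.1 hd
  have hCe : I.carry M d (upToRank I.rank M i) (i + 1) = upToRank I.rank M (i + 1) \ {e} := by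
    ext f
    constructor
    · rintro (hf | ⟨hf, hfd, _⟩)
      · refine ⟨upToRank_mono (Nat.le_succ i) hf, ?_⟩
        rintro rfl
        have := hf.2
        omega
      · exact ⟨hf, by rintro rfl; exact hfd hj.incident_left⟩
    · rintro ⟨hf, hfe⟩
      by_cases hfi : f ∈ upToRank I.rank M i
      · exact Or.inl hfi
      · refine Or.inr ⟨hf, fun hfd => hfe (hM.1.2 f hf.1 e he d hfd hj.incident_left), ?_⟩
        rintro x hx ⟨g, hg, hgx⟩
        obtain rfl := hM.1.2 f hf.1 g hg.1 x hx hgx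
        exact hfi hg
  refine ⟨⟨hj.ne.symm, hj.matched_right heM, fun z => ?_⟩, hCe⟩
  rw [hCe]
  constructor
  · rintro ⟨f, ⟨hf, hfe⟩, hfz⟩
    refine ⟨⟨f, hf, hfz⟩, ?_, ?_⟩
    · rintro rfl
      exact hfe (hM.1.2 f hf.1 e he _ hfz hj.incident_left)
    · rintro rfl
      exact hfe (hM.1.2 f hf.1 e he _ hfz hj.incident_right)
  · rintro ⟨⟨f, hf, hfz⟩, hzd, hzw⟩
    refine ⟨f, ⟨hf, ?_⟩, hfz⟩
    rintro rfl
    exact (hj.eq_or_eq hfz).elim hzd hzw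

/-- At the stage at which `d` is matched to `w`, an augmenting path starts at `w` exactly if `w` was
odd in the original instance: then `d` was even, so a rank-maximal matching of the original edges
can do without `d`. -/
theorem augmentsFrom_iff_mem_oddSet (hM : I.RankMaximal M) (hL : I.DeletionState M d i L)
    {e : A × P} (he : e ∈ M) (hr : I.rank e = i + 1) (hj : Joins e d w) :
    (∃ N, AugmentsFrom ((I.delete d).stageGraph (i + 1)) (I.carry M d L (i + 1)) w N) ↔
      w ∈ I.oddSet (I.stageGraph (i + 1)) := by
  have hd' := not_matched_upToRank_of_lt (j := i) hM he hj.incident_left (by omega)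
  have heM : e ∈ upToRank I.rank M (i + 1) := ⟨he, hr.le⟩
  have hd : Matched (upToRank I.rank M (i + 1)) d := hj.matched_left heM
  have hC := isMatching_carry hM hL
  have hopt := hM.optimal_upToRank (i := i + 1)
  obtain ⟨hmax, hcov⟩ := hopt.isMaximumMatching
  obtain ⟨hlose, -⟩ := losesPair_carry hM hL he hr hj
  have fM := hopt.1.finite edgesUpTo_finite
  have fC := hC.finite stageGraph_finite
  have hcard := hlose.ncard_eq hopt.1 hC fM fC hd
  constructor
  · rintro ⟨N, hN⟩
    have hNM := hN.spec hC
    have hNc := hN.ncard_lt hC stageGraph_finite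
    obtain ⟨K, hK, hcase⟩ := hopt.exists_delete hd
    have fK := hK.1.finite edgesUpTo_finite
    have hKmax := hK.isMaximumMatching.1.2 N hNM.1
    have hKc : (upToRank I.rank M (i + 1)).ncard = K.ncard := by
      rcases hcase with ⟨x, hx⟩ | ⟨y, hy⟩
      · have := hx.ncard_eq hopt.1 hK.1 fM fK hd
        omega
      · exact hy.ncard_eq hopt.1 hK.1 fM fK hd
    -- the edges of rank at most `i` do not use `d`, so the signatures agree at all lower ranks
    have hsig : ∀ k ≤ i, I.signature K k = I.signature (upToRank I.rank M (i + 1)) k := by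
      intro k hk
      have h1 := (hK.upToRank (Nat.le_succ i)).signature_eq
        (Optimal.delete (hM.optimal_upToRank (i := i)) hd')
      have h2 := congrFun h1 k
      change I.signature (upToRank I.rank K i) k = I.signature (upToRank I.rank M i) k at h2
      rwa [signature_upToRank hk, signature_upToRank hk,
        ← signature_upToRank (i := i + 1) (M := M) (by omega)] at h2
    have hKE := hK.1.1.trans edgesUpTo_delete_subset
    have hKopt : I.Optimal (i + 1) K := by
      refine hopt.of_signature_eq (hK.1.of_subset hKE)
        (signature_eq_of_ncard hKE hopt.1.1 fun k hk => ?_)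
      rcases Nat.eq_or_lt_of_le hk with rfl | hk
      · rw [upToRank_eq_self hKE, upToRank_eq_self hopt.1.1, hKc]
      · exact ncard_upToRank_congr (hKE.trans edgesUpTo_subset)
          (hopt.1.1.trans edgesUpTo_subset) fun l hl => hsig l (by omega)
    have hKd : ¬ Matched K d := not_matched_of_subset_delete (hK.1.1.trans edgesUpTo_subset)
    exact ⟨d, ⟨matched_mem_vertices (hopt.1.1.trans edgesUpTo_subset) hd, K,
      hKopt.isMaximumMatching.1, hKd⟩, e, hmax.1.1 heM, hj.symm⟩
  · intro hw
    obtain ⟨_, N, hN, hNd⟩ := mem_evenSet_of_joins stageGraph_subset_edges hmax heM hj.symm hw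
    obtain ⟨X, y, hdX, hyX, hyd, hX, hX', h⟩ :=
      exists_component hN.1 hmax.1 stageGraph_finite hd hNd
    rcases h with ⟨hy, _, k, p, rfl, rfl, hk, hp⟩ | ⟨hyN, hyM, _⟩
    · exact absurd ⟨k, p, rfl, hk, hp, hNd, hy, rfl⟩
        (hN.not_augmentsFrom stageGraph_finite (x := p 0))
    · have hXs : ∀ e ∈ upToRank I.rank M (i + 1) ∪ N, ∀ z w, Joins e z w → z ∈ X → w ∈ X :=
        fun e he => hX e he.symm
      have hK := isMatching_exchange hmax.1 hN.1 hXs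
      have hrep : Replaces (upToRank I.rank M (i + 1))
          (exchange X (upToRank I.rank M (i + 1)) N) d y := by
        refine ⟨hyd, hyM, fun z => ?_⟩
        rw [matched_exchange hXs]
        by_cases hzX : z ∈ X
        · by_cases hzd : z = d
          · simp [hzd, hdX, hNd, hyd.symm]
          · by_cases hzy : z = y
            · simp [hzy, hyX, hyN]
            · simp [hzX, hzd, hzy, hX' z hzX hzd hzy]
        · have hzd : z ≠ d := by rintro rfl; exact hzX hdX
          have hzy : z ≠ y := by rintro rfl; exact hzX hyX
          simp [hzX, hzd, hzy]
      have hKc := hrep.ncard_eq hopt.1 hK fM (hK.finite stageGraph_finite) hd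
      have hKmax : IsMaximumMatching (I.stageGraph (i + 1))
          (exchange X (upToRank I.rank M (i + 1)) N) :=
        ⟨hK, fun L' hL' => hKc ▸ hmax.2 L' hL'⟩
      have hclosed : ∀ x ∈ I.closedSet i, Matched (upToRank I.rank M i) x := by
        have h1 := (hM.optimal_upToRank (i := i)).isMaximumMatching
        intro x hx
        rcases i with _ | i
        · exact absurd hx notMem_closedSet_zero
        · exact (mem_closedSet_succ.1 hx).elim (h1.2 x) (matched_of_mem_blockedSet h1.1)
      have hKopt := optimal_of_isMaximumMatching hKmax fun x hx => (hrep.2.2 x).2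
        (Or.inl ⟨hcov x hx, fun hxd => hd' (hxd ▸ hclosed x hx)⟩)
      have hKd : ¬ Matched (exchange X (upToRank I.rank M (i + 1)) N) d := fun hc =>
        ((hrep.2.2 d).1 hc).elim (fun h => h.2 rfl) fun h => hyd h.symm
      have hKH := (hKopt.delete hKd).isMaximumMatching.1
      refine (isMaximumMatching_or_augmentsFrom hopt hd hC hlose).resolve_left fun hCmax => ?_
      have := hCmax.2 _ hKH.1
      omega

end RankInstance

end DeletionStages

/-! ### Executions of the vertex-deletion algorithm -/

section DeletionRuns

variable {A : Type u} {P : Type v}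

namespace RankInstance

variable {I : RankInstance A P} {M : Set (A × P)} {d : A ⊕ P} {g t : Trace A P} {r i : ℕ}

/-- A vertex that was closed in the original instance and has never been closed in the new one was
reopened, since it was even in the new instance when it was closed in the original one. -/
theorem mem_reopened (ht : ∀ k, 1 ≤ k → k ≤ i → (I.delete d).FollowsAt t k) {x : A ⊕ P}
    (hx : x ∈ (I.delete d).vertices) (hxt : x ∉ (I.delete d).closedSet i)
    (hxg : ∃ k, 1 ≤ k ∧ k ≤ i ∧ I.BlockedAt g k x) : x ∈ I.reopened d g t i := by
  induction i with
  | zero =>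
    obtain ⟨k, h1, h2, _⟩ := hxg
    omega
  | succ i ih =>
    refine ⟨?_, by rwa [closedBy_eq ht]⟩
    obtain ⟨h3, h4⟩ := not_or.1 (mt mem_closedSet_succ.2 hxt)
    obtain ⟨k, h1, h2, hb⟩ := hxg
    rcases Nat.eq_or_lt_of_le h2 with rfl | h2
    · refine Or.inr ⟨hb, ((ht _ h1 le_rfl).evenAt_iff).2 ?_⟩
      by_contra hc
      exact h4 ⟨hx, hc⟩
    · exact Or.inl (ih (fun k h1 h2 => ht k h1 (by omega)) h3 ⟨k, h1, by omega, hb⟩)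

/-- The graphs of the vertex-deletion algorithm are formed as in the algorithm of Irving et al. -/
theorem stageGraph_delete_succ (hg : ∀ k, 1 ≤ k → k ≤ i + 1 → I.FollowsAt g k)
    (ht : ∀ k, 1 ≤ k → k ≤ i → (I.delete d).FollowsAt t k) :
    (I.delete d).stageGraph (i + 1) = (I.delete d).reducedGraph i ∪
      {e ∈ (I.delete d).edges | I.rank e = i + 1 ∧
        (e ∈ g.pre (i + 1) ∨ ∃ x ∈ I.reopened d g t i, Incident e x) ∧
        ∀ x, Incident e x → x ∉ (I.delete d).closedBy t i} := by
  rw [stageGraph_succ, closedBy_eq ht]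
  congr 1
  ext e
  constructor
  · rintro ⟨he, hr, hc⟩
    refine ⟨he, hr, ?_, hc⟩
    by_cases hcl : ∀ x, Incident e x → x ∉ I.closedSet i
    · refine Or.inl ?_
      rw [(hg (i + 1) (by omega) le_rfl).1, stageGraph_succ]
      exact Or.inr ⟨he.1, hr, hcl⟩
    · push Not at hcl
      obtain ⟨x, hx, k, h1, h2, hb⟩ := hcl
      exact Or.inr ⟨x, mem_reopened ht (incident_mem_vertices he hx) (hc x hx)
        ⟨k, h1, h2, (hg k h1 (by omega)).blockedAt_iff.2 hb⟩, hx⟩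
  · rintro ⟨he, hr, _, hc⟩
    exact ⟨he, hr, hc⟩

theorem DeletionStep.states (hM : I.RankMaximal M) {L : ℕ → Set (A × P)} (h0 : L 0 = ∅)
    (h : ∀ i < r, I.DeletionStep M d (i + 1) (L i) (L (i + 1))) :
    ∀ i ≤ r, I.DeletionState M d i (L i) := by
  intro i
  induction i with
  | zero => exact fun _ => h0 ▸ DeletionState.zero hM
  | succ i ih => exact fun hi => ((ih (by omega)).step hM (h i (by omega))).1

/-- A sequence of matchings that are linked by stages of the algorithm is an execution. -/
theorem isDeletionRun_of_steps (hM : I.RankMaximal M) (hr : ∀ e ∈ M, I.rank e ≤ r)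
    (hg : I.IsIrvingRun r g) {L : ℕ → Set (A × P)} (h0 : L 0 = ∅)
    (h : ∀ i < r, I.DeletionStep M d (i + 1) (L i) (L (i + 1))) :
    I.IsDeletionRun r M g d ⟨L, (I.delete d).stageGraph, (I.delete d).reducedGraph⟩ := by
  have hst := DeletionStep.states hM h0 h
  have hfol : ∀ k ≤ r, (I.delete d).FollowsAt
      ⟨L, (I.delete d).stageGraph, (I.delete d).reducedGraph⟩ k := fun k hk =>
    ⟨rfl, (hst k hk).maximum⟩
  have hfg := (hg.follows r le_rfl).2
  have hpos : ∀ e ∈ M, ∃ j, I.rank e = j + 1 ∧ j < r := fun e he => by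
    have h1 := I.one_le_rank e (hM.1.1 he)
    have h2 := hr e he
    exact ⟨I.rank e - 1, by omega, by omega⟩
  -- if the partner of `d` is not odd at the stage of their edge, no augmenting path is available
  have hkeep : ∀ e ∈ M, ∀ w, Joins e d w → w ∉ I.oddSet (I.stageGraph (I.rank e)) →
      L (I.rank e) = upToRank I.rank M (I.rank e) \ {e} := by
    intro e he w hj hw
    obtain ⟨j, hj1, hj2⟩ := hpos e he
    obtain ⟨h1, h2⟩ := losesPair_carry hM (hst j hj2.le) he hj1 hj
    rw [hj1] at hw ⊢
    rcases h j hj2 with ⟨x, hx, haug⟩ | ⟨_, h3⟩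
    · rw [lost_eq_singleton hM h1] at hx
      obtain rfl := hx
      exact absurd ((augmentsFrom_iff_mem_oddSet hM (hst j hj2.le) he hj1 hj).1 ⟨_, haug⟩) hw
    · rw [h3, h2]
  refine ⟨h0, reducedGraph_zero, fun i hi => ?_, fun i hi => ?_, fun i hi hd => ?_, ?_, ?_, ?_,
    ?_, ?_⟩
  · exact stageGraph_delete_succ (fun k h1 h2 => hfg k h1 (by omega))
      fun k h1 h2 => hfol k (by omega)
  · rw [(hfol (i + 1) hi).uselessEdges_eq]
    exact reducedGraph_succ
  · exact (hst i hi).cases.elim (fun h => h.2) fun h => absurd h.1 hd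
  · intro e he w hj hw
    obtain ⟨j, hj1, hj2⟩ := hpos e he
    rw [(hfg (I.rank e) (by omega) (by omega)).oddAt_iff] at hw
    obtain ⟨h1, h2⟩ := losesPair_carry hM (hst j hj2.le) he hj1 hj
    rw [hj1] at hw ⊢
    rw [← h2]
    have hex := (augmentsFrom_iff_mem_oddSet hM (hst j hj2.le) he hj1 hj).2 hw
    rcases h j hj2 with ⟨x, hx, haug⟩ | ⟨hno, _⟩
    · rw [lost_eq_singleton hM h1] at hx
      obtain rfl := hx
      exact haug
    · exact absurd ⟨w, (lost_eq_singleton hM h1).symm ▸ rfl, hex⟩ hno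
  · intro e he w hj hw
    obtain ⟨j, hj1, hj2⟩ := hpos e he
    rw [(hfg (I.rank e) (by omega) (by omega)).unreachableAt_iff] at hw
    exact hkeep e he w hj hw.2
  · intro e he w hj hw
    obtain ⟨j, hj1, hj2⟩ := hpos e he
    rw [(hfg (I.rank e) (by omega) (by omega)).evenAt_iff] at hw
    exact hkeep e he w hj (notMem_oddSet_of_mem_evenSet stageGraph_subset_edges hw)
  · intro e he hd i hi hlt hex
    obtain ⟨j, rfl⟩ : ∃ j, i = j + 1 := ⟨i - 1, by omega⟩
    exact (h j hi).resolve_right fun h => h.1 hex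
  · intro e he hd i hi hlt hex
    obtain ⟨j, rfl⟩ : ∃ j, i = j + 1 := ⟨i - 1, by omega⟩
    exact ((h j hi).resolve_left fun ⟨x, hx, haug⟩ => hex ⟨x, hx, _, haug⟩).2

/-- Every execution of the vertex-deletion algorithm follows the algorithm of Irving et al. on the
new instance. -/
theorem IsDeletionRun.follows (hM : I.RankMaximal M) (hg : I.IsIrvingRun r g)
    (h : I.IsDeletionRun r M g d t) : ∀ i ≤ r, t.red i = (I.delete d).reducedGraph i ∧
      (∀ k, 1 ≤ k → k ≤ i → (I.delete d).FollowsAt t k) ∧ I.DeletionState M d i (t.M i) ∧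
      ∀ k < i, Relation.ReflTransGen (Augments (t.pre (k + 1))) (t.M k) (t.M (k + 1)) := by
  have hfg := (hg.follows r le_rfl).2
  intro i
  induction i with
  | zero =>
    exact fun _ => ⟨h.red_zero.trans reducedGraph_zero.symm, fun k h1 h2 => by omega,
      h.M_zero ▸ DeletionState.zero hM, by simp⟩
  | succ i ih =>
    intro hi
    obtain ⟨hred, hfol, hst, hchain⟩ := ih (by omega)
    have hpre : t.pre (i + 1) = (I.delete d).stageGraph (i + 1) := by
      rw [h.pre_succ i (by omega), hred]
      exact (stageGraph_delete_succ (fun k h1 h2 => hfg k h1 (by omega)) hfol).symm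
    have hstep : I.DeletionStep M d (i + 1) (t.M i) (t.M (i + 1)) := by
      by_cases hd : Matched (upToRank I.rank M (i + 1)) d
      · obtain ⟨e, he, hed⟩ := hd
        rcases Nat.eq_or_lt_of_le he.2 with hr | hr
        · obtain ⟨w, hj⟩ := hed.exists_joins
          obtain ⟨h1, h2⟩ := losesPair_carry hM hst he.1 hr hj
          have hiff := augmentsFrom_iff_mem_oddSet hM hst he.1 hr hj
          have hfr := hfg (i + 1) (by omega) hi
          by_cases hw : w ∈ I.oddSet (I.stageGraph (i + 1))
          · refine Or.inl ⟨w, (lost_eq_singleton hM h1).symm ▸ rfl, ?_⟩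
            have := h.atOdd e he.1 w hj (by rw [hr]; exact hfr.oddAt_iff.2 hw)
            rwa [hr, hpre, ← h2] at this
          · refine Or.inr ⟨?_, ?_⟩
            · rintro ⟨x, hx, haug⟩
              rw [lost_eq_singleton hM h1] at hx
              obtain rfl := hx
              exact hw (hiff.1 haug)
            · have hwV : w ∈ I.vertices := incident_mem_vertices (hM.1.1 he.1) hj.incident_right
              by_cases hwe : w ∈ I.evenSet (I.stageGraph (i + 1))
              · have := h.atEven e he.1 w hj (by rw [hr]; exact hfr.evenAt_iff.2 hwe)
                rwa [hr, ← h2] at this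
              · have := h.atUnreachable e he.1 w hj
                  (by rw [hr]; exact hfr.unreachableAt_iff.2 ⟨⟨hwV, hwe⟩, hw⟩)
                rwa [hr, ← h2] at this
        · by_cases hex : ∃ x ∈ I.freed M d t (i + 1), ∃ N,
              AugmentsFrom (t.pre (i + 1)) (I.carried M d t (i + 1)) x N
          · have := h.afterAugment e he.1 hed (i + 1) hi hr hex
            rw [hpre] at this
            exact Or.inl this
          · have := h.afterKeep e he.1 hed (i + 1) hi hr hex
            rw [hpre] at hex
            exact Or.inr ⟨hex, this⟩
      · have hCM := (carry_cases hM hst).resolve_right fun h => hd h.1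
        have hl : I.lost M d (t.M i) (i + 1) = ∅ := lost_eq_empty fun z hz _ => hCM.2 ▸ hz
        refine Or.inr ⟨?_, (h.before (i + 1) hi hd).trans hCM.2.symm⟩
        rintro ⟨x, hx, _⟩
        rw [hl] at hx
        exact hx
    obtain ⟨hst', haug⟩ := hst.step hM hstep
    have hf : (I.delete d).FollowsAt t (i + 1) := ⟨hpre, hst'.maximum⟩
    refine ⟨?_, fun k h1 h2 => ?_, hst', fun k hk => ?_⟩
    · rw [h.red_succ i (by omega), hf.uselessEdges_eq, hpre, reducedGraph_succ]
    · rcases Nat.eq_or_lt_of_le h2 with rfl | h2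
      · exact hf
      · exact hfol k h1 (by omega)
    · rcases Nat.eq_or_lt_of_le (Nat.lt_succ_iff.1 hk) with rfl | hk
      · rwa [hpre]
      · exact hchain k hk

/-- Every execution of the vertex-deletion algorithm is correct. -/
theorem IsDeletionRun.correct (hM : I.RankMaximal M)
    (hr : ∀ N, (I.delete d).RankMaximal N → ∀ e ∈ N, (I.delete d).rank e ≤ r)
    (hg : I.IsIrvingRun r g) (h : I.IsDeletionRun r M g d t) :
    (I.delete d).IsIrvingRun r t ∧ (I.delete d).RankMaximal (t.M r) ∧
      ∀ t', (I.delete d).IsIrvingRun r t' → ∀ i, 1 ≤ i → i ≤ r → t'.red i = t.red i := by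
  have hf := h.follows hM hg
  refine ⟨⟨h.M_zero, h.red_zero, fun i hi => ?_, fun i hi => ?_, fun i hi => ?_, h.red_succ⟩, ?_,
    fun t' ht' i _ hi => ?_⟩
  · rw [((hf (i + 1) hi).2.1 (i + 1) (by omega) le_rfl).1, stageGraph_succ, (hf i hi.le).1,
      closedBy_eq (hf i hi.le).2.1]
  · exact (hf (i + 1) hi).2.2.2 i (Nat.lt_succ_self i)
  · have := (hf (i + 1) hi).2.1 (i + 1) (by omega) le_rfl
    exact this.1 ▸ this.2
  · have hst := (hf r le_rfl).2.2.1
    exact (optimal_of_isMaximumMatching hst.maximum fun x hx =>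
      hst.covers x (closedSet_mono (Nat.sub_le r 1) hx)).rankMaximal hr
  · rw [(hf i hi).1, (ht'.follows i hi).1]

end RankInstance

end DeletionRuns

/-! ### Programs of the random access machine -/

theorem Store.reg_setReg (s : Store) (x n y : ℕ) :
    (s.setReg x n).reg y = if y = x then n else s.reg y := by
  simp [Store.setReg, Function.update_apply]

theorem Store.cell_setReg (s : Store) (x n : ℕ) : (s.setReg x n).cell = s.cell := rfl

theorem Store.reg_setCell (s : Store) (a i n : ℕ) : (s.setCell a i n).reg = s.reg := rfl

theorem Store.cell_setCell (s : Store) (a i n b j : ℕ) :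
    (s.setCell a i n).cell b j = if b = a ∧ j = i then n else s.cell b j := by
  by_cases hb : b = a
  · subst hb
    by_cases hj : j = i <;> simp [Store.setCell, hj]
  · simp [Store.setCell, hb]

namespace Prog

/-- The program contains no loop. -/
def LoopFree : Prog → Prop
  | .skip => True
  | .setReg _ _ => True
  | .setCell _ _ _ => True
  | .seq p q => p.LoopFree ∧ q.LoopFree
  | .ite _ p q => p.LoopFree ∧ q.LoopFree
  | .loop _ _ => False

open Classical in
/-- The effect of a program without loops. -/
noncomputable def run : Prog → Store → Store
  | .skip, s => s
  | .setReg x e, s => s.setReg x (e.eval s)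
  | .setCell a i e, s => s.setCell a (i.eval s) (e.eval s)
  | .seq p q, s => q.run (p.run s)
  | .ite c p q, s => if c.holds s then p.run s else q.run s
  | .loop _ _, s => s

/-- A bound for the running time of a program without loops. -/
def maxTime : Prog → ℕ
  | .skip => 1
  | .setReg _ e => e.cost + 1
  | .setCell _ i e => i.cost + e.cost + 1
  | .seq p q => p.maxTime + q.maxTime
  | .ite c p q => c.cost + max p.maxTime q.maxTime
  | .loop _ _ => 0

theorem exec_run {p : Prog} (hp : p.LoopFree) (s : Store) :
    ∃ t ≤ p.maxTime, Exec p s (p.run s) t := by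
  induction p generalizing s with
  | skip => exact ⟨1, le_rfl, .skip s⟩
  | setReg x e => exact ⟨_, le_rfl, .setReg s x e⟩
  | setCell a i e => exact ⟨_, le_rfl, .setCell s a i e⟩
  | seq p q ihp ihq =>
    obtain ⟨t1, h1, e1⟩ := ihp hp.1 s
    obtain ⟨t2, h2, e2⟩ := ihq hp.2 (p.run s)
    exact ⟨t1 + t2, Nat.add_le_add h1 h2, .seq e1 e2⟩
  | ite c p q ihp ihq =>
    by_cases hc : c.holds s
    · obtain ⟨t, h, e⟩ := ihp hp.1 s
      refine ⟨c.cost + t, Nat.add_le_add_left (h.trans (le_max_left _ _)) _, ?_⟩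
      rw [run, if_pos hc]
      exact .iteTrue hc e
    · obtain ⟨t, h, e⟩ := ihq hp.2 s
      refine ⟨c.cost + t, Nat.add_le_add_left (h.trans (le_max_right _ _)) _, ?_⟩
      rw [run, if_neg hc]
      exact .iteFalse hc e
  | loop c p _ => exact hp.elim

/-- The registers that a program may change. -/
def regs : Prog → List ℕ
  | .skip => []
  | .setReg x _ => [x]
  | .setCell _ _ _ => []
  | .seq p q => p.regs ++ q.regs
  | .ite _ p q => p.regs ++ q.regs
  | .loop _ p => p.regs

/-- The arrays that a program may change. -/
def arrays : Prog → List ℕ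
  | .skip => []
  | .setReg _ _ => []
  | .setCell a _ _ => [a]
  | .seq p q => p.arrays ++ q.arrays
  | .ite _ p q => p.arrays ++ q.arrays
  | .loop _ p => p.arrays

end Prog

/-- The memory `s'` agrees with `s` outside the registers `R` and the arrays `B`. -/
def Store.AgreesOff (R B : List ℕ) (s s' : Store) : Prop :=
  (∀ x, x ∉ R → s'.reg x = s.reg x) ∧ ∀ a, a ∉ B → s'.cell a = s.cell a

theorem Store.AgreesOff.trans {R B : List ℕ} {s₁ s₂ s₃ : Store} (h : s₁.AgreesOff R B s₂)
    (h' : s₂.AgreesOff R B s₃) : s₁.AgreesOff R B s₃ :=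
  ⟨fun x hx => (h'.1 x hx).trans (h.1 x hx), fun a ha => (h'.2 a ha).trans (h.2 a ha)⟩

theorem Store.AgreesOff.mono {R B R' B' : List ℕ} {s s' : Store} (h : s.AgreesOff R B s')
    (hR : R ⊆ R') (hB : B ⊆ B') : s.AgreesOff R' B' s' :=
  ⟨fun x hx => h.1 x fun hx' => hx (hR hx'), fun a ha => h.2 a fun ha' => ha (hB ha')⟩

theorem Store.AgreesOff.refl (R B : List ℕ) (s : Store) : s.AgreesOff R B s :=
  ⟨fun _ _ => rfl, fun _ _ => rfl⟩

theorem Exec.agreesOff {p : Prog} {s s' : Store} {t : ℕ} (h : Exec p s s' t) :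
    s.AgreesOff p.regs p.arrays s' := by
  induction h with
  | skip s => exact .refl _ _ s
  | setReg s x e =>
    refine ⟨fun y hy => ?_, fun _ _ => rfl⟩
    rw [Store.reg_setReg, if_neg]
    simpa [Prog.regs] using hy
  | setCell s a i e =>
    refine ⟨fun _ _ => rfl, fun b hb => ?_⟩
    funext j
    rw [Store.cell_setCell, if_neg]
    rintro ⟨rfl, _⟩
    simp [Prog.arrays] at hb
  | seq _ _ ih1 ih2 =>
    exact (ih1.mono (List.subset_append_left _ _) (List.subset_append_left _ _)).trans
      (ih2.mono (List.subset_append_right _ _) (List.subset_append_right _ _))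
  | iteTrue _ _ ih => exact ih.mono (List.subset_append_left _ _) (List.subset_append_left _ _)
  | iteFalse _ _ ih => exact ih.mono (List.subset_append_right _ _) (List.subset_append_right _ _)
  | loopStop _ => exact .refl _ _ _
  | loopStep _ _ _ ih1 ih2 => exact ih1.trans ih2

/-- Started with the memory `s`, the program halts within `T` steps in a memory with the property
`Q`. -/
def Reaches (p : Prog) (s : Store) (T : ℕ) (Q : Store → Prop) : Prop :=
  ∃ s' t, Exec p s s' t ∧ t ≤ T ∧ Q s'

namespace Reaches

variable {p q : Prog} {s : Store} {T T' : ℕ} {Q Q' : Store → Prop}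

theorem mono (h : Reaches p s T Q) (hT : T ≤ T') (hQ : ∀ s', Q s' → Q' s') :
    Reaches p s T' Q' := by
  obtain ⟨s', t, e, ht, hs⟩ := h
  exact ⟨s', t, e, ht.trans hT, hQ s' hs⟩

theorem seq (h : Reaches p s T Q) (h' : ∀ s', Q s' → Reaches q s' T' Q') :
    Reaches (.seq p q) s (T + T') Q' := by
  obtain ⟨s', t, e, ht, hs⟩ := h
  obtain ⟨s'', t', e', ht', hs'⟩ := h' s' hs
  exact ⟨s'', t + t', .seq e e', Nat.add_le_add ht ht', hs'⟩

theorem frame (h : Reaches p s T Q) :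
    Reaches p s T (fun s' => Q s' ∧ s.AgreesOff p.regs p.arrays s') := by
  obtain ⟨s', t, e, ht, hs⟩ := h
  exact ⟨s', t, e, ht, hs, e.agreesOff⟩

theorem of_loopFree (hp : p.LoopFree) (hQ : Q (p.run s)) : Reaches p s p.maxTime Q := by
  obtain ⟨t, ht, e⟩ := Prog.exec_run hp s
  exact ⟨_, t, e, ht, hQ⟩

/-- A loop with an invariant and a measure that decreases in every round. -/
theorem loop {c : Test} {K : ℕ} (Inv : Store → Prop) (φ : Store → ℕ)
    (step : ∀ s, Inv s → c.holds s → Reaches p s K (fun s' => Inv s' ∧ φ s' < φ s))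
    (h : Inv s) :
    Reaches (.loop c p) s ((K + c.cost) * φ s + c.cost) (fun s' => Inv s' ∧ ¬ c.holds s') := by
  induction hn : φ s using Nat.strong_induction_on generalizing s with
  | _ n ih =>
    by_cases hc : c.holds s
    · obtain ⟨s', t, e, ht, hs', hlt⟩ := step s h hc
      obtain ⟨s'', t', e', ht', hs''⟩ := ih (φ s') (hn ▸ hlt) hs' rfl
      refine ⟨s'', _, .loopStep hc e e', ?_, hs''⟩
      have h1 : (K + c.cost) * (φ s' + 1) ≤ (K + c.cost) * n := Nat.mul_le_mul_left _ (hn ▸ hlt)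
      rw [Nat.mul_add_one] at h1
      omega
    · exact ⟨s, _, .loopStop hc, Nat.le_add_left _ _, h, hc⟩

end Reaches

/-- The loop in which register `x` counts from `0` up to the content of register `N`. -/
def Prog.forLoop (x N : ℕ) (body : Prog) : Prog :=
  .seq (.setReg x (.lit 0))
    (.loop (.lt (.reg x) (.reg N)) (.seq body (.setReg x (.succ (.reg x)))))

/-- Counting loops with an invariant `Inv k` at the beginning of round `k`. The state in which round
`k` leaves the counter is made explicit, so that the invariant need not mention it. -/
theorem Reaches.forLoop {x N : ℕ} {body : Prog} {s : Store} (hb : body.LoopFree) (hxN : N ≠ x)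
    (hx : x ∉ body.regs) (hN : N ∉ body.regs) (Inv : ℕ → Store → Prop)
    (h0 : Inv 0 (s.setReg x 0))
    (step : ∀ k s', k < s.reg N → s'.reg x = k → s.AgreesOff (x :: body.regs) body.arrays s' →
      Inv k s' → Inv (k + 1) ((body.run s').setReg x (k + 1))) :
    Reaches (Prog.forLoop x N body) s ((body.maxTime + 6) * (s.reg N + 1))
      (fun s' => Inv (s.reg N) s' ∧ s.AgreesOff (x :: body.regs) body.arrays s') := by
  have hset : ∀ s' n, s.AgreesOff (x :: body.regs) body.arrays s' →
      s.AgreesOff (x :: body.regs) body.arrays (s'.setReg x n) := fun s' n h =>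
    ⟨fun y hy => by
      rw [Store.reg_setReg, if_neg (by rintro rfl; simp at hy), h.1 y hy], h.2⟩
  have hlf : (Prog.setReg x (.lit 0)).LoopFree := trivial
  have hinit := Reaches.of_loopFree (s := s) (Q := fun s' => s' = s.setReg x 0) hlf rfl
  refine Reaches.mono (hinit.seq (T' := (body.maxTime + 3 + 3) * s.reg N + 3)
    (Q' := fun s' => Inv (s.reg N) s' ∧ s.AgreesOff (x :: body.regs) body.arrays s') ?_)
    ?_ (fun _ h => h)
  · rintro _ rfl
    have := Reaches.loop (p := .seq body (.setReg x (.succ (.reg x))))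
      (c := .lt (.reg x) (.reg N)) (K := body.maxTime + 3) (s := s.setReg x 0)
      (Inv := fun s' => s'.reg x ≤ s.reg N ∧ Inv (s'.reg x) s' ∧
        s.AgreesOff (x :: body.regs) body.arrays s') (fun s' => s.reg N - s'.reg x) ?_ ?_
    · refine this.mono ?_ ?_
      · simp [Store.reg_setReg, Test.cost, Expr.cost]
      · rintro s' ⟨⟨h1, h2, h3⟩, h4⟩
        have hNs : s'.reg N = s.reg N := h3.1 N (by simp [hxN, hN])
        simp only [Test.holds, Expr.eval, hNs, not_lt] at h4
        rw [le_antisymm h1 h4] at h2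
        exact ⟨h2, h3⟩
    · rintro s' ⟨h1, h2, h3⟩ h4
      have hNs : s'.reg N = s.reg N := h3.1 N (by simp [hxN, hN])
      simp only [Test.holds, Expr.eval, hNs] at h4
      obtain ⟨t, ht, hex⟩ := Prog.exec_run hb s'
      have hag := hex.agreesOff
      have hxs : (body.run s').reg x = s'.reg x := hag.1 x hx
      refine ⟨(body.run s').setReg x (s'.reg x + 1), t + 3, ?_, by omega, ⟨?_, ?_, ?_⟩, ?_⟩
      · refine .seq hex ?_
        have := Exec.setReg (body.run s') x (.succ (.reg x))
        simpa [Expr.eval, Expr.cost, hxs] using this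
      · simpa [Store.reg_setReg] using h4
      · rw [Store.reg_setReg, if_pos rfl]
        exact step _ s' h4 rfl h3 h2
      · exact hset _ _ (h3.trans (hag.mono (List.subset_cons_self _ _) (List.Subset.refl _)))
      · rw [Store.reg_setReg, if_pos rfl]
        omega
    · refine ⟨by simp [Store.reg_setReg], by simpa [Store.reg_setReg] using h0, ?_⟩
      exact hset _ _ (.refl _ _ _)
  · have h6 : body.maxTime + 3 + 3 = body.maxTime + 6 := rfl
    simp only [Prog.maxTime, Expr.cost]
    rw [Nat.mul_add_one, h6]
    omega

/-! ### Graph search on numbered vertices -/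

/-- The successor of the largest number below `b` with the property `Q`, and `0` if there is none.
Adjacency lists are linked from larger to smaller edge numbers, an edge `e` being represented by
`e + 1` and the end of a list by `0`; so their links are values of this function. -/
noncomputable def lastBelow (Q : ℕ → Prop) : ℕ → ℕ
  | 0 => 0
  | b + 1 => open Classical in if Q b then b + 1 else lastBelow Q b

section LastBelow

variable {Q : ℕ → Prop} {b e : ℕ}

theorem lastBelow_le : lastBelow Q b ≤ b := by
  induction b with
  | zero => exact le_rfl
  | succ b ih =>
    rw [lastBelow]
    split_ifs
    · exact le_rfl
    · omega

theorem lastBelow_spec (h : lastBelow Q b ≠ 0) : Q (lastBelow Q b - 1) := by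
  induction b with
  | zero => exact absurd rfl h
  | succ b ih =>
    rw [lastBelow] at h ⊢
    split_ifs at h ⊢ with hb
    · exact hb
    · exact ih h

theorem not_of_lastBelow_le (h : lastBelow Q b ≤ e) (he : e < b) : ¬ Q e := by
  induction b with
  | zero => omega
  | succ b ih =>
    rw [lastBelow] at h
    split_ifs at h with hb
    · omega
    · rcases Nat.eq_or_lt_of_le (Nat.lt_succ_iff.1 he) with rfl | h'
      · exact hb
      · exact ih h h'

open Classical in
theorem count_lastBelow : Nat.count Q (lastBelow Q b) = Nat.count Q b := by
  induction b with
  | zero => rfl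
  | succ b ih =>
    rw [lastBelow]
    split_ifs with hb
    · rfl
    · rw [ih, Nat.count_succ, if_neg hb, add_zero]

end LastBelow

/-- A bipartite graph with a matching, on numbered vertices: the edge `e < m` joins `ap e` and
`po e` if it is `active`, and `mate v` is the successor of the partner of `v`, and `0` if `v` is
unmatched. -/
structure NumberedGraph where
  n : ℕ
  m : ℕ
  ap : ℕ → ℕ
  po : ℕ → ℕ
  active : ℕ → Prop
  mate : ℕ → ℕ
  side : ℕ → Bool
  ap_lt : ∀ e < m, ap e < n
  po_lt : ∀ e < m, po e < n
  side_ne : ∀ e < m, side (ap e) ≠ side (po e)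
  mate_spec : ∀ v < n, ∀ w, mate v = w + 1 → w < n ∧ mate w = v + 1 ∧ side v ≠ side w

namespace NumberedGraph

variable (Γ : NumberedGraph)

/-- The active edge `e` is incident to `v`. -/
def Inc (v e : ℕ) : Prop := Γ.active e ∧ (Γ.ap e = v ∨ Γ.po e = v)

/-- The edge `e` joins `u` and `y`. -/
def Link (e u y : ℕ) : Prop := (Γ.ap e = u ∧ Γ.po e = y) ∨ (Γ.po e = u ∧ Γ.ap e = y)

/-- An active edge joins `u` and `y`. -/
def Adj (u y : ℕ) : Prop := ∃ e < Γ.m, Γ.active e ∧ Γ.Link e u y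

/-- An alternating path from a root whose edges outside the matching are recorded in `par`. -/
structure TracePath (root : ℕ → Prop) (par : ℕ → ℕ) (l : ℕ) (p : ℕ → ℕ) : Prop where
  inj : ∀ s ≤ l, ∀ t ≤ l, p s = p t → s = t
  start : root (p 0)
  even_step : ∀ t < l, Even t → par (p (t + 1)) = p t + 1 ∧ Γ.Adj (p t) (p (t + 1))
  odd_step : ∀ t < l, Odd t → Γ.mate (p t) = p (t + 1) + 1
  lt : ∀ t ≤ l, p t < Γ.n

variable {Γ} {root : ℕ → Prop} {par par' : ℕ → ℕ} {l : ℕ} {p : ℕ → ℕ}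

theorem Adj.lt {u y : ℕ} (h : Γ.Adj u y) : y < Γ.n := by
  obtain ⟨e, he, _, ⟨_, rfl⟩ | ⟨_, rfl⟩⟩ := h
  · exact Γ.po_lt e he
  · exact Γ.ap_lt e he

theorem Adj.side_ne {u y : ℕ} (h : Γ.Adj u y) : Γ.side y ≠ Γ.side u := by
  obtain ⟨e, he, _, ⟨rfl, rfl⟩ | ⟨rfl, rfl⟩⟩ := h
  · exact (Γ.side_ne e he).symm
  · exact Γ.side_ne e he

namespace TracePath

theorem mono (h : Γ.TracePath root par l p) (hp : ∀ v, par v ≠ 0 → par' v = par v) :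
    Γ.TracePath root par' l p :=
  ⟨h.inj, h.start, fun t ht hte => by
    have := h.even_step t ht hte
    exact ⟨(hp _ (by omega)).trans this.1, this.2⟩, h.odd_step, h.lt⟩

theorem side_eq (h : Γ.TracePath root par l p) {t : ℕ} (ht : t ≤ l) :
    (Odd t → Γ.side (p t) = !Γ.side (p 0)) ∧ (Even t → Γ.side (p t) = Γ.side (p 0)) := by
  induction t with
  | zero => exact ⟨fun h => absurd h (by simp), fun _ => rfl⟩
  | succ t ih =>
    have ih := ih (by omega)
    rw [Nat.odd_add_one, Nat.even_add_one, Nat.not_odd_iff_even, Nat.not_even_iff_odd]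
    constructor
    · intro hte
      have h1 := (h.even_step t ht hte).2.side_ne
      rw [ih.2 hte] at h1
      exact Bool.eq_not_of_ne h1
    · intro hto
      have h1 := (Γ.mate_spec _ (h.lt t (by omega)) _ (h.odd_step t ht hto)).2.2
      rw [ih.1 hto] at h1
      cases h2 : Γ.side (p 0) <;> cases h3 : Γ.side (p (t + 1)) <;> simp [h2, h3] at h1 ⊢

theorem extend (h : Γ.TracePath root par l p) {z : ℕ} (hz : ∀ t ≤ l, p t ≠ z) (hzn : z < Γ.n)
    (he : Even l → par z = p l + 1 ∧ Γ.Adj (p l) z) (ho : Odd l → Γ.mate (p l) = z + 1) :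
    Γ.TracePath root par (l + 1) (Function.update p (l + 1) z) := by
  have hp : ∀ t ≤ l, Function.update p (l + 1) z t = p t := fun t ht =>
    Function.update_of_ne (by omega) _ _
  have hlast : Function.update p (l + 1) z (l + 1) = z := Function.update_self ..
  refine ⟨?_, by rw [hp 0 (by omega)]; exact h.start, ?_, ?_, ?_⟩
  · intro s hs t ht hst
    rcases Nat.lt_or_ge l s with hs' | hs' <;> rcases Nat.lt_or_ge l t with ht' | ht'
    · omega
    · obtain rfl : s = l + 1 := by omega
      rw [hp t ht', hlast] at hst
      exact absurd hst.symm (hz t ht')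
    · obtain rfl : t = l + 1 := by omega
      rw [hp s hs', hlast] at hst
      exact absurd hst (hz s hs')
    · rw [hp s hs', hp t ht'] at hst
      exact h.inj s hs' t ht' hst
  · intro t ht hte
    rcases Nat.lt_or_ge t l with ht' | ht'
    · rw [hp t ht'.le, hp (t + 1) ht']
      exact h.even_step t ht' hte
    · obtain rfl : t = l := by omega
      rw [hp t le_rfl, hlast]
      exact he hte
  · intro t ht hto
    rcases Nat.lt_or_ge t l with ht' | ht'
    · rw [hp t ht'.le, hp (t + 1) ht']
      exact h.odd_step t ht' hto
    · obtain rfl : t = l := by omega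
      rw [hp t le_rfl, hlast]
      exact ho hto
  · intro t ht
    rcases Nat.lt_or_ge l t with ht' | ht'
    · obtain rfl : t = l + 1 := by omega
      rwa [hlast]
    · rw [hp t ht']
      exact h.lt t ht'

/-- An unmarked neighbour of the last vertex of an even path is new to the path. -/
theorem extend_par (h : Γ.TracePath root par l p) (hl : Even l) {y : ℕ} (hy : par y = 0)
    (hadj : Γ.Adj (p l) y) :
    Γ.TracePath root (Function.update par y (p l + 1)) (l + 1) (Function.update p (l + 1) y) := by
  have hm : Γ.TracePath root (Function.update par y (p l + 1)) l p := h.mono fun v hv =>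
    Function.update_of_ne (by rintro rfl; exact hv hy) _ _
  refine hm.extend ?_ hadj.lt (fun _ => ⟨Function.update_self .., hadj⟩)
    (fun ho => absurd hl (Nat.not_even_iff_odd.2 ho))
  rintro t ht rfl
  rcases Nat.even_or_odd t with hte | ⟨s, rfl⟩
  · exact hadj.side_ne (((h.side_eq ht).2 hte).trans ((h.side_eq le_rfl).2 hl).symm)
  · have := (h.even_step (2 * s) (by omega) (by simp)).1
    omega

/-- The partner of the last vertex of an odd path is new to the path if it is not marked even. -/
theorem extend_mate (h : Γ.TracePath root par l p) (hl : Odd l) {z : ℕ} {ev : ℕ → ℕ}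
    (hev : ∀ t ≤ l, Even t → ev (p t) ≠ 0) (hz : ev z = 0) (hm : Γ.mate (p l) = z + 1) :
    Γ.TracePath root par (l + 1) (Function.update p (l + 1) z) := by
  obtain ⟨hzn, _, hs⟩ := Γ.mate_spec _ (h.lt l le_rfl) _ hm
  refine h.extend ?_ hzn (fun he => absurd he (Nat.not_even_iff_odd.2 hl)) (fun _ => hm)
  rintro t ht rfl
  rcases Nat.even_or_odd t with hte | hto
  · exact hev t ht hte hz
  · exact hs (((h.side_eq le_rfl).1 hl).trans ((h.side_eq ht).1 hto).symm)

end TracePath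

end NumberedGraph

/-- The variables of the search: `par v` is the successor of the vertex from which the odd vertex
`v` was reached, `ev` marks the even vertices, which are put into `queue`; the entries before `qh` have
been taken from the queue, and `qt` is its length. The search scans the edges of the vertex `cur`,
which was taken last; `ptr` points to the next edge. The search stops when `go` becomes `0`, and
`found` is the successor of an unmatched vertex that has been reached, if any. -/
structure SearchState where
  par : ℕ → ℕ
  ev : ℕ → ℕ
  queue : ℕ → ℕ
  qh : ℕ
  qt : ℕ
  ptr : ℕ
  cur : ℕ
  found : ℕ
  go : ℕ

/-- The invariant of the search. The properties `E` and `O` are arbitrary properties that propagate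
along alternating paths from the roots, and serve to state that only reachable vertices are
marked. -/
structure SearchInv (Γ : NumberedGraph) (root E O : ℕ → Prop) (σ : SearchState) : Prop where
  qh_le : σ.qh ≤ σ.qt
  queue_lt : ∀ k < σ.qt, σ.queue k < Γ.n
  queue_inj : ∀ j < σ.qt, ∀ k < σ.qt, σ.queue j = σ.queue k → j = k
  ev_iff : ∀ v < Γ.n, σ.ev v ≠ 0 ↔ ∃ k < σ.qt, σ.queue k = v
  root_ev : ∀ v, root v → v < Γ.n ∧ σ.ev v ≠ 0
  queue_mate : ∀ k < σ.qt, root (σ.queue k) ∨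
    ∃ y < Γ.n, Γ.mate y = σ.queue k + 1 ∧ σ.par y ≠ 0
  par_odd : ∀ v < Γ.n, σ.par v ≠ 0 → O v
  queue_even : ∀ k < σ.qt, E (σ.queue k)
  queue_path : ∀ k < σ.qt, ∃ l p, Even l ∧ p l = σ.queue k ∧ Γ.TracePath root σ.par l p ∧
    ∀ t ≤ l, Even t → σ.ev (p t) ≠ 0
  par_ev : σ.found = 0 → ∀ y < Γ.n, σ.par y ≠ 0 → ∃ z < Γ.n, Γ.mate y = z + 1 ∧ σ.ev z ≠ 0
  found_spec : σ.found ≠ 0 → σ.go = 0 ∧ ∃ l p, Odd l ∧ σ.found = p l + 1 ∧ Γ.mate (p l) = 0 ∧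
    Γ.TracePath root σ.par l p
  done : σ.found = 0 → ∀ k < σ.qh, ∀ e < Γ.m, Γ.active e → (k + 1 = σ.qh → σ.ptr ≤ e) →
    ∀ y, Γ.Link e (σ.queue k) y → σ.par y ≠ 0
  cur_spec : σ.ptr ≠ 0 → 0 < σ.qh ∧ σ.cur = σ.queue (σ.qh - 1) ∧ σ.ptr ≤ Γ.m ∧
    Γ.Inc σ.cur (σ.ptr - 1)
  halted : σ.go = 0 → σ.found = 0 → σ.ptr = 0 ∧ σ.qh = σ.qt

open Classical in
/-- A bound for the number of steps that the search has still to do: one for each vertex that has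
not been taken from the queue, and one for each edge at such a vertex and for each edge of the
current vertex that has not been scanned. -/
noncomputable def searchMeasure (Γ : NumberedGraph) (σ : SearchState) : ℕ :=
  (∑ v ∈ (Finset.range Γ.n).filter (fun v => ∀ k < σ.qh, σ.queue k ≠ v),
    (1 + Nat.count (Γ.Inc v) Γ.m)) + Nat.count (Γ.Inc σ.cur) σ.ptr + min σ.go 1

namespace SearchInv

variable {Γ : NumberedGraph} {root E O : ℕ → Prop} {σ : SearchState}

theorem found_eq_zero (h : SearchInv Γ root E O σ) (hgo : σ.go ≠ 0) : σ.found = 0 := by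
  by_contra hc
  exact hgo (h.found_spec hc).1

theorem halt (h : SearchInv Γ root E O σ) (hgo : σ.go ≠ 0) (hp : σ.ptr = 0)
    (hq : ¬ σ.qh < σ.qt) : SearchInv Γ root E O { σ with go := 0 } ∧
      searchMeasure Γ { σ with go := 0 } < searchMeasure Γ σ := by
  have hf := h.found_eq_zero hgo
  refine ⟨{ h with
    found_spec := fun hc => absurd hf hc
    halted := fun _ _ => ⟨hp, le_antisymm h.qh_le (not_lt.1 hq)⟩ }, ?_⟩
  simp only [searchMeasure]
  omega

theorem pop (h : SearchInv Γ root E O σ) (hgo : σ.go ≠ 0) (hp : σ.ptr = 0) (hq : σ.qh < σ.qt) :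
    SearchInv Γ root E O { σ with
      cur := σ.queue σ.qh
      ptr := lastBelow (Γ.Inc (σ.queue σ.qh)) Γ.m
      qh := σ.qh + 1 } ∧
    searchMeasure Γ { σ with
      cur := σ.queue σ.qh
      ptr := lastBelow (Γ.Inc (σ.queue σ.qh)) Γ.m
      qh := σ.qh + 1 } < searchMeasure Γ σ := by
  classical
  refine ⟨{ h with
    qh_le := hq
    done := fun hf k hk e he hact hpe y hy => ?_
    cur_spec := fun hne => ⟨Nat.succ_pos _, rfl, lastBelow_le, lastBelow_spec hne⟩
    halted := fun hc => absurd hc hgo }, ?_⟩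
  · rcases Nat.eq_or_lt_of_le (Nat.lt_succ_iff.1 hk) with rfl | hk
    · exact absurd ⟨hact, hy.imp And.left And.left⟩ (not_of_lastBelow_le (hpe rfl) he)
    · exact h.done hf k hk e he hact (fun _ => by omega) y hy
  · simp only [searchMeasure, hp, Nat.count_zero, count_lastBelow]
    have hrest : (Finset.range Γ.n).filter (fun v => ∀ k < σ.qh + 1, σ.queue k ≠ v) =
        ((Finset.range Γ.n).filter (fun v => ∀ k < σ.qh, σ.queue k ≠ v)).erase
          (σ.queue σ.qh) := by
      ext v
      simp only [Finset.mem_filter, Finset.mem_erase]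
      constructor
      · rintro ⟨h1, h2⟩
        exact ⟨fun hc => h2 σ.qh (by omega) hc.symm, h1, fun k hk => h2 k (by omega)⟩
      · rintro ⟨h1, h2, h3⟩
        refine ⟨h2, fun k hk => ?_⟩
        rcases Nat.eq_or_lt_of_le (Nat.lt_succ_iff.1 hk) with rfl | hk
        · exact fun hc => h1 hc.symm
        · exact h3 k hk
    have hmem : σ.queue σ.qh ∈
        (Finset.range Γ.n).filter (fun v => ∀ k < σ.qh, σ.queue k ≠ v) := by
      refine Finset.mem_filter.2 ⟨Finset.mem_range.2 (h.queue_lt _ hq), fun k hk hc => ?_⟩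
      have := h.queue_inj k (hk.trans hq) _ hq hc
      omega
    rw [hrest, ← Finset.sum_erase_add _ _ hmem]
    omega

/-- The scanned edges of the current vertex, after one more edge. -/
theorem link_marked (h : SearchInv Γ root E O σ) {e y : ℕ} (hp : σ.ptr = e + 1)
    (hy : Γ.Link e σ.cur y) {par : ℕ → ℕ} (hpar : ∀ v, σ.par v ≠ 0 → par v ≠ 0)
    (hpy : par y ≠ 0) (hf : σ.found = 0) : ∀ k < σ.qh, ∀ f < Γ.m, Γ.active f →
      (k + 1 = σ.qh → lastBelow (Γ.Inc σ.cur) e ≤ f) →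
      ∀ z, Γ.Link f (σ.queue k) z → par z ≠ 0 := by
  obtain ⟨hq, hcur, hpm, hinc⟩ := h.cur_spec (by omega)
  intro k hk f hf' hact hpf z hz
  by_cases hkq : k + 1 = σ.qh
  · obtain rfl : k = σ.qh - 1 := by omega
    rw [← hcur] at hz
    rcases Nat.lt_trichotomy f e with hfe | rfl | hfe
    · exact absurd ⟨hact, hz.imp And.left And.left⟩ (not_of_lastBelow_le (hpf hkq) hfe)
    · have hne := Γ.side_ne f hf'
      have : z = y := by
        rcases hy with ⟨h1, h2⟩ | ⟨h1, h2⟩ <;> rcases hz with ⟨h3, h4⟩ | ⟨h3, h4⟩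
        · rw [← h2, ← h4]
        · exact absurd (by rw [h1, h3]) hne
        · exact absurd (by rw [h1, h3]) hne
        · rw [← h2, ← h4]
      exact this ▸ hpy
    · rw [hcur] at hz
      exact hpar _ (h.done hf _ hk f hf' hact (fun _ => by omega) z hz)
  · exact hpar _ (h.done hf k hk f hf' hact (fun hc => absurd hc hkq) z hz)

open Classical in
theorem measure_link (h : SearchInv Γ root E O σ) {e : ℕ} (hp : σ.ptr = e + 1) :
    Nat.count (Γ.Inc σ.cur) (lastBelow (Γ.Inc σ.cur) e) + 1 = Nat.count (Γ.Inc σ.cur) σ.ptr := by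
  obtain ⟨-, -, -, hinc⟩ := h.cur_spec (by omega)
  rw [hp, Nat.add_sub_cancel] at hinc
  rw [hp, count_lastBelow, Nat.count_succ, if_pos hinc]

theorem cur_lastBelow (h : SearchInv Γ root E O σ) {e : ℕ} (hp : σ.ptr = e + 1)
    (hne : lastBelow (Γ.Inc σ.cur) e ≠ 0) : 0 < σ.qh ∧ σ.cur = σ.queue (σ.qh - 1) ∧
      lastBelow (Γ.Inc σ.cur) e ≤ Γ.m ∧ Γ.Inc σ.cur (lastBelow (Γ.Inc σ.cur) e - 1) := by
  obtain ⟨hq, hcur, hpm, hinc⟩ := h.cur_spec (by omega)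
  have : lastBelow (Γ.Inc σ.cur) e ≤ e := lastBelow_le
  exact ⟨hq, hcur, by omega, lastBelow_spec hne⟩

theorem skip (h : SearchInv Γ root E O σ) (hgo : σ.go ≠ 0) {e y : ℕ} (hp : σ.ptr = e + 1)
    (hy : Γ.Link e σ.cur y) (hpy : σ.par y ≠ 0) :
    SearchInv Γ root E O { σ with ptr := lastBelow (Γ.Inc σ.cur) e } ∧
    searchMeasure Γ { σ with ptr := lastBelow (Γ.Inc σ.cur) e } < searchMeasure Γ σ := by
  refine ⟨{ h with
    done := fun hf => h.link_marked hp hy (fun _ => id) hpy hf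
    cur_spec := h.cur_lastBelow hp
    halted := fun hc => absurd hc hgo }, ?_⟩
  have := h.measure_link hp
  simp only [searchMeasure]
  omega

theorem adj_cur (h : SearchInv Γ root E O σ) {e y : ℕ} (hp : σ.ptr = e + 1)
    (hy : Γ.Link e σ.cur y) : Γ.Adj σ.cur y := by
  obtain ⟨-, -, hpm, hinc⟩ := h.cur_spec (by omega)
  rw [hp, Nat.add_sub_cancel] at hinc
  exact ⟨e, by omega, hinc.1, hy⟩

theorem mark (h : SearchInv Γ root E O σ)
    (hO : ∀ u y, E u → Γ.Adj u y → O y) {e y : ℕ} (hp : σ.ptr = e + 1)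
    (hy : Γ.Link e σ.cur y) (hpy : σ.par y = 0) (hm : Γ.mate y = 0) :
    SearchInv Γ root E O { σ with
      par := Function.update σ.par y (σ.cur + 1)
      ptr := lastBelow (Γ.Inc σ.cur) e
      found := y + 1
      go := 0 } ∧
    searchMeasure Γ { σ with
      par := Function.update σ.par y (σ.cur + 1)
      ptr := lastBelow (Γ.Inc σ.cur) e
      found := y + 1
      go := 0 } < searchMeasure Γ σ := by
  obtain ⟨hq, hcur, -, -⟩ := h.cur_spec (by omega)
  have hadj := h.adj_cur hp hy
  have hlt : σ.qh - 1 < σ.qt := by have := h.qh_le; omega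
  have hmono : ∀ v, σ.par v ≠ 0 → Function.update σ.par y (σ.cur + 1) v = σ.par v := fun v hv =>
    Function.update_of_ne (by rintro rfl; exact hv hpy) _ _
  refine ⟨{ h with
    queue_mate := fun k hk => (h.queue_mate k hk).imp id fun ⟨y', h1, h2, h3⟩ =>
      ⟨y', h1, h2, ne_of_eq_of_ne (hmono y' h3) h3⟩
    par_odd := fun v hv hpv => ?_
    queue_path := fun k hk => ?_
    par_ev := fun hc => absurd hc (Nat.succ_ne_zero y)
    found_spec := fun _ => ⟨rfl, ?_⟩
    done := fun hc => absurd hc (Nat.succ_ne_zero y)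
    cur_spec := h.cur_lastBelow hp
    halted := fun _ hc => absurd hc (Nat.succ_ne_zero y) }, ?_⟩
  · by_cases hvy : v = y
    · subst hvy
      exact hO _ _ (hcur ▸ h.queue_even _ hlt) hadj
    · simp only [Function.update_of_ne hvy] at hpv
      exact h.par_odd v hv hpv
  · obtain ⟨l, p, h1, h2, h3, h4⟩ := h.queue_path k hk
    exact ⟨l, p, h1, h2, h3.mono hmono, h4⟩
  · obtain ⟨l, p, h1, h2, h3, h4⟩ := h.queue_path _ hlt
    rw [← hcur] at h2
    have := h3.extend_par h1 hpy (h2 ▸ hadj)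
    rw [h2] at this
    refine ⟨l + 1, _, Even.add_one h1, ?_, ?_, this⟩
    · simp
    · simpa using hm
  · have := h.measure_link hp
    simp only [searchMeasure]
    omega

theorem push (h : SearchInv Γ root E O σ) (hgo : σ.go ≠ 0)
    (hroot : ∀ v, root v → Γ.mate v = 0) (hO : ∀ u y, E u → Γ.Adj u y → O y)
    (hE : ∀ y z, y < Γ.n → O y → Γ.mate y = z + 1 → E z) {e y z : ℕ} (hp : σ.ptr = e + 1)
    (hy : Γ.Link e σ.cur y) (hpy : σ.par y = 0) (hm : Γ.mate y = z + 1) :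
    SearchInv Γ root E O { σ with
      par := Function.update σ.par y (σ.cur + 1)
      ev := Function.update σ.ev z 1
      queue := Function.update σ.queue σ.qt z
      qt := σ.qt + 1
      ptr := lastBelow (Γ.Inc σ.cur) e } ∧
    searchMeasure Γ { σ with
      par := Function.update σ.par y (σ.cur + 1)
      ev := Function.update σ.ev z 1
      queue := Function.update σ.queue σ.qt z
      qt := σ.qt + 1
      ptr := lastBelow (Γ.Inc σ.cur) e } < searchMeasure Γ σ := by
  obtain ⟨hq, hcur, -, -⟩ := h.cur_spec (by omega)
  have hadj := h.adj_cur hp hy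
  have hqt := h.qh_le
  have hlt : σ.qh - 1 < σ.qt := by omega
  have hf := h.found_eq_zero hgo
  obtain ⟨hzn, hmz, -⟩ := Γ.mate_spec y hadj.lt z hm
  have hOy : O y := hO _ _ (hcur ▸ h.queue_even _ hlt) hadj
  have hmono : ∀ v, σ.par v ≠ 0 → Function.update σ.par y (σ.cur + 1) v = σ.par v := fun v hv =>
    Function.update_of_ne (by rintro rfl; exact hv hpy) _ _
  have hmono' : ∀ v, σ.par v ≠ 0 → Function.update σ.par y (σ.cur + 1) v ≠ 0 := fun v hv => by
    rwa [hmono v hv]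
  have hpar : Function.update σ.par y (σ.cur + 1) y ≠ 0 := by simp
  have hqueue : ∀ k < σ.qt, Function.update σ.queue σ.qt z k = σ.queue k := fun k hk =>
    Function.update_of_ne (by omega) _ _
  have hqlast : Function.update σ.queue σ.qt z σ.qt = z := Function.update_self ..
  have hev : ∀ v, σ.ev v ≠ 0 → Function.update σ.ev z 1 v ≠ 0 := fun v hv => by
    rw [Function.update_apply]
    split_ifs
    · exact one_ne_zero
    · exact hv
  -- a queued vertex is a root, hence unmatched, or has a marked partner
  have hnew : ∀ k < σ.qt, σ.queue k ≠ z := by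
    rintro k hk rfl
    rcases h.queue_mate k hk with hr | ⟨y', hy', hm', hp'⟩
    · rw [hroot _ hr] at hmz
      omega
    · have := (Γ.mate_spec y' hy' _ hm').2.1
      obtain rfl : y' = y := by omega
      exact hp' hpy
  have hevz : σ.ev z = 0 := by
    by_contra hc
    obtain ⟨k, hk, hkz⟩ := (h.ev_iff z hzn).1 hc
    exact hnew k hk hkz
  have split : ∀ {k : ℕ}, k < σ.qt + 1 → k < σ.qt ∨ k = σ.qt := fun hk => by omega
  refine ⟨{
    qh_le := by show σ.qh ≤ σ.qt + 1; omega
    queue_lt := fun k hk => ?_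
    queue_inj := fun j hj k hk hjk => ?_
    ev_iff := fun v hv => ?_
    root_ev := fun v hv => ⟨(h.root_ev v hv).1, hev v (h.root_ev v hv).2⟩
    queue_mate := fun k hk => ?_
    par_odd := fun v hv hpv => ?_
    queue_even := fun k hk => ?_
    queue_path := fun k hk => ?_
    par_ev := fun _ v hv hpv => ?_
    found_spec := fun hc => absurd hf hc
    done := ?_
    cur_spec := ?_
    halted := fun hc => absurd hc hgo }, ?_⟩
  · rcases split hk with hk | rfl
    · simp only [hqueue k hk]
      exact h.queue_lt k hk
    · simpa only [hqlast] using hzn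
  · rcases split hj with hj | rfl <;> rcases split hk with hk | rfl
    · simp only [hqueue j hj, hqueue k hk] at hjk
      exact h.queue_inj j hj k hk hjk
    · simp only [hqueue j hj, hqlast] at hjk
      exact absurd hjk (hnew j hj)
    · simp only [hqueue k hk, hqlast] at hjk
      exact absurd hjk.symm (hnew k hk)
    · rfl
  · constructor
    · intro hne
      by_cases hvz : v = z
      · exact ⟨σ.qt, Nat.lt_succ_self _, by simp [hvz]⟩
      · simp only [Function.update_of_ne hvz] at hne
        obtain ⟨k, hk, hkv⟩ := (h.ev_iff v hv).1 hne
        exact ⟨k, Nat.lt_succ_of_lt hk, by simpa only [hqueue k hk] using hkv⟩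
    · rintro ⟨k, hk, hkv⟩
      rcases split hk with hk | rfl
      · simp only [hqueue k hk] at hkv
        exact hev v ((h.ev_iff v hv).2 ⟨k, hk, hkv⟩)
      · simp only [hqlast] at hkv
        simp [← hkv]
  · rcases split hk with hk | rfl
    · simp only [hqueue k hk]
      exact (h.queue_mate k hk).imp id fun ⟨y', h1, h2, h3⟩ => ⟨y', h1, h2, hmono' y' h3⟩
    · simp only [hqlast]
      exact Or.inr ⟨y, hadj.lt, hm, hpar⟩
  · by_cases hvy : v = y
    · exact hvy ▸ hOy
    · simp only [Function.update_of_ne hvy] at hpv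
      exact h.par_odd v hv hpv
  · rcases split hk with hk | rfl
    · simp only [hqueue k hk]
      exact h.queue_even k hk
    · simp only [hqlast]
      exact hE y z hadj.lt hOy hm
  · rcases split hk with hk | rfl
    · obtain ⟨l, p, h1, h2, h3, h4⟩ := h.queue_path k hk
      exact ⟨l, p, h1, by simpa only [hqueue k hk] using h2, h3.mono hmono,
        fun t ht hte => hev _ (h4 t ht hte)⟩
    · obtain ⟨l, p, h1, h2, h3, h4⟩ := h.queue_path _ hlt
      rw [← hcur] at h2
      have h5 := h3.extend_par h1 hpy (h2 ▸ hadj)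
      rw [h2] at h5
      have h1' : Odd (l + 1) := Even.add_one h1
      have h6 := h5.extend_mate (z := z) (ev := σ.ev) h1' ?_ hevz (by simpa using hm)
      · refine ⟨l + 1 + 1, _, Odd.add_one h1', by simp, h6, ?_⟩
        intro t ht hte
        rcases Nat.eq_or_lt_of_le ht with rfl | ht
        · simp
        · have htl : t ≤ l := by
            rcases Nat.eq_or_lt_of_le (Nat.lt_succ_iff.1 ht) with rfl | ht
            · exact absurd hte (Nat.not_even_iff_odd.2 h1')
            · omega
          rw [Function.update_of_ne (by omega), Function.update_of_ne (by omega)]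
          exact hev _ (h4 t htl hte)
      · intro t ht hte
        have htl : t ≤ l := by
          rcases Nat.eq_or_lt_of_le ht with rfl | ht
          · exact absurd hte (Nat.not_even_iff_odd.2 h1')
          · omega
        rw [Function.update_of_ne (by omega)]
        exact h4 t htl hte
  · by_cases hvy : v = y
    · exact ⟨z, hzn, hvy ▸ hm, by simp⟩
    · simp only [Function.update_of_ne hvy] at hpv
      obtain ⟨w, h1, h2, h3⟩ := h.par_ev hf v hv hpv
      exact ⟨w, h1, h2, hev w h3⟩
  · intro _ k hk f hf' hact hpf w hw
    have hk' : k < σ.qh := hk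
    simp only [hqueue k (by omega)] at hw
    exact h.link_marked hp hy hmono' hpar hf k hk f hf' hact hpf w hw
  · intro hne
    obtain ⟨h1, h2, h3⟩ := h.cur_lastBelow hp hne
    exact ⟨h1, by simpa only [hqueue _ hlt] using h2, h3⟩
  · have hrest : ∀ v, (∀ k < σ.qh, Function.update σ.queue σ.qt z k ≠ v) ↔
        ∀ k < σ.qh, σ.queue k ≠ v := fun v =>
      forall₂_congr fun k hk => by rw [hqueue k (by omega)]
    have := h.measure_link hp
    simp only [searchMeasure, hrest]
    omega

end SearchInv

/-! ### The search program -/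

/-- One step of the search. The registers 6, 7, 8, 9, 10, 14 hold the variables `qh`, `qt`, `ptr`,
`cur`, `found`, `go`, and the arrays 11, 12, 13 hold `par`, `ev`, `queue`. The graph is given by the
heads of the adjacency lists in array 7 and the links for the two end-points of each edge in the
arrays 8 and 9, and array 10 holds the partners. Register 12 is auxiliary. -/
def searchBody : Prog :=
  .ite (.eq (.reg 8) (.lit 0))
    (.ite (.lt (.reg 6) (.reg 7))
      (.seq (.setReg 9 (.cell 13 (.reg 6)))
        (.seq (.setReg 8 (.cell 7 (.reg 9))) (.setReg 6 (.succ (.reg 6)))))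
      (.setReg 14 (.lit 0)))
    (.seq
      (.ite (.eq (.cell 0 (.pred (.reg 8))) (.reg 9))
        (.seq (.setReg 12 (.cell 1 (.pred (.reg 8)))) (.setReg 8 (.cell 8 (.pred (.reg 8)))))
        (.seq (.setReg 12 (.cell 0 (.pred (.reg 8)))) (.setReg 8 (.cell 9 (.pred (.reg 8))))))
      (.ite (.eq (.cell 11 (.reg 12)) (.lit 0))
        (.seq (.setCell 11 (.reg 12) (.succ (.reg 9)))
          (.ite (.eq (.cell 10 (.reg 12)) (.lit 0))
            (.seq (.setReg 10 (.succ (.reg 12))) (.setReg 14 (.lit 0)))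
            (.seq (.setCell 13 (.reg 7) (.pred (.cell 10 (.reg 12))))
              (.seq (.setCell 12 (.pred (.cell 10 (.reg 12))) (.lit 1))
                (.setReg 7 (.succ (.reg 7)))))))
        .skip))

/-- The search, from a memory in which the queue has been filled with the roots. -/
def searchLoop : Prog := .loop (.lt (.lit 0) (.reg 14)) searchBody

/-- The variables of the search in the memory. -/
def Store.search (s : Store) : SearchState :=
  ⟨s.cell 11, s.cell 12, s.cell 13, s.reg 6, s.reg 7, s.reg 8, s.reg 9, s.reg 10, s.reg 14⟩

/-- The memory holds the graph with its adjacency lists and the matching. -/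
structure Store.HoldsGraph (s : Store) (Γ : NumberedGraph) : Prop where
  ap : ∀ e < Γ.m, s.cell 0 e = Γ.ap e
  po : ∀ e < Γ.m, s.cell 1 e = Γ.po e
  mate : ∀ v < Γ.n, s.cell 10 v = Γ.mate v
  head : ∀ v < Γ.n, s.cell 7 v = lastBelow (Γ.Inc v) Γ.m
  linkA : ∀ e < Γ.m, Γ.active e → s.cell 8 e = lastBelow (Γ.Inc (Γ.ap e)) e
  linkP : ∀ e < Γ.m, Γ.active e → s.cell 9 e = lastBelow (Γ.Inc (Γ.po e)) e

theorem Store.cell_setCell_eq (s : Store) (a i n b : ℕ) :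
    (s.setCell a i n).cell b = if b = a then Function.update (s.cell a) i n else s.cell b := by
  by_cases hb : b = a
  · subst hb
    simp [Store.setCell]
  · simp [Store.setCell, hb]

theorem searchBody_spec {Γ : NumberedGraph} {root E O : ℕ → Prop} {s : Store}
    (hΓ : s.HoldsGraph Γ) (h : SearchInv Γ root E O s.search) (hgo : s.reg 14 ≠ 0)
    (hroot : ∀ v, root v → Γ.mate v = 0) (hO : ∀ u y, E u → Γ.Adj u y → O y)
    (hE : ∀ y z, y < Γ.n → O y → Γ.mate y = z + 1 → E z) :
    SearchInv Γ root E O (searchBody.run s).search ∧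
      searchMeasure Γ (searchBody.run s).search < searchMeasure Γ s.search := by
  by_cases hp : s.reg 8 = 0
  · by_cases hq : s.reg 6 < s.reg 7
    · have hlt : s.cell 13 (s.reg 6) < Γ.n := h.queue_lt _ hq
      have := h.pop hgo hp hq
      have heq : (searchBody.run s).search = { s.search with
          cur := s.search.queue s.search.qh
          ptr := lastBelow (Γ.Inc (s.search.queue s.search.qh)) Γ.m
          qh := s.search.qh + 1 } := by
        simp [searchBody, Prog.run, Test.holds, Expr.eval, hp, hq, Store.search, Store.reg_setReg,
          Store.cell_setReg, hΓ.head _ hlt]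
      rwa [heq]
    · have := h.halt hgo hp hq
      have heq : (searchBody.run s).search = { s.search with go := 0 } := by
        simp [searchBody, Prog.run, Test.holds, Expr.eval, hp, hq, Store.search, Store.reg_setReg,
          Store.cell_setReg]
      rwa [heq]
  · obtain ⟨e, he⟩ : ∃ e, s.reg 8 = e + 1 := ⟨s.reg 8 - 1, by omega⟩
    obtain ⟨-, -, hpm, hinc⟩ := h.cur_spec hp
    have hem : e < Γ.m := by
      change s.reg 8 ≤ Γ.m at hpm
      omega
    change Γ.Inc (s.reg 9) (s.reg 8 - 1) at hinc
    rw [he, Nat.add_sub_cancel] at hinc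
    -- the other end-point of the edge, and the next edge of the list
    obtain ⟨y, hy, hrun⟩ : ∃ y, Γ.Link e (s.reg 9) y ∧
        (Prog.ite (.eq (.cell 0 (.pred (.reg 8))) (.reg 9))
        (.seq (.setReg 12 (.cell 1 (.pred (.reg 8)))) (.setReg 8 (.cell 8 (.pred (.reg 8)))))
        (.seq (.setReg 12 (.cell 0 (.pred (.reg 8)))) (.setReg 8 (.cell 9 (.pred (.reg 8)))))).run s
        = (s.setReg 12 y).setReg 8 (lastBelow (Γ.Inc (s.reg 9)) e) := by
      by_cases ha : Γ.ap e = s.reg 9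
      · refine ⟨Γ.po e, Or.inl ⟨ha, rfl⟩, ?_⟩
        have := hΓ.linkA e hem hinc.1
        simp [Prog.run, Test.holds, Expr.eval, he, hΓ.ap e hem, hΓ.po e hem, ha, Store.reg_setReg,
          Store.cell_setReg, this]
      · have hpo := hinc.2.resolve_left ha
        refine ⟨Γ.ap e, Or.inr ⟨hpo, rfl⟩, ?_⟩
        have := hΓ.linkP e hem hinc.1
        simp [Prog.run, Test.holds, Expr.eval, he, hΓ.ap e hem, ha, hpo, Store.reg_setReg,
          Store.cell_setReg, this]
    have hyn : y < Γ.n := (h.adj_cur he hy).lt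
    have hmy := hΓ.mate y hyn
    rw [searchBody, Prog.run, if_neg (by simpa [Test.holds, Expr.eval] using hp), Prog.run, hrun]
    by_cases hpy : s.cell 11 y = 0
    · rcases hm : Γ.mate y with _ | z
      · have := h.mark hO he hy hpy hm
        rw [hm] at hmy
        refine Eq.mp (congrArg₂ (fun a b => SearchInv Γ root E O a ∧ searchMeasure Γ b < _)
          ?_ ?_) this <;>
        simp [Prog.run, Test.holds, Expr.eval, Store.search, Store.reg_setReg, Store.cell_setReg,
          Store.cell_setCell_eq, Store.reg_setCell, hpy, hmy]
      · have := h.push hgo hroot hO hE he hy hpy hm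
        rw [hm] at hmy
        refine Eq.mp (congrArg₂ (fun a b => SearchInv Γ root E O a ∧ searchMeasure Γ b < _)
          ?_ ?_) this <;>
        simp [Prog.run, Test.holds, Expr.eval, Store.search, Store.reg_setReg, Store.cell_setReg,
          Store.cell_setCell_eq, Store.reg_setCell, hpy, hmy]
    · have := h.skip hgo he hy hpy
      refine Eq.mp (congrArg₂ (fun a b => SearchInv Γ root E O a ∧ searchMeasure Γ b < _)
        ?_ ?_) this <;>
      simp [Prog.run, Test.holds, Expr.eval, Store.search, Store.reg_setReg, Store.cell_setReg, hpy]

theorem Store.HoldsGraph.congr {s s' : Store} {Γ : NumberedGraph} (h : s.HoldsGraph Γ)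
    {R B : List ℕ} (hs : s.AgreesOff R B s') (hB : ∀ a ∈ [0, 1, 7, 8, 9, 10], a ∉ B) :
    s'.HoldsGraph Γ := by
  have e := fun a ha => hs.2 a (hB a ha)
  refine ⟨?_, ?_, ?_, ?_, ?_, ?_⟩
  · rw [e 0 (by simp)]; exact h.ap
  · rw [e 1 (by simp)]; exact h.po
  · rw [e 10 (by simp)]; exact h.mate
  · rw [e 7 (by simp)]; exact h.head
  · rw [e 8 (by simp)]; exact h.linkA
  · rw [e 9 (by simp)]; exact h.linkP

theorem sum_count_inc_le (Γ : NumberedGraph) : open Classical in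
    ∑ v ∈ Finset.range Γ.n, Nat.count (Γ.Inc v) Γ.m ≤ 2 * Γ.m := by
  classical
  have h1 : ∀ v, Nat.count (Γ.Inc v) Γ.m = ∑ e ∈ Finset.range Γ.m, if Γ.Inc v e then 1 else 0 := by
    intro v
    rw [Nat.count_eq_card_filter_range, Finset.card_filter]
  simp only [h1]
  rw [Finset.sum_comm]
  calc ∑ e ∈ Finset.range Γ.m, ∑ v ∈ Finset.range Γ.n, (if Γ.Inc v e then 1 else 0)
      ≤ ∑ e ∈ Finset.range Γ.m, 2 := by
        refine Finset.sum_le_sum fun e _ => ?_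
        rw [← Finset.card_filter]
        refine (Finset.card_le_card (t := {Γ.ap e, Γ.po e}) fun v hv => ?_).trans
          Finset.card_le_two
        rw [Finset.mem_filter] at hv
        rcases hv.2.2 with h | h <;> simp [h]
    _ = 2 * Γ.m := by simp [mul_comm]

theorem searchMeasure_le (Γ : NumberedGraph) {σ : SearchState} (hp : σ.ptr = 0) :
    searchMeasure Γ σ ≤ Γ.n + 2 * Γ.m + 1 := by
  classical
  simp only [searchMeasure, hp, Nat.count_zero]
  have h1 := Finset.sum_le_sum_of_subset (f := fun v => 1 + Nat.count (Γ.Inc v) Γ.m)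
    (Finset.filter_subset (fun v => ∀ k < σ.qh, σ.queue k ≠ v) (Finset.range Γ.n))
  rw [Finset.sum_add_distrib (s := Finset.range Γ.n), Finset.sum_const, Finset.card_range,
    smul_eq_mul, mul_one] at h1
  have h2 := sum_count_inc_le Γ
  omega

/-- The search: it either finds an augmenting path from a root, or marks exactly the vertices that
can be reached along alternating paths from the roots. -/
theorem searchLoop_spec {Γ : NumberedGraph} {root E O : ℕ → Prop} {s : Store}
    (hΓ : s.HoldsGraph Γ) (h : SearchInv Γ root E O s.search) (hptr : s.reg 8 = 0)
    (hroot : ∀ v, root v → Γ.mate v = 0) (hO : ∀ u y, E u → Γ.Adj u y → O y)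
    (hE : ∀ y z, y < Γ.n → O y → Γ.mate y = z + 1 → E z) :
    Reaches searchLoop s (100 * (Γ.n + 2 * Γ.m + 2)) (fun s' =>
      SearchInv Γ root E O s'.search ∧ s'.reg 14 = 0 ∧
        s.AgreesOff searchBody.regs searchBody.arrays s') := by
  have hlf : searchBody.LoopFree := by simp [searchBody, Prog.LoopFree]
  have hloop := Reaches.loop (c := .lt (.lit 0) (.reg 14)) (p := searchBody) (s := s)
    (K := searchBody.maxTime)
    (fun s' => SearchInv Γ root E O s'.search ∧ s.AgreesOff searchBody.regs searchBody.arrays s')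
    (fun s' => searchMeasure Γ s'.search) ?_ ⟨h, .refl _ _ _⟩
  · refine hloop.mono ?_ ?_
    · have h1 : searchMeasure Γ s.search ≤ Γ.n + 2 * Γ.m + 1 := searchMeasure_le Γ hptr
      have h2 : searchBody.maxTime + (Test.lt (.lit 0) (.reg 14)).cost ≤ 100 := by
        simp [searchBody, Prog.maxTime, Test.cost, Expr.cost]
      have h3 := Nat.mul_le_mul h2 h1
      simp only [Test.cost, Expr.cost] at h3 ⊢
      omega
    · rintro s' ⟨⟨h1, h2⟩, h3⟩
      exact ⟨h1, by simpa [Test.holds, Expr.eval] using h3, h2⟩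
  · rintro s' ⟨h1, h2⟩ h3
    have hgo : s'.reg 14 ≠ 0 := by
      simp only [Test.holds, Expr.eval] at h3
      omega
    have h4 := searchBody_spec (hΓ.congr h2 (by simp [searchBody, Prog.arrays])) h1 hgo hroot hO hE
    obtain ⟨t, ht, hex⟩ := Prog.exec_run hlf s'
    exact ⟨_, t, hex, ht, ⟨h4.1, h2.trans hex.agreesOff⟩, h4.2⟩

/-! ### Matchings and alternating paths on numbered vertices -/

section Numbering

variable {A : Type u} {P : Type v} {G : RankInstance A P} (ν : CellNumbering G)

/-- The array `mate` holds the matching `N`: the successor of the number of its partner for each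
matched vertex, and `0` for each unmatched vertex. -/
structure MateArray (mate : ℕ → ℕ) (N : Set (A × P)) : Prop where
  matched : ∀ e ∈ N, ∀ x y, Joins e x y → mate (ν.vertex x) = ν.vertex y + 1
  unmatched : ∀ x ∈ G.vertices, ¬ Matched N x → mate (ν.vertex x) = 0

variable {ν}

namespace CellNumbering

theorem vertex_lt {x : A ⊕ P} (hx : x ∈ G.vertices) : ν.vertex x < G.numVertices :=
  ν.vertex_bijOn.1 hx

theorem edge_lt {e : A × P} (he : e ∈ G.edges) : ν.edge e < G.numEdges := ν.edge_bijOn.1 he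

theorem vertex_inj {x y : A ⊕ P} (hx : x ∈ G.vertices) (hy : y ∈ G.vertices)
    (h : ν.vertex x = ν.vertex y) : x = y := ν.vertex_bijOn.2.1 hx hy h

theorem edge_inj {e f : A × P} (he : e ∈ G.edges) (hf : f ∈ G.edges)
    (h : ν.edge e = ν.edge f) : e = f := ν.edge_bijOn.2.1 he hf h

theorem exists_vertex {k : ℕ} (hk : k < G.numVertices) : ∃ x ∈ G.vertices, ν.vertex x = k :=
  ν.vertex_bijOn.2.2 hk

theorem exists_edge {k : ℕ} (hk : k < G.numEdges) : ∃ e ∈ G.edges, ν.edge e = k :=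
  ν.edge_bijOn.2.2 hk

end CellNumbering

theorem RankInstance.joins_mem_vertices {e : A × P} (he : e ∈ G.edges) {x y : A ⊕ P}
    (hj : Joins e x y) : x ∈ G.vertices ∧ y ∈ G.vertices :=
  ⟨incident_mem_vertices he hj.incident_left, incident_mem_vertices he hj.incident_right⟩

namespace MateArray

variable {mate : ℕ → ℕ} {N : Set (A × P)}

theorem eq_zero_iff (h : MateArray ν mate N) {x : A ⊕ P} (hx : x ∈ G.vertices) :
    mate (ν.vertex x) = 0 ↔ ¬ Matched N x := by
  refine ⟨?_, h.unmatched x hx⟩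
  rintro h0 ⟨e, he, hex⟩
  obtain ⟨y, hj⟩ := hex.exists_joins
  rw [h.matched e he x y hj] at h0
  omega

theorem eq_succ_iff (h : MateArray ν mate N) {x : A ⊕ P} (hx : x ∈ G.vertices)
    {w : ℕ} : mate (ν.vertex x) = w + 1 ↔ ∃ e ∈ N, ∃ y, Joins e x y ∧ ν.vertex y = w := by
  constructor
  · intro hw
    have hm : Matched N x := by
      by_contra hc
      rw [h.unmatched x hx hc] at hw
      omega
    obtain ⟨e, he, hex⟩ := hm
    obtain ⟨y, hj⟩ := hex.exists_joins
    rw [h.matched e he x y hj] at hw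
    exact ⟨e, he, y, hj, by omega⟩
  · rintro ⟨e, he, y, hj, rfl⟩
    exact h.matched e he x y hj

/-- The edges of the matching can be read off the array. -/
theorem mem_iff (h : MateArray ν mate N) (hN : N ⊆ G.edges) {e : A × P} (he : e ∈ G.edges) :
    e ∈ N ↔ mate (ν.vertex (Sum.inl e.1)) = ν.vertex (Sum.inr e.2) + 1 := by
  have hV := RankInstance.joins_mem_vertices he (joins_mk e)
  rw [h.eq_succ_iff hV.1]
  constructor
  · exact fun heN => ⟨e, heN, _, joins_mk e, rfl⟩
  · rintro ⟨f, hf, y, hj, hy⟩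
    obtain rfl := ν.vertex_inj (RankInstance.joins_mem_vertices (hN hf) hj).2 hV.2 hy
    exact hj.edge_unique (joins_mk e) ▸ hf

theorem insert (h : MateArray ν mate N) (hN : N ⊆ G.edges) {e : A × P} (he : e ∈ G.edges)
    (hu : ∀ x, Incident e x → ¬ Matched N x) {x y : A ⊕ P} (hj : Joins e x y) :
    MateArray ν (Function.update (Function.update mate (ν.vertex x) (ν.vertex y + 1))
      (ν.vertex y) (ν.vertex x + 1)) (insert e N) := by
  have hV := RankInstance.joins_mem_vertices he hj
  have hxy : ν.vertex x ≠ ν.vertex y := fun hc => hj.ne (ν.vertex_inj hV.1 hV.2 hc)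
  have hother : ∀ z ∈ G.vertices, z ≠ x → z ≠ y → Function.update
      (Function.update mate (ν.vertex x) (ν.vertex y + 1)) (ν.vertex y) (ν.vertex x + 1)
      (ν.vertex z) = mate (ν.vertex z) := by
    intro z hz hzx hzy
    rw [Function.update_of_ne fun hc => hzy (ν.vertex_inj hz hV.2 hc),
      Function.update_of_ne fun hc => hzx (ν.vertex_inj hz hV.1 hc)]
  constructor
  · rintro f (rfl | hf) z w hzw
    · rcases hj.eq_or_eq hzw.incident_left with rfl | rfl
      · obtain rfl := hj.right_unique hzw
        rw [Function.update_of_ne hxy, Function.update_self]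
      · obtain rfl := hj.symm.right_unique hzw
        rw [Function.update_self]
    · rw [hother z (RankInstance.joins_mem_vertices (hN hf) hzw).1]
      · exact h.matched f hf z w hzw
      · rintro rfl
        exact hu z hj.incident_left (hzw.matched_left hf)
      · rintro rfl
        exact hu z hj.incident_right (hzw.matched_left hf)
  · intro z hz hzu
    have hze : ¬ Incident e z := fun hc => hzu ⟨e, Set.mem_insert _ _, hc⟩
    rw [hother z hz (by rintro rfl; exact hze hj.incident_left)
      (by rintro rfl; exact hze hj.incident_right)]
    exact h.unmatched z hz fun hc => hzu (hc.mono (Set.subset_insert _ _))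

end MateArray

open Classical in
/-- The graph with the edges `F` and the matching `N` on the numbers of the vertices. -/
noncomputable def CellNumbering.graph (ν : CellNumbering G) {ap po mate : ℕ → ℕ}
    {N : Set (A × P)} (F : Set (A × P))
    (hap : ∀ e ∈ G.edges, ap (ν.edge e) = ν.vertex (Sum.inl e.1))
    (hpo : ∀ e ∈ G.edges, po (ν.edge e) = ν.vertex (Sum.inr e.2))
    (hN : N ⊆ G.edges) (hm : MateArray ν mate N) : NumberedGraph where
  n := G.numVertices
  m := G.numEdges
  ap := ap
  po := po
  active k := ∃ e ∈ F, ν.edge e = k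
  mate := mate
  side k := decide (∃ a ∈ G.applicants, ν.vertex (Sum.inl a) = k)
  ap_lt k hk := by
    obtain ⟨e, he, rfl⟩ := ν.exists_edge hk
    rw [hap e he]
    exact ν.vertex_lt (RankInstance.joins_mem_vertices he (joins_mk e)).1
  po_lt k hk := by
    obtain ⟨e, he, rfl⟩ := ν.exists_edge hk
    rw [hpo e he]
    exact ν.vertex_lt (RankInstance.joins_mem_vertices he (joins_mk e)).2
  side_ne k hk := by
    obtain ⟨e, he, rfl⟩ := ν.exists_edge hk
    rw [hap e he, hpo e he]
    have h1 : ∃ a ∈ G.applicants, ν.vertex (Sum.inl a) = ν.vertex (Sum.inl e.1) :=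
      ⟨e.1, (G.edges_subset he).1, rfl⟩
    have h2 : ¬ ∃ a ∈ G.applicants, ν.vertex (Sum.inl a) = ν.vertex (Sum.inr e.2) := by
      rintro ⟨a, ha, h⟩
      have := ν.vertex_inj (Or.inl ⟨a, ha, rfl⟩)
        (RankInstance.joins_mem_vertices he (joins_mk e)).2 h
      cases this
    simp [h1, h2]
  mate_spec k hk w hw := by
    obtain ⟨x, hx, rfl⟩ := ν.exists_vertex hk
    obtain ⟨e, he, y, hj, rfl⟩ := (hm.eq_succ_iff hx).1 hw
    have hy := (RankInstance.joins_mem_vertices (hN he) hj).2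
    refine ⟨ν.vertex_lt hy, hm.matched e he y x hj.symm, ?_⟩
    have hside : ∀ z ∈ G.vertices, (∃ a ∈ G.applicants, ν.vertex (Sum.inl a) = ν.vertex z) ↔
        z.isLeft = true := by
      intro z hz
      constructor
      · rintro ⟨a, ha, h⟩
        rw [← ν.vertex_inj (Or.inl ⟨a, ha, rfl⟩) hz h]
        rfl
      · intro hl
        rcases hz with ⟨a, ha, rfl⟩ | ⟨p, _, rfl⟩
        · exact ⟨a, ha, rfl⟩
        · simp at hl
    have := hj.isLeft_eq
    rw [Ne, decide_eq_decide, hside x hx, hside y hy, this]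
    cases x.isLeft <;> simp

section Graph

variable {ap po mate : ℕ → ℕ} {N F : Set (A × P)}
  {hap : ∀ e ∈ G.edges, ap (ν.edge e) = ν.vertex (Sum.inl e.1)}
  {hpo : ∀ e ∈ G.edges, po (ν.edge e) = ν.vertex (Sum.inr e.2)}
  {hN : N ⊆ G.edges} {hm : MateArray ν mate N}

theorem CellNumbering.adj_iff (hF : F ⊆ G.edges) {k l : ℕ} :
    (ν.graph F hap hpo hN hm).Adj k l ↔
      ∃ e ∈ F, ∃ x y, Joins e x y ∧ ν.vertex x = k ∧ ν.vertex y = l := by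
  constructor
  · rintro ⟨f, _, ⟨e, he, rfl⟩, ⟨h1, h2⟩ | ⟨h1, h2⟩⟩
    · change ap (ν.edge e) = k at h1
      change po (ν.edge e) = l at h2
      rw [hap e (hF he)] at h1
      rw [hpo e (hF he)] at h2
      exact ⟨e, he, _, _, joins_mk e, h1, h2⟩
    · change po (ν.edge e) = k at h1
      change ap (ν.edge e) = l at h2
      rw [hpo e (hF he)] at h1
      rw [hap e (hF he)] at h2
      exact ⟨e, he, _, _, (joins_mk e).symm, h1, h2⟩
  · rintro ⟨e, he, x, y, hj, rfl, rfl⟩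
    refine ⟨ν.edge e, ν.edge_lt (hF he), ⟨e, he, rfl⟩, ?_⟩
    rcases hj with ⟨rfl, rfl⟩ | ⟨rfl, rfl⟩
    · exact Or.inl ⟨hap e (hF he), hpo e (hF he)⟩
    · exact Or.inr ⟨hpo e (hF he), hap e (hF he)⟩

/-- A path traced by the search, translated back to the vertices of the instance. -/
theorem NumberedGraph.TracePath.exists_isAltPath [Nonempty (A ⊕ P)] (hF : F ⊆ G.edges)
    (hNF : IsMatching F N) {root : ℕ → Prop} {par : ℕ → ℕ} {l : ℕ} {p : ℕ → ℕ}
    (hroot : ∀ v, root v → mate v = 0)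
    (h : (ν.graph F hap hpo hN hm).TracePath root par l p) :
    ∃ q : ℕ → A ⊕ P, (∀ t ≤ l, q t ∈ G.vertices ∧ ν.vertex (q t) = p t) ∧ IsAltPath F N l q := by
  have hq : ∀ t, ∃ x, t ≤ l → x ∈ G.vertices ∧ ν.vertex x = p t := by
    intro t
    by_cases ht : t ≤ l
    · obtain ⟨x, hx⟩ := ν.exists_vertex (h.lt t ht)
      exact ⟨x, fun _ => hx⟩
    · exact ⟨Classical.arbitrary _, fun hc => absurd hc ht⟩
  choose q hq using hq
  refine ⟨q, hq, ?_, fun t ht => ?_⟩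
  · intro s hs t ht hst
    refine h.inj s hs t ht ?_
    rw [← (hq s hs).2, ← (hq t ht).2, hst]
  · have h1 := hq t ht.le
    have h2 := hq (t + 1) ht
    rcases Nat.even_or_odd t with hte | hto
    · obtain ⟨e, he, x, y, hj, hx, hy⟩ := (CellNumbering.adj_iff hF).1 (h.even_step t ht hte).2
      have hV := RankInstance.joins_mem_vertices (hF he) hj
      obtain rfl := ν.vertex_inj hV.1 h1.1 (hx.trans h1.2.symm)
      obtain rfl := ν.vertex_inj hV.2 h2.1 (hy.trans h2.2.symm)
      refine ⟨e, he, hj, fun heN => ?_, fun ho => absurd hte (Nat.not_even_iff_odd.2 ho)⟩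
      have hmt := hm.matched e heN _ _ hj
      rw [h1.2, h2.2] at hmt
      rcases t with _ | t
      · rw [hroot _ h.start] at hmt
        omega
      · have hto : Odd t := by
          rw [Nat.even_add_one] at hte
          simpa using hte
        have hstep := h.odd_step t (by omega) hto
        have hback := (NumberedGraph.mate_spec _ _ (h.lt t (by omega)) _ hstep).2.1
        change mate (p (t + 1)) = p t + 1 at hback
        have := h.inj t (by omega) (t + 1 + 1) ht (by omega)
        omega
    · have hstep := h.odd_step t ht hto
      change mate (p t) = p (t + 1) + 1 at hstep
      rw [← h1.2] at hstep
      obtain ⟨e, he, y, hj, hy⟩ := (hm.eq_succ_iff h1.1).1 hstep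
      have hV := RankInstance.joins_mem_vertices (hN he) hj
      obtain rfl := ν.vertex_inj hV.2 h2.1 (hy.trans h2.2.symm)
      exact ⟨e, hNF.1 he, hj, fun _ => hto, fun _ => he⟩

/-- When the search stops without having found an unmatched vertex, it has marked all vertices that
alternating paths from the roots lead to. -/
theorem SearchInv.marked_of_isAltPath (hF : F ⊆ G.edges) {root E O : ℕ → Prop} {σ : SearchState}
    (h : SearchInv (ν.graph F hap hpo hN hm) root E O σ) (hgo : σ.go = 0) (hf : σ.found = 0)
    {k : ℕ} {q : ℕ → A ⊕ P} (hq : IsAltPath F N k q) (h0 : root (ν.vertex (q 0))) {t : ℕ}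
    (ht : t ≤ k) : (Even t → σ.ev (ν.vertex (q t)) ≠ 0) ∧ (Odd t → σ.par (ν.vertex (q t)) ≠ 0) := by
  obtain ⟨hptr, hqt⟩ := h.halted hgo hf
  induction t with
  | zero => exact ⟨fun _ => (h.root_ev _ h0).2, fun hc => absurd hc (by simp)⟩
  | succ t ih =>
    have ih := ih (by omega)
    obtain ⟨e, he, hj, hiff⟩ := hq.2 t ht
    have hV := RankInstance.joins_mem_vertices (hF he) hj
    rw [Nat.even_add_one, Nat.odd_add_one, Nat.not_even_iff_odd, Nat.not_odd_iff_even]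
    constructor
    · intro hto
      obtain ⟨z, _, hz, hez⟩ := h.par_ev hf _ (ν.vertex_lt hV.1) (ih.2 hto)
      have := hm.matched e (hiff.2 hto) _ _ hj
      change mate (ν.vertex (q t)) = z + 1 at hz
      obtain rfl : z = ν.vertex (q (t + 1)) := by omega
      exact hez
    · intro hte
      obtain ⟨j, hjq, hj'⟩ := (h.ev_iff _ (ν.vertex_lt hV.1)).1 (ih.1 hte)
      obtain ⟨f, hf', hact, hlink⟩ := (CellNumbering.adj_iff (hap := hap) (hpo := hpo) (hN := hN)
        (hm := hm) hF).2 ⟨e, he, _, _, hj, rfl, rfl⟩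
      rw [← hj'] at hlink
      exact h.done hf j (hqt ▸ hjq) f hf' hact (fun _ => by omega) _ hlink

/-- Flipping the partners along an augmenting path. -/
theorem MateArray.symmDiff (hN : N ⊆ G.edges) (hm : MateArray ν mate N) (hF : F ⊆ G.edges)
    (hNF : IsMatching F N) {l : ℕ} {q : ℕ → A ⊕ P}
    (hl : Odd l) (hq : IsAltPath F N l q) (h0 : ¬ Matched N (q 0)) (h1 : ¬ Matched N (q l))
    {mate' : ℕ → ℕ} (hon : ∀ t < l, Even t → mate' (ν.vertex (q t)) = ν.vertex (q (t + 1)) + 1 ∧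
      mate' (ν.vertex (q (t + 1))) = ν.vertex (q t) + 1)
    (hoff : ∀ v, (∀ t ≤ l, ν.vertex (q t) ≠ v) → mate' v = mate v) :
    MateArray ν mate' (_root_.symmDiff N (pathEdges l q)) := by
  have hV : ∀ t ≤ l, q t ∈ G.vertices := by
    intro t ht
    rcases t with _ | t
    · obtain ⟨e, he, hj, _⟩ := hq.2 0 hl.pos
      exact (RankInstance.joins_mem_vertices (hF he) hj).1
    · obtain ⟨e, he, hj, _⟩ := hq.2 t ht
      exact (RankInstance.joins_mem_vertices (hF he) hj).2
  constructor
  · intro e he x y hj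
    rcases (mem_symmDiff_pathEdges hq).1 he with ⟨heN, hep⟩ | ⟨t, ht, hte, hjt⟩
    · have hx := (RankInstance.joins_mem_vertices (hN heN) hj).1
      rw [hoff, hm.matched e heN x y hj]
      intro t ht hc
      obtain rfl := ν.vertex_inj (hV t ht) hx hc
      exact hep (mem_pathEdges_of_incident hNF hl hq h0 h1 heN ht hj.incident_left)
    · rcases hjt.eq_or_eq hj.incident_left with rfl | rfl
      · obtain rfl := hjt.right_unique hj
        exact (hon t ht hte).1
      · obtain rfl := hjt.symm.right_unique hj
        exact (hon t ht hte).2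
  · intro x hx hxu
    rw [hoff, hm.unmatched x hx]
    · exact fun hc => hxu (((augment_path hNF hl hq h0 h1).2 x).2 (Or.inl hc))
    · intro t ht hc
      obtain rfl := ν.vertex_inj (hV t ht) hx hc
      rcases Nat.even_or_odd t with hte | ⟨s, rfl⟩
      · have htl : t < l := by
          rcases Nat.eq_or_lt_of_le ht with rfl | h
          · exact absurd hte (Nat.not_even_iff_odd.2 hl)
          · exact h
        obtain ⟨e, _, hj, _⟩ := hq.2 t htl
        exact hxu ⟨e, (mem_symmDiff_pathEdges hq).2 (Or.inr ⟨t, htl, hte, hj⟩), hj.incident_left⟩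
      · obtain ⟨e, _, hj, _⟩ := hq.2 (2 * s) (by omega)
        exact hxu ⟨e, (mem_symmDiff_pathEdges hq).2 (Or.inr ⟨2 * s, by omega, by simp, hj⟩),
          hj.incident_right⟩

end Graph

end Numbering

/-! ### Initialization, adjacency lists, and the matching at the beginning of a stage -/

/-- A loop whose round `k` changes only cells with index `k`, namely to the values `val a k`. -/
theorem Reaches.forEach {x N : ℕ} {body : Prog} {s : Store} (hb : body.LoopFree) (hxN : N ≠ x)
    (hx : x ∉ body.regs) (hN : N ∉ body.regs) (val : ℕ → ℕ → ℕ)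
    (step : ∀ k < s.reg N, ∀ s', s'.reg x = k → s.AgreesOff (x :: body.regs) body.arrays s' →
      (∀ a, s'.cell a k = s.cell a k) →
      ∀ a j, (body.run s').cell a j = if j = k then val a k else s'.cell a j) :
    Reaches (Prog.forLoop x N body) s ((body.maxTime + 6) * (s.reg N + 1))
      (fun s' => (∀ a j, s'.cell a j = if j < s.reg N then val a j else s.cell a j) ∧
        s.AgreesOff (x :: body.regs) body.arrays s') := by
  refine Reaches.forLoop hb hxN hx hN
    (fun k s' => ∀ a j, s'.cell a j = if j < k then val a j else s.cell a j) (fun a j => rfl) ?_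
  intro k s' hk hxk hs' h a j
  rw [Store.cell_setReg, step k hk s' hxk hs' (fun a => by rw [h, if_neg (lt_irrefl k)]) a j, h]
  rcases Nat.lt_trichotomy j k with hj | rfl | hj
  · rw [if_neg hj.ne, if_pos hj, if_pos (by omega)]
  · rw [if_pos rfl, if_pos (by omega)]
  · rw [if_neg hj.ne', if_neg (by omega), if_neg (by omega)]

section Programs

variable {A : Type u} {P : Type v} {G : RankInstance A P}

/-- The part of the input that the program does not change: the sizes, the number of stages, the
vertex to be deleted, and the graph with the ranks. -/
structure Store.HoldsInstance (s : Store) (ν : CellNumbering G) (r : ℕ) (d : A ⊕ P) : Prop where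
  numVertices : s.reg 0 = G.numVertices
  numEdges : s.reg 1 = G.numEdges
  stages : s.reg 2 = r
  deleted : s.reg 3 = ν.vertex d
  applicant : ∀ e ∈ G.edges, s.cell 0 (ν.edge e) = ν.vertex (Sum.inl e.1)
  post : ∀ e ∈ G.edges, s.cell 1 (ν.edge e) = ν.vertex (Sum.inr e.2)
  rank : ∀ e ∈ G.edges, s.cell 2 (ν.edge e) = G.rank e

variable {ν : CellNumbering G} {r : ℕ} {d : A ⊕ P} {s s' : Store}

theorem Store.HoldsInstance.congr (h : s.HoldsInstance ν r d) {R B : List ℕ}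
    (hs : s.AgreesOff R B s') (hR : ∀ x ∈ [0, 1, 2, 3], x ∉ R) (hB : ∀ a ∈ [0, 1, 2], a ∉ B) :
    s'.HoldsInstance ν r d := by
  have e := fun x hx => hs.1 x (hR x hx)
  have f := fun a ha => hs.2 a (hB a ha)
  refine ⟨?_, ?_, ?_, ?_, ?_, ?_, ?_⟩
  · rw [e 0 (by simp)]; exact h.numVertices
  · rw [e 1 (by simp)]; exact h.numEdges
  · rw [e 2 (by simp)]; exact h.stages
  · rw [e 3 (by simp)]; exact h.deleted
  · rw [f 0 (by simp)]; exact h.applicant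
  · rw [f 1 (by simp)]; exact h.post
  · rw [f 2 (by simp)]; exact h.rank

/-- The edges of the matching that is given with the input are marked in array 3. -/
def Store.HoldsMarks (s : Store) (ν : CellNumbering G) (M : Set (A × P)) : Prop :=
  ∀ e ∈ G.edges, s.cell 3 (ν.edge e) = 1 ↔ e ∈ M

/-- The edges incident to `d` are deleted at the beginning. -/
def initEdges : Prog :=
  .forLoop 5 1
    (.ite (.eq (.cell 0 (.reg 5)) (.reg 3)) (.setCell 4 (.reg 5) (.lit 1))
      (.ite (.eq (.cell 1 (.reg 5)) (.reg 3)) (.setCell 4 (.reg 5) (.lit 1))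
        (.setCell 4 (.reg 5) (.lit 0))))

/-- The vertices have no labels and no partners. -/
def initVertices : Prog :=
  .forLoop 5 0
    (.seq (.setCell 5 (.reg 5) (.lit 0))
      (.seq (.setCell 6 (.reg 5) (.lit 0)) (.setCell 10 (.reg 5) (.lit 0))))

open Classical in
theorem initEdges_spec (s : Store) :
    Reaches initEdges s (30 * (s.reg 1 + 1)) (fun s' =>
      (∀ k < s.reg 1, s'.cell 4 k = if s.cell 0 k = s.reg 3 ∨ s.cell 1 k = s.reg 3 then 1 else 0) ∧
        s.AgreesOff [5] [4] s') := by
  refine (Reaches.forEach (s := s) (by simp [Prog.LoopFree]) (by simp) (by simp [Prog.regs])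
    (by simp [Prog.regs]) (fun a k => if a = 4 then
      (if s.cell 0 k = s.reg 3 ∨ s.cell 1 k = s.reg 3 then 1 else 0) else s.cell a k) ?_).mono ?_ ?_
  · intro k hk s' hx hs' hc a j
    have h3 : s'.reg 3 = s.reg 3 := hs'.1 3 (by simp [Prog.regs])
    by_cases ha : a = 4 <;> by_cases hj : j = k <;>
    by_cases h0 : s.cell 0 k = s.reg 3 <;> by_cases h1 : s.cell 1 k = s.reg 3 <;>
    simp [Prog.run, Test.holds, Expr.eval, Store.cell_setCell, hx, hc, h3, ha, hj, h0, h1]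
  · refine Nat.mul_le_mul_right _ ?_
    simp [Prog.maxTime, Expr.cost, Test.cost]
  · rintro s' ⟨h1, h2⟩
    exact ⟨fun k hk => by rw [h1, if_pos hk, if_pos rfl],
      h2.mono (by simp [Prog.regs]) (by simp [Prog.arrays])⟩

theorem initVertices_spec (s : Store) :
    Reaches initVertices s (30 * (s.reg 0 + 1)) (fun s' =>
      (∀ k < s.reg 0, s'.cell 5 k = 0 ∧ s'.cell 10 k = 0) ∧ s.AgreesOff [5] [5, 6, 10] s') := by
  refine (Reaches.forEach (s := s) (by simp [Prog.LoopFree]) (by simp) (by simp [Prog.regs])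
    (by simp [Prog.regs]) (fun a k => if a = 5 ∨ a = 6 ∨ a = 10 then 0 else s.cell a k) ?_).mono
    ?_ ?_
  · intro k hk s' hx hs' hc a j
    by_cases ha : a = 5
    · by_cases hj : j = k <;>
      simp [Prog.run, Expr.eval, Store.cell_setCell, Store.reg_setCell, hx, ha, hj]
    by_cases ha' : a = 6
    · by_cases hj : j = k <;>
      simp [Prog.run, Expr.eval, Store.cell_setCell, Store.reg_setCell, hx, ha', hj]
    by_cases hj : j = k <;>
    simp [Prog.run, Expr.eval, Store.cell_setCell, Store.reg_setCell, hx, hc, ha, ha', hj]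
  · refine Nat.mul_le_mul_right _ ?_
    simp [Prog.maxTime, Expr.cost]
  · rintro s' ⟨h1, h2⟩
    exact ⟨fun k hk => by simp [h1, hk],
      h2.mono (by simp [Prog.regs]) (by simp [Prog.arrays])⟩

/-- Clears the heads of the adjacency lists. -/
def clearHeads : Prog := .forLoop 5 0 (.setCell 7 (.reg 5) (.lit 0))

theorem clearHeads_spec (s : Store) :
    Reaches clearHeads s (30 * (s.reg 0 + 1)) (fun s' =>
      (∀ k < s.reg 0, s'.cell 7 k = 0) ∧ s.AgreesOff [5] [7] s') := by
  refine (Reaches.forEach (s := s) (by simp [Prog.LoopFree]) (by simp) (by simp [Prog.regs])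
    (by simp [Prog.regs]) (fun a k => if a = 7 then 0 else s.cell a k) ?_).mono ?_ ?_
  · intro k hk s' hx hs' hc a j
    by_cases ha : a = 7 <;> by_cases hj : j = k <;>
    simp [Prog.run, Expr.eval, Store.cell_setCell, hx, hc, ha, hj]
  · refine Nat.mul_le_mul_right _ ?_
    simp [Prog.maxTime, Expr.cost]
  · rintro s' ⟨h1, h2⟩
    exact ⟨fun k hk => by simp [h1, hk],
      h2.mono (by simp [Prog.regs]) (by simp [Prog.arrays])⟩

/-- Clears the marks of the search. -/
def clearMarks : Prog :=
  .forLoop 5 0 (.seq (.setCell 11 (.reg 5) (.lit 0)) (.setCell 12 (.reg 5) (.lit 0)))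

theorem clearMarks_spec (s : Store) :
    Reaches clearMarks s (30 * (s.reg 0 + 1)) (fun s' =>
      (∀ k < s.reg 0, s'.cell 11 k = 0 ∧ s'.cell 12 k = 0) ∧ s.AgreesOff [5] [11, 12] s') := by
  refine (Reaches.forEach (s := s) (by simp [Prog.LoopFree]) (by simp) (by simp [Prog.regs])
    (by simp [Prog.regs]) (fun a k => if a = 11 ∨ a = 12 then 0 else s.cell a k) ?_).mono
    ?_ ?_
  · intro k hk s' hx hs' hc a j
    by_cases ha : a = 11
    · by_cases hj : j = k <;>
      simp [Prog.run, Expr.eval, Store.cell_setCell, Store.reg_setCell, hx, ha, hj]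
    by_cases hj : j = k <;>
    simp [Prog.run, Expr.eval, Store.cell_setCell, Store.reg_setCell, hx, hc, ha, hj]
  · refine Nat.mul_le_mul_right _ ?_
    simp [Prog.maxTime, Expr.cost]
  · rintro s' ⟨h1, h2⟩
    exact ⟨fun k hk => by simp [h1, hk],
      h2.mono (by simp [Prog.regs]) (by simp [Prog.arrays])⟩

/-- Builds the adjacency lists of the graph of the stage in register 4. -/
def buildLists : Prog :=
  .forLoop 5 1
    (.ite (.eq (.cell 4 (.reg 5)) (.lit 0))
      (.ite (.lt (.cell 2 (.reg 5)) (.succ (.reg 4)))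
        (.seq (.setCell 8 (.reg 5) (.cell 7 (.cell 0 (.reg 5))))
          (.seq (.setCell 7 (.cell 0 (.reg 5)) (.succ (.reg 5)))
            (.seq (.setCell 9 (.reg 5) (.cell 7 (.cell 1 (.reg 5))))
              (.setCell 7 (.cell 1 (.reg 5)) (.succ (.reg 5))))))
        .skip)
      .skip)

theorem buildLists_spec {n : ℕ} {ap po : ℕ → ℕ} {active : ℕ → Prop}
    (h7 : ∀ v < n, s.cell 7 v = 0) (hap : ∀ k < s.reg 1, s.cell 0 k = ap k)
    (hpo : ∀ k < s.reg 1, s.cell 1 k = po k) (hne : ∀ k < s.reg 1, ap k ≠ po k)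
    (hapn : ∀ k < s.reg 1, ap k < n) (hpon : ∀ k < s.reg 1, po k < n)
    (hact : ∀ k < s.reg 1, active k ↔ s.cell 4 k = 0 ∧ s.cell 2 k ≤ s.reg 4) :
    Reaches buildLists s (60 * (s.reg 1 + 1)) (fun s' =>
      ((∀ v < n, s'.cell 7 v = lastBelow (fun e => active e ∧ (ap e = v ∨ po e = v)) (s.reg 1)) ∧
      (∀ k < s.reg 1, active k →
        s'.cell 8 k = lastBelow (fun e => active e ∧ (ap e = ap k ∨ po e = ap k)) k ∧
        s'.cell 9 k = lastBelow (fun e => active e ∧ (ap e = po k ∨ po e = po k)) k)) ∧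
      s.AgreesOff [5] [7, 8, 9] s') := by
  refine (Reaches.forLoop (s := s) (by simp [Prog.LoopFree]) (by simp) (by simp [Prog.regs])
    (by simp [Prog.regs]) (fun b s' =>
      (∀ v < n, s'.cell 7 v = lastBelow (fun e => active e ∧ (ap e = v ∨ po e = v)) b) ∧
      (∀ k < b, active k →
        s'.cell 8 k = lastBelow (fun e => active e ∧ (ap e = ap k ∨ po e = ap k)) k ∧
        s'.cell 9 k = lastBelow (fun e => active e ∧ (ap e = po k ∨ po e = po k)) k))
    ?_ ?_).mono ?_ ?_
  · exact ⟨fun v hv => h7 v hv, fun k hk => absurd hk (Nat.not_lt_zero k)⟩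
  · rintro b s' hb hx hs' ⟨hl, hk⟩
    have e0 : s'.cell 0 b = ap b := by rw [hs'.2 0 (by simp [Prog.arrays]), hap b hb]
    have e1 : s'.cell 1 b = po b := by rw [hs'.2 1 (by simp [Prog.arrays]), hpo b hb]
    have e2 : s'.cell 2 = s.cell 2 := hs'.2 2 (by simp [Prog.arrays])
    have e4 : s'.cell 4 = s.cell 4 := hs'.2 4 (by simp [Prog.arrays])
    have r4 : s'.reg 4 = s.reg 4 := hs'.1 4 (by simp [Prog.regs])
    have hab := hne b hb
    by_cases ha : active b
    · obtain ⟨c1, c2⟩ := (hact b hb).1 ha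
      have hla := hl (ap b) (hapn b hb)
      have hlp := hl (po b) (hpon b hb)
      constructor
      · intro v hv
        have hlv := hl v hv
        rw [lastBelow]
        by_cases hva : ap b = v
        · subst hva
          simp [Prog.run, Test.holds, Expr.eval, Store.cell_setCell, Store.reg_setCell,
            Store.cell_setReg, hx, e0, e1, e2, e4, r4, c1, c2, ha]
        · by_cases hvp : po b = v
          · subst hvp
            simp [Prog.run, Test.holds, Expr.eval, Store.cell_setCell, Store.reg_setCell,
              Store.cell_setReg, hx, e0, e1, e2, e4, r4, c1, c2, ha]
          · simp [Prog.run, Test.holds, Expr.eval, Store.cell_setCell, Store.reg_setCell,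
              Store.cell_setReg, hx, e0, e1, e2, e4, r4, c1, c2, hva, hvp,
              Ne.symm hva, Ne.symm hvp, hlv]
      · intro k hkb hak
        rcases Nat.eq_or_lt_of_le (Nat.lt_succ_iff.1 hkb) with rfl | hkb
        · simp [Prog.run, Test.holds, Expr.eval, Store.cell_setCell, Store.reg_setCell,
            Store.cell_setReg, hx, e0, e1, e2, e4, r4, c1, c2, hla, hlp, hab.symm]
        · have := hk k hkb hak
          simp [Prog.run, Test.holds, Expr.eval, Store.cell_setCell, Store.reg_setCell,
            Store.cell_setReg, hx, e0, e1, e2, e4, r4, c1, c2, hkb.ne, this]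
    · have hskip : ((Prog.ite (.eq (.cell 4 (.reg 5)) (.lit 0))
          (.ite (.lt (.cell 2 (.reg 5)) (.succ (.reg 4)))
          (.seq (.setCell 8 (.reg 5) (.cell 7 (.cell 0 (.reg 5))))
          (.seq (.setCell 7 (.cell 0 (.reg 5)) (.succ (.reg 5)))
            (.seq (.setCell 9 (.reg 5) (.cell 7 (.cell 1 (.reg 5))))
              (.setCell 7 (.cell 1 (.reg 5)) (.succ (.reg 5))))))
          .skip) .skip).run s') = s' := by
        have := mt (hact b hb).2 ha
        by_cases c1 : s.cell 4 b = 0 <;> by_cases c2 : s.cell 2 b ≤ s.reg 4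
        · exact absurd ⟨c1, c2⟩ this
        all_goals simp [Prog.run, Test.holds, Expr.eval, hx, e2, e4, r4, c1, c2]
      rw [hskip, Store.cell_setReg]
      refine ⟨fun v hv => ?_, fun k hkb hak => hk k ?_ hak⟩
      · rw [lastBelow, if_neg fun hc => ha hc.1]
        exact hl v hv
      · rcases Nat.eq_or_lt_of_le (Nat.lt_succ_iff.1 hkb) with rfl | hkb
        · exact absurd hak ha
        · exact hkb
  · refine Nat.mul_le_mul_right _ ?_
    simp [Prog.maxTime, Expr.cost, Test.cost]
  · rintro s' ⟨h1, h2⟩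
    exact ⟨h1, h2.mono (by simp [Prog.regs]) (by simp [Prog.arrays])⟩

end Programs

/-! ### Taking over edges of the given matching -/

section Programs

variable {A : Type u} {P : Type v} {G : RankInstance A P} {ν : CellNumbering G} {r : ℕ}
  {d : A ⊕ P} {s s' : Store} {M L : Set (A × P)}

theorem Store.HoldsMarks.congr (h : s.HoldsMarks ν M) {R B : List ℕ} (hs : s.AgreesOff R B s')
    (hB : 3 ∉ B) : s'.HoldsMarks ν M := by
  rw [Store.HoldsMarks, hs.2 3 hB]
  exact h

/-- The test whether the edge in register 5 belongs to the given matching and has a rank of at most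
the stage. -/
theorem run_ite_marked {p : Prog} {e : A × P} (he : e ∈ G.edges) (h : s.HoldsInstance ν r d)
    (hM : s.HoldsMarks ν M) (h5 : s.reg 5 = ν.edge e) :
    (e ∈ upToRank G.rank M (s.reg 4) →
      (Prog.ite (.eq (.cell 3 (.reg 5)) (.lit 1))
        (.ite (.lt (.cell 2 (.reg 5)) (.succ (.reg 4))) p .skip) .skip).run s = p.run s) ∧
    (e ∉ upToRank G.rank M (s.reg 4) →
      (Prog.ite (.eq (.cell 3 (.reg 5)) (.lit 1))
        (.ite (.lt (.cell 2 (.reg 5)) (.succ (.reg 4))) p .skip) .skip).run s = s) := by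
  have h2 := h.rank e he
  constructor
  · rintro ⟨h3, h4⟩
    have := (hM e he).2 h3
    simp [Prog.run, Test.holds, Expr.eval, h5, this, h2, h4]
  · intro hn
    by_cases h3 : e ∈ M
    · have h4 : ¬ G.rank e ≤ s.reg 4 := fun h4 => hn ⟨h3, h4⟩
      have := (hM e he).2 h3
      simp [Prog.run, Test.holds, Expr.eval, h5, this, h2, h4]
    · have := mt (hM e he).1 h3
      simp [Prog.run, Test.holds, Expr.eval, h5, this]

/-- Matches the end-points of the edge in register 5 if they are free and different from `d`. -/
def carryEdge : Prog :=
  .ite (.eq (.cell 0 (.reg 5)) (.reg 3)) .skip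
    (.ite (.eq (.cell 1 (.reg 5)) (.reg 3)) .skip
      (.ite (.eq (.cell 10 (.cell 0 (.reg 5))) (.lit 0))
        (.ite (.eq (.cell 10 (.cell 1 (.reg 5))) (.lit 0))
          (.seq (.setCell 10 (.cell 0 (.reg 5)) (.succ (.cell 1 (.reg 5))))
            (.setCell 10 (.cell 1 (.reg 5)) (.succ (.cell 0 (.reg 5)))))
          .skip)
        .skip))

/-- Adds the edges of small rank of the given matching that are disjoint from the current one. -/
def carryEdges : Prog :=
  .forLoop 5 1
    (.ite (.eq (.cell 3 (.reg 5)) (.lit 1))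
      (.ite (.lt (.cell 2 (.reg 5)) (.succ (.reg 4)))
        carryEdge
        .skip)
      .skip)

theorem incident_iff_vertex {e : A × P} (he : e ∈ G.edges) (hd : d ∈ G.vertices) :
    Incident e d ↔ ν.vertex (Sum.inl e.1) = ν.vertex d ∨ ν.vertex (Sum.inr e.2) = ν.vertex d := by
  have hV := RankInstance.joins_mem_vertices he (joins_mk e)
  constructor
  · rintro (rfl | rfl)
    · exact Or.inl rfl
    · exact Or.inr rfl
  · rintro (h | h)
    · exact Or.inl (ν.vertex_inj hV.1 hd h).symm
    · exact Or.inr (ν.vertex_inj hV.2 hd h).symm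

theorem carryEdges_spec (h : s.HoldsInstance ν r d) (hd : d ∈ G.vertices) (hM : s.HoldsMarks ν M)
    (hMm : IsMatching G.edges M) (hL : L ⊆ G.edges) (hmate : MateArray ν (s.cell 10) L) :
    Reaches carryEdges s (60 * (s.reg 1 + 1)) (fun s' =>
      MateArray ν (s'.cell 10) (G.carry M d L (s.reg 4)) ∧ s.AgreesOff [5] [10] s') := by
  -- the edges with numbers below `b` that are to be added
  set D : ℕ → Set (A × P) := fun b => L ∪ {e ∈ upToRank G.rank M (s.reg 4) | (¬ Incident e d ∧
    ∀ x, Incident e x → ¬ Matched L x) ∧ ν.edge e < b} with hD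
  have hDE : ∀ b, D b ⊆ G.edges := by
    rintro b e (he | he)
    · exact hL he
    · exact hMm.1 he.1.1
  refine (Reaches.forLoop (s := s) (by simp [Prog.LoopFree, carryEdge]) (by simp)
    (by simp [Prog.regs, carryEdge])
    (by simp [Prog.regs, carryEdge]) (fun b s' => MateArray ν (s'.cell 10) (D b)) ?_ ?_).mono ?_ ?_
  · have : D 0 = L := by
      ext e
      simp [hD]
    rw [this]
    exact hmate
  · intro b s' hb hx hs' hm
    rw [h.numEdges] at hb
    obtain ⟨e, he, rfl⟩ := ν.exists_edge hb
    have h' := h.congr hs' (by simp [Prog.regs, carryEdge]) (by simp [Prog.arrays, carryEdge])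
    have hM' := hM.congr hs' (by simp [Prog.arrays, carryEdge])
    have r4 : s'.reg 4 = s.reg 4 := hs'.1 4 (by simp [Prog.regs, carryEdge])
    have hsucc : ∀ f, f ∈ D (ν.edge e + 1) ↔ f ∈ D (ν.edge e) ∨ (f = e ∧
        e ∈ upToRank G.rank M (s.reg 4) ∧ ¬ Incident e d ∧ ∀ x, Incident e x → ¬ Matched L x) := by
      intro f
      constructor
      · rintro (hf | ⟨h1, h2, h3⟩)
        · exact Or.inl (Or.inl hf)
        · rcases Nat.eq_or_lt_of_le (Nat.lt_succ_iff.1 h3) with h3 | h3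
          · obtain rfl := ν.edge_inj (hMm.1 h1.1) he h3
            exact Or.inr ⟨rfl, h1, h2⟩
          · exact Or.inl (Or.inr ⟨h1, h2, h3⟩)
      · rintro ((hf | ⟨h1, h2, h3⟩) | ⟨rfl, h1, h2⟩)
        · exact Or.inl hf
        · exact Or.inr ⟨h1, h2, by omega⟩
        · exact Or.inr ⟨h1, h2, by omega⟩
    rw [Store.cell_setReg]
    have hrun := run_ite_marked (p := carryEdge) he h' hM' hx
    rw [r4] at hrun
    by_cases hmem : e ∈ upToRank G.rank M (s.reg 4)
    · rw [hrun.1 hmem]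
      have e0 := h'.applicant e he
      have e1 := h'.post e he
      have r3 := h'.deleted
      have hV := RankInstance.joins_mem_vertices he (joins_mk e)
      have hinc := incident_iff_vertex (ν := ν) he hd
      have z0 := hm.eq_zero_iff hV.1
      have z1 := hm.eq_zero_iff hV.2
      by_cases hed : Incident e d
      · have : D (ν.edge e + 1) = D (ν.edge e) := by
          ext f
          rw [hsucc]
          exact ⟨fun hf => hf.elim id fun hf => absurd hed hf.2.2.1, Or.inl⟩
        rw [this]
        rcases hinc.1 hed with hc | hc
        · simpa [carryEdge, Prog.run, Test.holds, Expr.eval, hx, e0, r3, hc] using hm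
        · by_cases hc' : ν.vertex (Sum.inl e.1) = ν.vertex d
          · simpa [carryEdge, Prog.run, Test.holds, Expr.eval, hx, e0, r3, hc'] using hm
          · simpa [carryEdge, Prog.run, Test.holds, Expr.eval, hx, e0, e1, r3, hc, hc'] using hm
      · have hnd := mt hinc.2 hed
        rw [not_or] at hnd
        by_cases hfree : ∀ x, Incident e x → ¬ Matched (D (ν.edge e)) x
        · have : D (ν.edge e + 1) = insert e (D (ν.edge e)) := by
            ext f
            rw [hsucc, Set.mem_insert_iff]
            have : ∀ x, Incident e x → ¬ Matched L x := fun x hx hc =>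
              hfree x hx (hc.mono Set.subset_union_left)
            tauto
          rw [this]
          have z0' := z0.2 (hfree _ (Or.inl rfl))
          have z1' := z1.2 (hfree _ (Or.inr rfl))
          have := hm.insert (hDE _) he hfree (joins_mk e)
          have hne : ν.vertex (Sum.inr e.2) ≠ ν.vertex (Sum.inl e.1) := fun hc =>
            (joins_mk e).ne (ν.vertex_inj hV.1 hV.2 hc.symm)
          simpa [carryEdge, Prog.run, Test.holds, Expr.eval, hx, e0, e1, r3, hnd, z0', z1',
            Store.cell_setCell_eq, Store.reg_setCell] using this
        · have : D (ν.edge e + 1) = D (ν.edge e) := by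
            ext f
            rw [hsucc]
            refine ⟨?_, Or.inl⟩
            rintro (hf | ⟨rfl, -, -, hu⟩)
            · exact hf
            · exfalso
              refine hfree fun x hxf ⟨f', hf', hxf'⟩ => ?_
              rcases hf' with hf' | ⟨hf', -, hlt⟩
              · exact hu x hxf ⟨f', hf', hxf'⟩
              · obtain rfl := hMm.2 f hmem.1 f' hf'.1 x hxf hxf'
                exact lt_irrefl _ hlt
          rw [this]
          by_cases c0 : s'.cell 10 (ν.vertex (Sum.inl e.1)) = 0
          · by_cases c1 : s'.cell 10 (ν.vertex (Sum.inr e.2)) = 0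
            · refine absurd ?_ hfree
              rintro x (rfl | rfl)
              · exact z0.1 c0
              · exact z1.1 c1
            · simpa [carryEdge, Prog.run, Test.holds, Expr.eval, hx, e0, e1, r3, hnd, c0, c1]
                using hm
          · simpa [carryEdge, Prog.run, Test.holds, Expr.eval, hx, e0, e1, r3, hnd, c0] using hm
    · rw [hrun.2 hmem]
      have : D (ν.edge e + 1) = D (ν.edge e) := by
        ext f
        rw [hsucc]
        exact ⟨fun hf => hf.elim id fun hf => absurd hf.2.1 hmem, Or.inl⟩
      rwa [this]
  · refine Nat.mul_le_mul_right _ ?_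
    simp [carryEdge, Prog.maxTime, Expr.cost, Test.cost]
  · rintro s' ⟨h1, h2⟩
    have : D (s.reg 1) = G.carry M d L (s.reg 4) := by
      ext e
      refine or_congr Iff.rfl ⟨fun he => ⟨he.1, he.2.1⟩, fun he => ⟨he.1, he.2, ?_⟩⟩
      rw [h.numEdges]
      exact ν.edge_lt (hMm.1 he.1.1)
    rw [this] at h1
    exact ⟨h1, h2.mono (by simp [Prog.regs, carryEdge]) (by simp [Prog.arrays, carryEdge])⟩

/-- Records the end-point with its number in array `a` of the edge in register 5 if it is free and
different from `d`. -/
def checkLost (a : ℕ) : Prog :=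
  .ite (.eq (.cell a (.reg 5)) (.reg 3)) .skip
    (.ite (.eq (.cell 10 (.cell a (.reg 5))) (.lit 0)) (.setReg 11 (.succ (.cell a (.reg 5))))
      .skip)

open Classical in
theorem run_checkLost (s : Store) (a : ℕ) : (checkLost a).run s =
    if s.cell a (s.reg 5) ≠ s.reg 3 ∧ s.cell 10 (s.cell a (s.reg 5)) = 0 then
      s.setReg 11 (s.cell a (s.reg 5) + 1) else s := by
  by_cases h0 : s.cell a (s.reg 5) = s.reg 3 <;>
  by_cases h1 : s.cell 10 (s.cell a (s.reg 5)) = 0 <;>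
  simp_all [checkLost, Prog.run, Test.holds, Expr.eval]

/-- Looks for a vertex that has lost its partner. -/
def findLost : Prog :=
  .seq (.setReg 11 (.lit 0))
    (.forLoop 5 1
      (.ite (.eq (.cell 3 (.reg 5)) (.lit 1))
        (.ite (.lt (.cell 2 (.reg 5)) (.succ (.reg 4)))
          (.seq (checkLost 0) (checkLost 1))
          .skip)
        .skip))

open Classical in
theorem findLost_spec (h : s.HoldsInstance ν r d) (hd : d ∈ G.vertices) (hM : s.HoldsMarks ν M)
    (hME : M ⊆ G.edges) (hmate : MateArray ν (s.cell 10) (G.carry M d L (s.reg 4))) :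
    Reaches findLost s (70 * (s.reg 1 + 1)) (fun s' =>
      ((s'.reg 11 = 0 ∧ G.lost M d L (s.reg 4) = ∅) ∨
        ∃ x ∈ G.lost M d L (s.reg 4), s'.reg 11 = ν.vertex x + 1) ∧ s.AgreesOff [5, 11] [] s') := by
  have hlf : (Prog.setReg 11 (.lit 0)).LoopFree := trivial
  have hinit := Reaches.of_loopFree (s := s) (Q := fun s' => s' = s.setReg 11 0) hlf rfl
  refine ((hinit.seq (T' := 65 * (s.reg 1 + 1)) (Q' := fun s' =>
      (s'.reg 11 = 0 ∧ G.lost M d L (s.reg 4) = ∅) ∨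
        ∃ x ∈ G.lost M d L (s.reg 4), s'.reg 11 = ν.vertex x + 1) ?_).frame).mono ?_ ?_
  · rintro _ rfl
    refine (Reaches.forLoop (s := s.setReg 11 0) (by simp [Prog.LoopFree, checkLost]) (by simp)
      (by simp [Prog.regs, checkLost]) (by simp [Prog.regs, checkLost]) (fun b s' =>
        (s'.reg 11 = 0 ∨ ∃ x ∈ G.lost M d L (s.reg 4), s'.reg 11 = ν.vertex x + 1) ∧
        (s'.reg 11 = 0 → ∀ e ∈ upToRank G.rank M (s.reg 4), ν.edge e < b → ∀ x, Incident e x →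
          x ∉ G.lost M d L (s.reg 4))) ?_ ?_).mono ?_ ?_
    · exact ⟨Or.inl (by simp [Store.reg_setReg]), fun _ e _ he => absurd he (Nat.not_lt_zero _)⟩
    · intro b s' hb hx hs' ⟨hl1, hl2⟩
      rw [Store.reg_setReg, if_neg (by simp), h.numEdges] at hb
      obtain ⟨e, he, rfl⟩ := ν.exists_edge hb
      have hs'' : s.AgreesOff [5, 11] [] s' := by
        refine Store.AgreesOff.trans (s₂ := s.setReg 11 0) ⟨fun y hy => ?_, fun _ _ => rfl⟩
          (hs'.mono (by simp [Prog.regs, checkLost]) (by simp [Prog.arrays, checkLost]))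
        rw [Store.reg_setReg, if_neg]
        rintro rfl
        simp at hy
      have h' := h.congr hs'' (by simp) (by simp)
      have hM' := hM.congr hs'' (by simp)
      have r4 : s'.reg 4 = s.reg 4 := hs''.1 4 (by simp)
      have hm : MateArray ν (s'.cell 10) (G.carry M d L (s.reg 4)) := by
        rw [hs''.2 10 (by simp)]
        exact hmate
      have hrun := run_ite_marked (p := (.seq (checkLost 0) (checkLost 1))) he h' hM' hx
      rw [r4] at hrun
      simp only [Store.reg_setReg, if_neg (show ¬ (11 = 5) by omega)]
      by_cases hmem : e ∈ upToRank G.rank M (s.reg 4)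
      · rw [hrun.1 hmem]
        have e0 := h'.applicant e he
        have e1 := h'.post e he
        have r3 := h'.deleted
        have hV := RankInstance.joins_mem_vertices he (joins_mk e)
        -- the tests of the program describe the vertices that have lost their partners
        have hlost : ∀ x, Incident e x → (x ∈ G.lost M d L (s.reg 4) ↔
            ν.vertex x ≠ ν.vertex d ∧ s'.cell 10 (ν.vertex x) = 0) := by
          intro x hxe
          have hxV := RankInstance.incident_mem_vertices he hxe
          rw [hm.eq_zero_iff hxV]
          constructor
          · rintro ⟨h1, -, h3⟩
            rw [RankInstance.mem_vertices_delete] at h1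
            exact ⟨fun hc => h1.2 (ν.vertex_inj h1.1 hd hc), h3⟩
          · rintro ⟨h1, h2⟩
            exact ⟨RankInstance.mem_vertices_delete.2 ⟨hxV, fun hc => h1 (hc ▸ rfl)⟩,
              ⟨e, hmem, hxe⟩, h2⟩
        have l0 := hlost _ (Or.inl rfl)
        have l1 := hlost _ (Or.inr rfl)
        have hfin : ∀ s'' : Store, (s''.reg 11 = 0 ∨
            ∃ x ∈ G.lost M d L (s.reg 4), s''.reg 11 = ν.vertex x + 1) →
            (s''.reg 11 = 0 → s'.reg 11 = 0 ∧ Sum.inl e.1 ∉ G.lost M d L (s.reg 4) ∧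
              Sum.inr e.2 ∉ G.lost M d L (s.reg 4)) →
            (s''.reg 11 = 0 ∨ ∃ x ∈ G.lost M d L (s.reg 4), s''.reg 11 = ν.vertex x + 1) ∧
            (s''.reg 11 = 0 → ∀ f ∈ upToRank G.rank M (s.reg 4), ν.edge f < ν.edge e + 1 →
              ∀ x, Incident f x → x ∉ G.lost M d L (s.reg 4)) := by
          refine fun s'' h1 h2 => ⟨h1, fun h3 f hf hlt x hxf => ?_⟩
          obtain ⟨h4, h5, h6⟩ := h2 h3
          rcases Nat.eq_or_lt_of_le (Nat.lt_succ_iff.1 hlt) with hlt | hlt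
          · obtain rfl := ν.edge_inj (hME hf.1) he hlt
            rcases hxf with rfl | rfl
            · exact h5
            · exact h6
          · exact hl2 h4 f hf hlt x hxf
        have hrun0 : (checkLost 0).run s' =
            if Sum.inl e.1 ∈ G.lost M d L (s.reg 4) then
              s'.setReg 11 (ν.vertex (Sum.inl e.1) + 1) else s' := by
          rw [run_checkLost, hx, e0, r3]
          exact if_congr l0.symm rfl rfl
        have hrun1 : ∀ n, (checkLost 1).run (s'.setReg 11 n) =
            if Sum.inr e.2 ∈ G.lost M d L (s.reg 4) then
              (s'.setReg 11 n).setReg 11 (ν.vertex (Sum.inr e.2) + 1) else s'.setReg 11 n := by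
          intro n
          have r5' : (s'.setReg 11 n).reg 5 = s'.reg 5 := by simp [Store.reg_setReg]
          have r3' : (s'.setReg 11 n).reg 3 = s'.reg 3 := by simp [Store.reg_setReg]
          rw [run_checkLost, Store.cell_setReg, r5', r3', hx, e1, r3]
          exact if_congr l1.symm rfl rfl
        have hself : s' = s'.setReg 11 (s'.reg 11) := by simp [Store.setReg]
        rw [Prog.run, hrun0]
        by_cases m0 : Sum.inl e.1 ∈ G.lost M d L (s.reg 4) <;>
        by_cases m1 : Sum.inr e.2 ∈ G.lost M d L (s.reg 4)
        · rw [if_pos m0, hrun1, if_pos m1]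
          exact hfin _ (Or.inr ⟨_, m1, by simp [Store.reg_setReg]⟩) (by simp [Store.reg_setReg])
        · rw [if_pos m0, hrun1, if_neg m1]
          exact hfin _ (Or.inr ⟨_, m0, by simp [Store.reg_setReg]⟩) (by simp [Store.reg_setReg])
        · rw [if_neg m0, hself, hrun1, if_pos m1]
          exact hfin _ (Or.inr ⟨_, m1, by simp [Store.reg_setReg]⟩) (by simp [Store.reg_setReg])
        · rw [if_neg m0, hself, hrun1, if_neg m1, ← hself]
          exact hfin _ hl1 fun h0 => ⟨h0, m0, m1⟩
      · rw [hrun.2 hmem]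
        refine ⟨hl1, fun h0 f hf hlt x hxf => ?_⟩
        rcases Nat.eq_or_lt_of_le (Nat.lt_succ_iff.1 hlt) with hlt | hlt
        · obtain rfl := ν.edge_inj (hME hf.1) he hlt
          exact absurd hf hmem
        · exact hl2 h0 f hf hlt x hxf
    · rw [Store.reg_setReg, if_neg (by simp)]
      refine Nat.mul_le_mul_right _ ?_
      simp [checkLost, Prog.maxTime, Expr.cost, Test.cost]
    · rintro s' ⟨⟨h1, h2⟩, -⟩
      rcases h1 with h1 | h1
      · refine Or.inl ⟨h1, Set.eq_empty_of_forall_notMem fun x hx => ?_⟩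
        obtain ⟨e, he, hxe⟩ := hx.2.1
        refine h2 h1 e he ?_ x hxe hx
        rw [Store.reg_setReg, if_neg (by simp), h.numEdges]
        exact ν.edge_lt (hME he.1)
      · exact Or.inr h1
  · simp only [Prog.maxTime, Expr.cost]
    omega
  · rintro s' ⟨h1, h2⟩
    exact ⟨h1, h2.mono (by simp [Prog.regs, Prog.forLoop, checkLost])
      (by simp [Prog.arrays, Prog.forLoop, checkLost])⟩

end Programs

/-! ### Augmenting the matching -/

theorem Reaches.loop_of_not {c : Test} {p : Prog} {s : Store} {Q : Store → Prop} (hc : ¬ c.holds s)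
    (h : Q s) : Reaches (.loop c p) s c.cost Q := ⟨s, _, .loopStop hc, le_rfl, h⟩

theorem Reaches.loop_step {c : Test} {p : Prog} {s : Store} {T T' : ℕ} {Q Q' : Store → Prop}
    (hc : c.holds s) (h : Reaches p s T Q)
    (h' : ∀ s', Q s' → Reaches (.loop c p) s' T' Q') :
    Reaches (.loop c p) s (c.cost + T + T') Q' := by
  obtain ⟨s', t, e, ht, hs⟩ := h
  obtain ⟨s'', t', e', ht', hs'⟩ := h' s' hs
  exact ⟨s'', _, .loopStep hc e e', by omega, hs'⟩

/-- Flips the partners along the path that leads to the vertex whose successor is in register 10,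
from the end to the start. -/
def augmentLoop : Prog :=
  .loop (.lt (.lit 0) (.reg 10))
    (.seq (.setReg 12 (.pred (.reg 10)))
      (.seq (.setReg 9 (.pred (.cell 11 (.reg 12))))
        (.seq (.setReg 10 (.cell 10 (.reg 9)))
          (.seq (.setCell 10 (.reg 9) (.succ (.reg 12)))
            (.setCell 10 (.reg 12) (.succ (.reg 9)))))))

theorem augmentLoop_spec {p : ℕ → ℕ} {b : ℕ} {s : Store}
    (hinj : ∀ i ≤ 2 * b + 1, ∀ j ≤ 2 * b + 1, p i = p j → i = j)
    (hpar : ∀ t ≤ b, s.cell 11 (p (2 * t + 1)) = p (2 * t) + 1)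
    (hmate : ∀ t < b, s.cell 10 (p (2 * t + 2)) = p (2 * t + 1) + 1)
    (h0 : s.cell 10 (p 0) = 0) (hend : s.reg 10 = p (2 * b + 1) + 1) :
    Reaches augmentLoop s (40 * (b + 1) + 3) (fun s' =>
      (∀ t ≤ b, s'.cell 10 (p (2 * t)) = p (2 * t + 1) + 1 ∧
        s'.cell 10 (p (2 * t + 1)) = p (2 * t) + 1) ∧
      ∀ v, (∀ t ≤ 2 * b + 1, p t ≠ v) → s'.cell 10 v = s.cell 10 v) := by
  induction b generalizing s with
  | zero =>
    have hne : p 0 ≠ p 1 := fun hc => by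
      have := hinj 0 (by omega) 1 (by omega) hc
      omega
    have hpar0 : s.cell 11 (p 1) = p 0 + 1 := hpar 0 le_rfl
    have hend0 : s.reg 10 = p 1 + 1 := hend
    refine (Reaches.loop_step (T' := 3) (by simp [Test.holds, Expr.eval, hend])
      (Reaches.of_loopFree (by simp [Prog.LoopFree]) rfl) ?_).mono ?_ fun s' h => h
    · rintro _ rfl
      refine Reaches.loop_of_not ?_ ⟨?_, ?_⟩
      · simp [Prog.run, Test.holds, Expr.eval, Store.reg_setCell, Store.reg_setReg,
          Store.cell_setReg, hend0, hpar0, h0]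
      · intro t ht
        obtain rfl : t = 0 := by omega
        simp [Prog.run, Expr.eval, Store.reg_setCell, Store.reg_setReg,
          Store.cell_setReg, Store.cell_setCell, hend0, hpar0, hne]
      · intro v hv
        simp [Prog.run, Expr.eval, Store.reg_setCell, Store.reg_setReg,
          Store.cell_setReg, Store.cell_setCell, hend0, hpar0, (hv 0 (by omega)).symm,
          (hv 1 (by omega)).symm]
    · simp [Prog.maxTime, Test.cost, Expr.cost]
  | succ b ih =>
    have e1 : 2 * (b + 1) + 1 = 2 * b + 3 := by ring
    have e2 : 2 * (b + 1) = 2 * b + 2 := by ring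
    rw [e1] at hinj hend ⊢
    have hpar' : s.cell 11 (p (2 * b + 3)) = p (2 * b + 2) + 1 := hpar (b + 1) le_rfl
    have hmate' : s.cell 10 (p (2 * b + 2)) = p (2 * b + 1) + 1 := hmate b (by omega)
    have hne : ∀ i ≤ 2 * b + 3, ∀ j ≤ 2 * b + 3, i ≠ j → p i ≠ p j :=
      fun i hi j hj hij hc => hij (hinj i hi j hj hc)
    have h23 := hne (2 * b + 2) (by omega) (2 * b + 3) (by omega) (by omega)
    refine (Reaches.loop_step (T' := 40 * (b + 1) + 3) (by simp [Test.holds, Expr.eval, hend])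
      (Reaches.of_loopFree (by simp [Prog.LoopFree]) rfl) ?_).mono ?_ fun s' h => h
    · rintro _ rfl
      refine (ih ?_ ?_ ?_ ?_ ?_).mono le_rfl ?_
      · exact fun i hi j hj => hinj i (by omega) j (by omega)
      · intro t ht
        simpa [Prog.run, Expr.eval, Store.cell_setReg, Store.cell_setCell]
          using hpar t (by omega)
      · intro t ht
        have a1 := hne (2 * t + 2) (by omega) (2 * b + 2) (by omega) (by omega)
        have a2 := hne (2 * t + 2) (by omega) (2 * b + 3) (by omega) (by omega)
        simpa [Prog.run, Expr.eval, Store.reg_setCell, Store.reg_setReg, Store.cell_setReg,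
          Store.cell_setCell, hend, hpar', a1, a2] using hmate t (by omega)
      · have a1 := hne 0 (by omega) (2 * b + 2) (by omega) (by omega)
        have a2 := hne 0 (by omega) (2 * b + 3) (by omega) (by omega)
        simpa [Prog.run, Expr.eval, Store.reg_setCell, Store.reg_setReg, Store.cell_setReg,
          Store.cell_setCell, hend, hpar', a1, a2] using h0
      · simp [Prog.run, Expr.eval, Store.reg_setCell, Store.reg_setReg, Store.cell_setReg, hend,
          hpar', hmate']
      · rintro s' ⟨h1, h2⟩
        constructor
        · intro t ht
          rcases Nat.lt_or_ge b t with hbt | hbt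
          · obtain rfl : t = b + 1 := by omega
            rw [e2, h2, h2]
            · simp [Prog.run, Expr.eval, Store.reg_setCell, Store.reg_setReg, Store.cell_setReg,
                Store.cell_setCell, hend, hpar', h23]
            · exact fun t ht => hne t (by omega) _ (by omega) (by omega)
            · exact fun t ht => hne t (by omega) _ (by omega) (by omega)
          · exact h1 t hbt
        · intro v hv
          rw [h2 v fun t ht => hv t (by omega)]
          have a1 := (hv (2 * b + 2) (by omega)).symm
          have a2 := (hv (2 * b + 3) (by omega)).symm
          simp [Prog.run, Expr.eval, Store.reg_setCell, Store.reg_setReg, Store.cell_setReg,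
            Store.cell_setCell, hend, hpar', a1, a2]
    · simp only [Prog.maxTime, Test.cost, Expr.cost]
      omega

/-! ### Starting the searches -/

theorem SearchInv.start {Γ : NumberedGraph} {root E O : ℕ → Prop} {σ : SearchState}
    (hqh : σ.qh = 0) (hptr : σ.ptr = 0) (hfound : σ.found = 0) (hgo : σ.go = 0 → σ.qt = 0)
    (hlt : ∀ k < σ.qt, σ.queue k < Γ.n)
    (hinj : ∀ j < σ.qt, ∀ k < σ.qt, σ.queue j = σ.queue k → j = k)
    (hroot : ∀ v, root v ↔ ∃ k < σ.qt, σ.queue k = v)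
    (hev : ∀ v < Γ.n, σ.ev v ≠ 0 ↔ ∃ k < σ.qt, σ.queue k = v) (hpar : ∀ v < Γ.n, σ.par v = 0)
    (hE : ∀ v, root v → E v) : SearchInv Γ root E O σ where
  qh_le := by omega
  queue_lt := hlt
  queue_inj := hinj
  ev_iff := hev
  root_ev v hv := by
    obtain ⟨k, hk, rfl⟩ := (hroot v).1 hv
    exact ⟨hlt k hk, (hev _ (hlt k hk)).2 ⟨k, hk, rfl⟩⟩
  queue_mate k hk := Or.inl ((hroot _).2 ⟨k, hk, rfl⟩)
  par_odd v hv hc := absurd (hpar v hv) hc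
  queue_even k hk := hE _ ((hroot _).2 ⟨k, hk, rfl⟩)
  queue_path k hk := ⟨0, fun _ => σ.queue k, by simp, rfl,
    ⟨fun i hi j hj _ => by omega, (hroot _).2 ⟨k, hk, rfl⟩, fun t ht => absurd ht (by omega),
      fun t ht => absurd ht (by omega), fun _ _ => hlt k hk⟩,
    fun _ _ _ => (hev _ (hlt k hk)).2 ⟨k, hk, rfl⟩⟩
  par_ev _ v hv hc := absurd (hpar v hv) hc
  found_spec hc := absurd hfound hc
  done _ k hk := by omega
  cur_spec hc := absurd hptr hc
  halted h0 _ := ⟨hptr, by rw [hqh, hgo h0]⟩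

/-- Puts the lost vertex, if there is one, into the queue. -/
def startLost : Prog :=
  .seq (.setReg 6 (.lit 0)) (.seq (.setReg 7 (.lit 0)) (.seq (.setReg 8 (.lit 0))
    (.seq (.setReg 10 (.lit 0)) (.seq (.setReg 14 (.lit 0))
      (.ite (.eq (.reg 11) (.lit 0)) .skip
        (.seq (.setCell 13 (.lit 0) (.pred (.reg 11)))
          (.seq (.setCell 12 (.pred (.reg 11)) (.lit 1))
            (.seq (.setReg 7 (.lit 1)) (.setReg 14 (.lit 1))))))))))

theorem startLost_spec {Γ : NumberedGraph} {s : Store}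
    (h11 : ∀ v < Γ.n, s.cell 11 v = 0) (h12 : ∀ v < Γ.n, s.cell 12 v = 0)
    (hlt : ∀ v, s.reg 11 = v + 1 → v < Γ.n) :
    Reaches startLost s 60 (fun s' =>
      SearchInv Γ (fun v => s.reg 11 = v + 1) (fun _ => True) (fun _ => True) s'.search ∧
        s'.reg 8 = 0) := by
  refine (Reaches.of_loopFree (by simp [startLost, Prog.LoopFree]) ⟨?_, ?_⟩).mono
    (by simp [startLost, Prog.maxTime, Expr.cost, Test.cost]) fun s' h => h
  · rcases hr : s.reg 11 with _ | v
    · refine SearchInv.start ?_ ?_ ?_ ?_ ?_ ?_ ?_ ?_ ?_ ?_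
      all_goals simp +contextual [startLost, Prog.run, Test.holds, Expr.eval, Store.search,
        Store.reg_setReg, Store.cell_setReg, hr, h11, h12]
    · have := hlt v hr
      refine SearchInv.start ?_ ?_ ?_ ?_ ?_ ?_ ?_ ?_ ?_ ?_
      all_goals simp +contextual [startLost, Prog.run, Test.holds, Expr.eval, Store.search,
        Store.reg_setReg, Store.cell_setReg, Store.cell_setCell, Store.reg_setCell, hr, h11, h12,
        this, eq_comm]
  · rcases hr : s.reg 11 with _ | v <;>
    simp [startLost, Prog.run, Test.holds, Expr.eval, Store.reg_setReg, Store.reg_setCell, hr]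

/-- Puts all unmatched vertices into the queue. -/
def startFree : Prog :=
  .seq (.setReg 6 (.lit 0)) (.seq (.setReg 7 (.lit 0)) (.seq (.setReg 8 (.lit 0))
    (.seq (.setReg 10 (.lit 0)) (.seq (.setReg 14 (.lit 1))
      (.forLoop 5 0
        (.ite (.eq (.cell 10 (.reg 5)) (.lit 0))
          (.seq (.setCell 13 (.reg 7) (.reg 5))
            (.seq (.setCell 12 (.reg 5) (.lit 1)) (.setReg 7 (.succ (.reg 7)))))
          .skip))))))

theorem startFree_spec {Γ : NumberedGraph} {E O : ℕ → Prop} {s : Store} (hn : s.reg 0 = Γ.n)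
    (h10 : ∀ v < Γ.n, s.cell 10 v = Γ.mate v)
    (h11 : ∀ v < Γ.n, s.cell 11 v = 0) (h12 : ∀ v < Γ.n, s.cell 12 v = 0)
    (hE : ∀ v < Γ.n, Γ.mate v = 0 → E v) :
    Reaches startFree s (70 * (s.reg 0 + 1)) (fun s' =>
      SearchInv Γ (fun v => v < Γ.n ∧ Γ.mate v = 0) E O s'.search ∧ s'.reg 8 = 0) := by
  set s₁ := ((((s.setReg 6 0).setReg 7 0).setReg 8 0).setReg 10 0).setReg 14 1 with hs₁
  have hloop := Reaches.forLoop (s := s₁) (x := 5) (N := 0)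
    (body := .ite (.eq (.cell 10 (.reg 5)) (.lit 0))
          (.seq (.setCell 13 (.reg 7) (.reg 5))
            (.seq (.setCell 12 (.reg 5) (.lit 1)) (.setReg 7 (.succ (.reg 7)))))
          .skip) (by simp [Prog.LoopFree]) (by simp) (by simp [Prog.regs])
    (by simp [Prog.regs]) (fun b s' =>
      (∀ k < s'.reg 7, s'.cell 13 k < b) ∧
      (∀ j < s'.reg 7, ∀ k < s'.reg 7, s'.cell 13 j = s'.cell 13 k → j = k) ∧
      (∀ v < Γ.n, (v < b ∧ Γ.mate v = 0) ↔ ∃ k < s'.reg 7, s'.cell 13 k = v) ∧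
      (∀ v < Γ.n, s'.cell 12 v ≠ 0 ↔ ∃ k < s'.reg 7, s'.cell 13 k = v)) ?_ ?_
  · have hr0 : s₁.reg 0 = Γ.n := by simp [hs₁, Store.reg_setReg, hn]
    rw [hr0] at hloop
    have hinit : ∀ (x n : ℕ) (s : Store), Reaches (.setReg x (.lit n)) s 2
        (fun s' => s' = s.setReg x n) := fun x n s => Reaches.of_loopFree (by trivial) rfl
    rw [hn]
    refine ((hinit 6 0 s).seq (Q' := fun s' => SearchInv Γ (fun v => v < Γ.n ∧ Γ.mate v = 0) E O
        s'.search ∧ s'.reg 8 = 0) (T' := 8 + 60 * (Γ.n + 1)) ?_).mono (by omega) fun s' h => h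
    rintro _ rfl
    refine ((hinit 7 0 _).seq (T' := 6 + 60 * (Γ.n + 1)) ?_).mono (by omega) fun s' h => h
    rintro _ rfl
    refine ((hinit 8 0 _).seq (T' := 4 + 60 * (Γ.n + 1)) ?_).mono (by omega) fun s' h => h
    rintro _ rfl
    refine ((hinit 10 0 _).seq (T' := 2 + 60 * (Γ.n + 1)) ?_).mono (by omega) fun s' h => h
    rintro _ rfl
    refine ((hinit 14 1 _).seq (T' := 60 * (Γ.n + 1)) ?_).mono (by omega) fun s' h => h
    rintro _ rfl
    refine hloop.mono (Nat.mul_le_mul_right _ (by simp [Prog.maxTime, Expr.cost, Test.cost])) ?_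
    rintro s' ⟨⟨i1, i2, i3, i4⟩, hs'⟩
    have e8 : s'.reg 8 = 0 := by rw [hs'.1 8 (by simp [Prog.regs])]; simp [hs₁, Store.reg_setReg]
    refine ⟨SearchInv.start ?_ e8 ?_ ?_ i1 i2 ?_ i4 ?_ fun v hv => hE v hv.1 hv.2, e8⟩
    · change s'.reg 6 = 0
      rw [hs'.1 6 (by simp [Prog.regs])]
      simp [hs₁, Store.reg_setReg]
    · change s'.reg 10 = 0
      rw [hs'.1 10 (by simp [Prog.regs])]
      simp [hs₁, Store.reg_setReg]
    · intro h14
      change s'.reg 14 = 0 at h14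
      rw [hs'.1 14 (by simp [Prog.regs])] at h14
      simp [hs₁, Store.reg_setReg] at h14
    · intro v
      constructor
      · exact fun hv => (i3 v hv.1).1 hv
      · rintro ⟨k, hk, rfl⟩
        exact (i3 _ (i1 k hk)).2 ⟨k, hk, rfl⟩
    · intro v hv
      change s'.cell 11 v = 0
      rw [hs'.2 11 (by simp [Prog.arrays])]
      simpa [hs₁, Store.cell_setReg] using h11 v hv
  · refine ⟨?_, ?_, ?_, ?_⟩
    all_goals simp +contextual [hs₁, Store.reg_setReg, Store.cell_setReg, h12]
  · rintro b s' hb hx hs' ⟨i1, i2, i3, i4⟩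
    have hr0 : s₁.reg 0 = Γ.n := by simp [hs₁, Store.reg_setReg, hn]
    rw [hr0] at hb
    have e10 : s'.cell 10 b = Γ.mate b := by
      rw [hs'.2 10 (by simp [Prog.arrays]), ← h10 b hb]
      simp [hs₁, Store.cell_setReg]
    by_cases hm : Γ.mate b = 0
    · have hrun : (((Prog.ite (.eq (.cell 10 (.reg 5)) (.lit 0))
          (.seq (.setCell 13 (.reg 7) (.reg 5))
            (.seq (.setCell 12 (.reg 5) (.lit 1)) (.setReg 7 (.succ (.reg 7)))))
          .skip).run s').setReg 5 (b + 1)) = (((s'.setCell 13 (s'.reg 7) b).setCell 12 b 1).setReg 7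
            (s'.reg 7 + 1)).setReg 5 (b + 1) := by
        simp [Prog.run, Test.holds, Expr.eval, hx, e10, hm, Store.reg_setCell]
      rw [hrun]
      set s₂ := (((s'.setCell 13 (s'.reg 7) b).setCell 12 b 1).setReg 7
            (s'.reg 7 + 1)).setReg 5 (b + 1) with hs₂
      have f7 : s₂.reg 7 = s'.reg 7 + 1 := by simp [hs₂, Store.reg_setReg]
      have f13 : ∀ k < s'.reg 7, s₂.cell 13 k = s'.cell 13 k := fun k hk => by
        simp [hs₂, Store.cell_setReg, Store.cell_setCell, hk.ne]
      have f13' : s₂.cell 13 (s'.reg 7) = b := by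
        simp [hs₂, Store.cell_setReg, Store.cell_setCell]
      have f12 : ∀ v, s₂.cell 12 v = if v = b then 1 else s'.cell 12 v := fun v => by
        simp [hs₂, Store.cell_setReg, Store.cell_setCell]
      have hex : ∀ v, (∃ k < s₂.reg 7, s₂.cell 13 k = v) ↔
          (∃ k < s'.reg 7, s'.cell 13 k = v) ∨ b = v := by
        intro v
        rw [f7]
        constructor
        · rintro ⟨k, hk, rfl⟩
          rcases Nat.eq_or_lt_of_le (Nat.lt_succ_iff.1 hk) with rfl | hk
          · exact Or.inr f13'.symm
          · exact Or.inl ⟨k, hk, (f13 k hk).symm⟩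
        · rintro (⟨k, hk, rfl⟩ | rfl)
          · exact ⟨k, by omega, f13 k hk⟩
          · exact ⟨_, Nat.lt_succ_self _, f13'⟩
      refine ⟨?_, ?_, ?_, ?_⟩
      · intro k hk
        rw [f7] at hk
        rcases Nat.eq_or_lt_of_le (Nat.lt_succ_iff.1 hk) with rfl | hk
        · omega
        · have := i1 k hk
          rw [f13 k hk]
          omega
      · intro j hj k hk hjk
        rw [f7] at hj hk
        rcases Nat.eq_or_lt_of_le (Nat.lt_succ_iff.1 hj) with rfl | hj <;>
        rcases Nat.eq_or_lt_of_le (Nat.lt_succ_iff.1 hk) with rfl | hk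
        · rfl
        · have := i1 k hk
          rw [f13', f13 k hk] at hjk
          omega
        · have := i1 j hj
          rw [f13', f13 j hj] at hjk
          omega
        · rw [f13 j hj, f13 k hk] at hjk
          exact i2 j hj k hk hjk
      · intro v hv
        rw [hex, ← i3 v hv]
        constructor
        · rintro ⟨h1, h2⟩
          rcases Nat.eq_or_lt_of_le (Nat.lt_succ_iff.1 h1) with rfl | h1
          · exact Or.inr rfl
          · exact Or.inl ⟨h1, h2⟩
        · rintro (⟨h1, h2⟩ | rfl)
          · exact ⟨by omega, h2⟩
          · exact ⟨by omega, hm⟩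
      · intro v hv
        rw [hex, ← i4 v hv, f12]
        by_cases hvb : v = b
        · simp [hvb]
        · simp [hvb, Ne.symm hvb]
    · have hrun : (Prog.ite (.eq (.cell 10 (.reg 5)) (.lit 0))
          (.seq (.setCell 13 (.reg 7) (.reg 5))
            (.seq (.setCell 12 (.reg 5) (.lit 1)) (.setReg 7 (.succ (.reg 7)))))
          .skip).run s' = s' := by
        simp [Prog.run, Test.holds, Expr.eval, hx, e10, hm]
      rw [hrun]
      simp only [Store.reg_setReg, Store.cell_setReg, if_neg (show ¬ (7 = 5) by omega)]
      refine ⟨fun k hk => (i1 k hk).trans (Nat.lt_succ_self b), i2, fun v hv => ?_, i4⟩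
      rw [← i3 v hv]
      constructor
      · rintro ⟨h1, h2⟩
        rcases Nat.eq_or_lt_of_le (Nat.lt_succ_iff.1 h1) with rfl | h1
        · exact absurd h2 hm
        · exact ⟨h1, h2⟩
      · rintro ⟨h1, h2⟩
        exact ⟨by omega, h2⟩

/-! ### Augmenting from the lost vertex, and computing the labels -/

section Programs

variable {A : Type u} {P : Type v} {G : RankInstance A P} {ν : CellNumbering G} {r : ℕ}
  {d : A ⊕ P} {s s' : Store} {M L C N F : Set (A × P)} {ap po : ℕ → ℕ}
  {hap : ∀ e ∈ G.edges, ap (ν.edge e) = ν.vertex (Sum.inl e.1)}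
  {hpo : ∀ e ∈ G.edges, po (ν.edge e) = ν.vertex (Sum.inr e.2)}

/-- An augmenting path found by the search. -/
theorem SearchInv.exists_augmentsFrom [Nonempty (A ⊕ P)] {mate : ℕ → ℕ} {hN : C ⊆ G.edges}
    {hm : MateArray ν mate C} (hF : F ⊆ G.edges) (hC : IsMatching F C)
    {root E O : ℕ → Prop} {σ : SearchState} (hroot : ∀ v, root v → mate v = 0)
    (h : SearchInv (ν.graph F hap hpo hN hm) root E O σ) (hf : σ.found ≠ 0) :
    ∃ b p q, (ν.graph F hap hpo hN hm).TracePath root σ.par (2 * b + 1) p ∧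
      σ.found = p (2 * b + 1) + 1 ∧ (∀ t ≤ 2 * b + 1, q t ∈ G.vertices ∧ ν.vertex (q t) = p t) ∧
      IsAltPath F C (2 * b + 1) q ∧ ¬ Matched C (q 0) ∧ ¬ Matched C (q (2 * b + 1)) := by
  obtain ⟨-, l, p, ⟨b, rfl⟩, hfp, hml, hp⟩ := h.found_spec hf
  obtain ⟨q, hq, hqp⟩ := hp.exists_isAltPath hF hC hroot
  refine ⟨b, p, q, hp, hfp, hq, hqp, ?_, ?_⟩
  · rw [← hm.eq_zero_iff (hq 0 (by omega)).1, (hq 0 (by omega)).2]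
    exact hroot _ hp.start
  · rw [← hm.eq_zero_iff (hq _ le_rfl).1, (hq _ le_rfl).2]
    exact hml

/-- When the search stops without success, there is no augmenting path from a root. -/
theorem SearchInv.not_augmentsFrom {mate : ℕ → ℕ} {hN : C ⊆ G.edges}
    {hm : MateArray ν mate C} (hF : F ⊆ G.edges)
    {root E O : ℕ → Prop} {σ : SearchState}
    (h : SearchInv (ν.graph F hap hpo hN hm) root E O σ) (hgo : σ.go = 0) (hf : σ.found = 0)
    {x : A ⊕ P} (hx : root (ν.vertex x)) : ¬ AugmentsFrom F C x N := by
  rintro ⟨k, q, rfl, ⟨b, rfl⟩, hq, -, h1, -⟩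
  obtain ⟨e, he, hj, -⟩ := hq.2 (2 * b) (by omega)
  have hV := (RankInstance.joins_mem_vertices (hF he) hj).2
  have hpar := (h.marked_of_isAltPath hF hgo hf hq hx le_rfl).2 ⟨b, rfl⟩
  obtain ⟨z, -, hz, -⟩ := h.par_ev hf _ (ν.vertex_lt hV) hpar
  have := (hm.eq_zero_iff hV).2 h1
  change mate _ = z + 1 at hz
  omega

/-- Searches for an augmenting path from the lost vertex, and augments along it. -/
def augmentLost : Prog := .seq startLost (.seq searchLoop augmentLoop)

theorem augmentLost_spec [Nonempty (A ⊕ P)] (hF : F ⊆ G.edges) (hC : IsMatching F C)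
    {hCG : C ⊆ G.edges} {hm : MateArray ν (s.cell 10) C}
    (hΓ : s.HoldsGraph (ν.graph F hap hpo hCG hm))
    (h11 : ∀ v < G.numVertices, s.cell 11 v = 0) (h12 : ∀ v < G.numVertices, s.cell 12 v = 0)
    (hlost : s.reg 11 = 0 ∨ ∃ x ∈ G.vertices, ¬ Matched C x ∧ s.reg 11 = ν.vertex x + 1) :
    Reaches augmentLost s (500 * (G.numVertices + G.numEdges + 1)) (fun s' =>
      (s.reg 11 = 0 → MateArray ν (s'.cell 10) C) ∧
      ∀ x ∈ G.vertices, s.reg 11 = ν.vertex x + 1 →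
        (∃ N, AugmentsFrom F C x N ∧ MateArray ν (s'.cell 10) N) ∨
        ((¬ ∃ N, AugmentsFrom F C x N) ∧ MateArray ν (s'.cell 10) C)) := by
  have hlt : ∀ v, s.reg 11 = v + 1 → v < G.numVertices ∧ s.cell 10 v = 0 := by
    intro v hv
    rcases hlost with h | ⟨x, hx, hxC, h⟩
    · omega
    · obtain rfl : v = ν.vertex x := by omega
      exact ⟨ν.vertex_lt hx, hm.unmatched x hx hxC⟩
  have hstart := (startLost_spec (Γ := ν.graph F hap hpo hCG hm) h11 h12
    fun v hv => (hlt v hv).1).frame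
  refine Reaches.mono (hstart.seq (T' := 100 * (G.numVertices + 2 * G.numEdges + 2) +
    (40 * G.numVertices + 3)) ?_) (by omega) fun s' h => h
  rintro s₁ ⟨⟨hinv, hptr⟩, hs₁⟩
  have hΓ₁ := hΓ.congr hs₁ (by simp [startLost, Prog.arrays])
  refine (searchLoop_spec hΓ₁ hinv hptr (fun v hv => (hlt v hv).2) (fun _ _ _ _ => trivial)
    fun _ _ _ _ _ => trivial).seq ?_
  rintro s₂ ⟨hinv₂, hgo, hs₂⟩
  have hmate : s₂.cell 10 = s.cell 10 := by
    rw [hs₂.2 10 (by simp [searchBody, Prog.arrays]), hs₁.2 10 (by simp [startLost, Prog.arrays])]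
  by_cases hf : s₂.reg 10 = 0
  · refine (Reaches.loop_of_not (by simp [Test.holds, Expr.eval, hf]) ⟨fun _ => ?_, fun x _ hx =>
      Or.inr ⟨?_, ?_⟩⟩).mono (by simp [Test.cost, Expr.cost]) fun s' h => h
    · rw [hmate]
      exact hm
    · rintro ⟨N, hN⟩
      exact hinv₂.not_augmentsFrom hF hgo hf hx hN
    · rw [hmate]
      exact hm
  · obtain ⟨b, p, q, hp, hfp, hq, hqp, hq0, hql⟩ :=
      hinv₂.exists_augmentsFrom hF hC (fun v hv => (hlt v hv).2) hf
    change s₂.reg 10 = _ at hfp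
    have hb : b + 1 ≤ G.numVertices := by
      have hmaps : ∀ t ∈ Finset.range (2 * b + 2), p t ∈ Finset.range G.numVertices :=
        fun t ht => Finset.mem_range.2 (hp.lt t (by have := Finset.mem_range.1 ht; omega))
      have := Finset.card_le_card_of_injOn p hmaps fun i hi j hj hij =>
        hp.inj i (by simpa [Nat.lt_succ_iff] using hi) j (by simpa [Nat.lt_succ_iff] using hj) hij
      simp only [Finset.card_range] at this
      omega
    refine (augmentLoop_spec (p := p) (b := b) hp.inj ?_ ?_ ?_ hfp).mono
      (by have := Nat.mul_le_mul_left 40 hb; omega) ?_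
    · exact fun t ht => (hp.even_step (2 * t) (by omega) (by simp)).1
    · intro t ht
      rw [hmate]
      have := hp.odd_step (2 * t + 1) (by omega) ⟨t, rfl⟩
      exact ((ν.graph F hap hpo hCG hm).mate_spec _ (hp.lt _ (by omega)) _ this).2.1
    · rw [hmate]
      exact (hlt _ hp.start).2
    · rintro s' ⟨h1, h2⟩
      have hodd : Odd (2 * b + 1) := ⟨b, rfl⟩
      refine ⟨fun h0 => ?_, fun x hx hxr => Or.inl ⟨_, ⟨2 * b + 1, q, ?_, hodd, hqp, hq0, hql, rfl⟩,
        ?_⟩⟩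
      · have : s.reg 11 = p 0 + 1 := hp.start
        omega
      · have : s.reg 11 = p 0 + 1 := hp.start
        refine ν.vertex_inj (hq 0 (by omega)).1 hx ?_
        rw [(hq 0 (by omega)).2]
        omega
      · refine hm.symmDiff hCG hF hC hodd hqp hq0 hql ?_ ?_
        · rintro t ht ⟨c, hc⟩
          obtain rfl : t = 2 * c := by omega
          rw [(hq _ ht.le).2, (hq (2 * c + 1) ht).2]
          exact h1 c (by omega)
        · intro v hv
          rw [h2 v fun t ht => ?_, hmate]
          rw [← (hq t ht).2]
          exact hv t ht

/-- Marks the even and the odd vertices. -/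
def computeLabels : Prog := .seq clearMarks (.seq startFree searchLoop)

theorem computeLabels_spec (hF : F ⊆ (G.delete d).edges)
    (hN : IsMaximumMatching F N) {hNG : N ⊆ G.edges} {hm : MateArray ν (s.cell 10) N}
    (hΓ : s.HoldsGraph (ν.graph F hap hpo hNG hm)) (hn : s.reg 0 = G.numVertices) :
    Reaches computeLabels s (500 * (G.numVertices + G.numEdges + 1)) (fun s' =>
      ∀ x ∈ (G.delete d).vertices,
        (s'.cell 12 (ν.vertex x) ≠ 0 ↔ x ∈ (G.delete d).evenSet F) ∧
        (s'.cell 11 (ν.vertex x) ≠ 0 ↔ x ∈ (G.delete d).oddSet F)) := by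
  have : Nonempty (A ⊕ P) := ⟨d⟩
  have hFG : F ⊆ G.edges := hF.trans (fun e he => he.1)
  have hFf : F.Finite := G.edges_finite.subset hFG
  have hVG : ∀ {x}, x ∈ (G.delete d).vertices → x ∈ G.vertices := fun hx =>
    (RankInstance.mem_vertices_delete.1 hx).1
  -- the vertices that the search may mark as even and as odd
  set E : ℕ → Prop := fun v => ∃ x ∈ G.vertices, ν.vertex x = v ∧
    (x = d ∨ x ∈ (G.delete d).evenSet F) with hE
  set O : ℕ → Prop := fun v => ∃ x ∈ (G.delete d).vertices, ν.vertex x = v ∧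
    x ∈ (G.delete d).oddSet F with hO
  set Γ := ν.graph F hap hpo hNG hm with hΓdef
  have hE0 : ∀ v < Γ.n, Γ.mate v = 0 → E v := by
    intro v hv h0
    obtain ⟨x, hx, rfl⟩ := ν.exists_vertex hv
    have hxN := (hm.eq_zero_iff hx).1 h0
    refine ⟨x, hx, rfl, ?_⟩
    by_cases hxd : x = d
    · exact Or.inl hxd
    · exact Or.inr ⟨RankInstance.mem_vertices_delete.2 ⟨hx, hxd⟩, N, hN, hxN⟩
  refine Reaches.mono ((clearMarks_spec s).seq (T' := 70 * (G.numVertices + 1) +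
    100 * (G.numVertices + 2 * G.numEdges + 2)) ?_) (by rw [hn]; omega) fun s' h => h
  rintro s₁ ⟨hclear, hs₁⟩
  have hΓ₁ := hΓ.congr hs₁ (by simp)
  have hn₁ : s₁.reg 0 = G.numVertices := (hs₁.1 0 (by simp)).trans hn
  have hstart := (startFree_spec (Γ := Γ) (E := E) (O := O) hn₁ hΓ₁.mate
    (fun v hv => (hclear v (hn ▸ hv)).1) (fun v hv => (hclear v (hn ▸ hv)).2) hE0).frame
  rw [hn₁] at hstart
  refine hstart.seq ?_
  rintro s₂ ⟨⟨hinv, hptr⟩, hs₂⟩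
  have hΓ₂ := hΓ₁.congr hs₂ (by simp [startFree, Prog.forLoop, Prog.arrays])
  refine (searchLoop_spec hΓ₂ hinv hptr (fun v hv => hv.2) ?_ ?_).mono le_rfl ?_
  · rintro u y ⟨x, hx, rfl, hxE⟩ hadj
    obtain ⟨e, he, x', y', hj, hx', rfl⟩ := (CellNumbering.adj_iff hFG).1 hadj
    have hV := RankInstance.joins_mem_vertices (hF he) hj
    obtain rfl := ν.vertex_inj (hVG hV.1) hx hx'
    have hxd := (RankInstance.mem_vertices_delete.1 hV.1).2
    exact ⟨y', hV.2, rfl, x', hxE.resolve_left hxd, e, he, hj.symm⟩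
  · rintro y z hy ⟨x, hx, rfl, hxO⟩ hz
    obtain ⟨e, he, y', hj, rfl⟩ := (hm.eq_succ_iff (hVG hx)).1 hz
    have hV := RankInstance.joins_mem_vertices (hF (hN.1.1 he)) hj
    exact ⟨y', hVG hV.2, rfl, Or.inr (RankInstance.mem_evenSet_of_joins hF hN he hj hxO)⟩
  · rintro s' ⟨hinv', hgo, -⟩
    have hf : s'.search.found = 0 := by
      by_contra hf
      obtain ⟨b, p, q, -, -, -, hqp, hq0, hql⟩ :=
        hinv'.exists_augmentsFrom hFG hN.1 (fun v hv => hv.2) hf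
      exact hN.not_augmentsFrom hFf ⟨2 * b + 1, q, rfl, ⟨b, rfl⟩, hqp, hq0, hql, rfl⟩
    intro x hx
    have hxn : ν.vertex x < Γ.n := ν.vertex_lt (hVG hx)
    have hmark : ∀ k p, p 0 ∈ (G.delete d).vertices → ¬ Matched N (p 0) → IsAltPath F N k p →
        (Even k → s'.cell 12 (ν.vertex (p k)) ≠ 0) ∧
        (Odd k → s'.cell 11 (ν.vertex (p k)) ≠ 0) := fun k p h1 h2 h3 =>
      hinv'.marked_of_isAltPath hFG hgo hf h3
        ⟨ν.vertex_lt (hVG h1), (hm.eq_zero_iff (hVG h1)).2 h2⟩ le_rfl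
    refine ⟨⟨fun h => ?_, fun h => ?_⟩, fun h => ?_, fun h => ?_⟩
    · obtain ⟨k, hk, hkx⟩ := (hinv'.ev_iff _ hxn).1 h
      obtain ⟨y, hy, hyx, hyE⟩ := hinv'.queue_even k hk
      obtain rfl := ν.vertex_inj hy (hVG hx) (hyx.trans hkx)
      exact hyE.resolve_left (RankInstance.mem_vertices_delete.1 hx).2
    · obtain ⟨k, p, h1, h2, h3, rfl, hk⟩ := (RankInstance.isEven_iff hF hN).2 h
      exact (hmark k p h1 h2 h3).1 hk
    · obtain ⟨y, hy, hyx, hyO⟩ := hinv'.par_odd _ hxn h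
      exact ν.vertex_inj (hVG hy) (hVG hx) hyx ▸ hyO
    · obtain ⟨k, p, h1, h2, h3, rfl, hk⟩ := (RankInstance.isOdd_iff hF hN).2 h
      exact (hmark k p h1 h2 h3).2 hk

end Programs

/-! ### Recording the labels and the deletions -/

/-- Records the labels of the vertices that become odd or unreachable. -/
def labelVertices : Prog :=
  .forLoop 5 0
    (.ite (.eq (.cell 5 (.reg 5)) (.lit 0))
      (.ite (.eq (.cell 12 (.reg 5)) (.lit 0))
        (.seq (.setCell 5 (.reg 5) (.reg 4))
          (.ite (.eq (.cell 11 (.reg 5)) (.lit 0)) (.setCell 6 (.reg 5) (.lit 1))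
            (.setCell 6 (.reg 5) (.lit 0))))
        .skip)
      .skip)

theorem labelVertices_spec (s : Store) :
    Reaches labelVertices s (40 * (s.reg 0 + 1)) (fun s' =>
      (∀ k < s.reg 0, (s.cell 5 k = 0 ∧ s.cell 12 k = 0 → s'.cell 5 k = s.reg 4 ∧
          s'.cell 6 k = if s.cell 11 k = 0 then 1 else 0) ∧
        (¬ (s.cell 5 k = 0 ∧ s.cell 12 k = 0) →
          s'.cell 5 k = s.cell 5 k ∧ s'.cell 6 k = s.cell 6 k)) ∧
      s.AgreesOff [5] [5, 6] s') := by
  refine (Reaches.forEach (s := s) (by simp [Prog.LoopFree]) (by simp) (by simp [Prog.regs])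
    (by simp [Prog.regs]) (fun a k => if s.cell 5 k = 0 ∧ s.cell 12 k = 0 then
      (if a = 5 then s.reg 4 else if a = 6 then (if s.cell 11 k = 0 then 1 else 0) else s.cell a k)
      else s.cell a k) ?_).mono ?_ ?_
  · intro k hk s' hx hs' hc a j
    have r4 : s'.reg 4 = s.reg 4 := hs'.1 4 (by simp [Prog.regs])
    by_cases h5 : s.cell 5 k = 0
    · by_cases h12 : s.cell 12 k = 0
      · by_cases h11 : s.cell 11 k = 0 <;> by_cases ha : a = 5 <;> by_cases ha' : a = 6 <;>
        by_cases hj : j = k <;>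
        simp [Prog.run, Test.holds, Expr.eval, Store.cell_setCell, Store.reg_setCell, hx, hc, r4,
          h5, h12, h11, ha, ha', hj]
      · by_cases hj : j = k <;>
        simp [Prog.run, Test.holds, Expr.eval, hx, hc, h5, h12, hj]
    · by_cases hj : j = k <;> simp [Prog.run, Test.holds, Expr.eval, hx, hc, h5, hj]
  · refine Nat.mul_le_mul_right _ ?_
    simp [Prog.maxTime, Expr.cost, Test.cost]
  · rintro s' ⟨h1, h2⟩
    refine ⟨fun k hk => ⟨fun hc => ?_, fun hc => ?_⟩,
      h2.mono (by simp [Prog.regs]) (by simp [Prog.arrays])⟩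
    · simp [h1, hk, hc]
    · simp only [h1, if_pos hk, if_neg hc, and_self]

/-- Records the deletion of the edge in register 5: an edge of the graph of the stage is deleted if
it is useless, an edge of larger rank if it has an end-point that is not even. -/
def deleteEdge : Prog :=
  .ite (.eq (.cell 4 (.reg 5)) (.lit 0))
    (.ite (.lt (.cell 2 (.reg 5)) (.succ (.reg 4)))
      (.ite (.eq (.cell 11 (.cell 0 (.reg 5))) (.lit 0))
        (.ite (.eq (.cell 11 (.cell 1 (.reg 5))) (.lit 0)) .skip
          (.ite (.eq (.cell 12 (.cell 0 (.reg 5))) (.lit 0))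
            (.setCell 4 (.reg 5) (.reg 4)) .skip))
        (.ite (.eq (.cell 12 (.cell 1 (.reg 5))) (.lit 0)) (.setCell 4 (.reg 5) (.reg 4))
          (.ite (.eq (.cell 11 (.cell 1 (.reg 5))) (.lit 0)) .skip
            (.ite (.eq (.cell 12 (.cell 0 (.reg 5))) (.lit 0))
              (.setCell 4 (.reg 5) (.reg 4)) .skip))))
      (.ite (.eq (.cell 12 (.cell 0 (.reg 5))) (.lit 0)) (.setCell 4 (.reg 5) (.reg 4))
        (.ite (.eq (.cell 12 (.cell 1 (.reg 5))) (.lit 0)) (.setCell 4 (.reg 5) (.reg 4))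
          .skip)))
    .skip

/-- The condition on the labels under which the edge `k` is deleted. -/
def Store.Deletes (s : Store) (k : ℕ) : Prop :=
  (s.cell 2 k ≤ s.reg 4 ∧
    ((s.cell 11 (s.cell 0 k) ≠ 0 ∧ s.cell 12 (s.cell 1 k) = 0) ∨
      (s.cell 11 (s.cell 1 k) ≠ 0 ∧ s.cell 12 (s.cell 0 k) = 0))) ∨
  (s.reg 4 < s.cell 2 k ∧ (s.cell 12 (s.cell 0 k) = 0 ∨ s.cell 12 (s.cell 1 k) = 0))

open Classical in
theorem run_deleteEdge (s : Store) : deleteEdge.run s =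
    if s.cell 4 (s.reg 5) = 0 ∧ s.Deletes (s.reg 5) then s.setCell 4 (s.reg 5) (s.reg 4)
    else s := by
  by_cases h4 : s.cell 4 (s.reg 5) = 0
  · by_cases ha : s.cell 11 (s.cell 0 (s.reg 5)) = 0 <;>
    by_cases hp : s.cell 11 (s.cell 1 (s.reg 5)) = 0 <;>
    by_cases ha' : s.cell 12 (s.cell 0 (s.reg 5)) = 0 <;>
    by_cases hp' : s.cell 12 (s.cell 1 (s.reg 5)) = 0 <;>
    rcases Nat.lt_or_ge (s.reg 4) (s.cell 2 (s.reg 5)) with h2 | h2 <;>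
    simp [deleteEdge, Store.Deletes, Prog.run, Test.holds, Expr.eval, h4, h2, ha, hp, ha', hp',
      Nat.not_lt.2, Nat.not_le.2]
  · simp [deleteEdge, Prog.run, Test.holds, Expr.eval, h4]

/-- Records the deletions of a stage. -/
def deleteEdges : Prog := .forLoop 5 1 deleteEdge

open Classical in
theorem deleteEdges_spec (s : Store) :
    Reaches deleteEdges s (80 * (s.reg 1 + 1)) (fun s' =>
      (∀ k < s.reg 1, s'.cell 4 k = if s.cell 4 k = 0 ∧ s.Deletes k then s.reg 4 else s.cell 4 k) ∧
      s.AgreesOff [5] [4] s') := by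
  refine (Reaches.forEach (s := s) (by simp [Prog.LoopFree, deleteEdge]) (by simp)
    (by simp [Prog.regs, deleteEdge]) (by simp [Prog.regs, deleteEdge]) (fun a k => if a = 4 then
      (if s.cell 4 k = 0 ∧ s.Deletes k then s.reg 4 else s.cell 4 k) else s.cell a k) ?_).mono ?_ ?_
  · intro k hk s' hx hs' hc a j
    have r4 : s'.reg 4 = s.reg 4 := hs'.1 4 (by simp [Prog.regs, deleteEdge])
    have hdel : s'.Deletes k ↔ s.Deletes k := by
      simp only [Store.Deletes, r4, hc, hs'.2 11 (by simp [Prog.arrays, deleteEdge]),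
        hs'.2 12 (by simp [Prog.arrays, deleteEdge])]
    rw [run_deleteEdge, hx, hc, hdel, r4]
    by_cases hcond : s.cell 4 k = 0 ∧ s.Deletes k
    · rw [if_pos hcond, if_pos hcond, Store.cell_setCell]
      by_cases hj : j = k <;> by_cases ha : a = 4 <;> simp [hj, ha, hc]
    · rw [if_neg hcond, if_neg hcond]
      by_cases hj : j = k <;> by_cases ha : a = 4 <;> simp [hj, ha, hc]
  · refine Nat.mul_le_mul_right _ ?_
    simp [deleteEdge, Prog.maxTime, Expr.cost, Test.cost]
  · rintro s' ⟨h1, h2⟩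
    exact ⟨fun k hk => by rw [h1, if_pos hk, if_pos rfl],
      h2.mono (by simp [Prog.regs, deleteEdge]) (by simp [Prog.arrays, deleteEdge])⟩

/-- Marks the edges of the matching in array 3. -/
def markMatching : Prog :=
  .forLoop 5 1
    (.ite (.eq (.cell 10 (.cell 0 (.reg 5))) (.succ (.cell 1 (.reg 5))))
      (.setCell 3 (.reg 5) (.lit 1)) (.setCell 3 (.reg 5) (.lit 0)))

theorem markMatching_spec (s : Store) :
    Reaches markMatching s (30 * (s.reg 1 + 1)) (fun s' =>
      (∀ k < s.reg 1, s'.cell 3 k = if s.cell 10 (s.cell 0 k) = s.cell 1 k + 1 then 1 else 0) ∧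
      s.AgreesOff [5] [3] s') := by
  refine (Reaches.forEach (s := s) (by simp [Prog.LoopFree]) (by simp) (by simp [Prog.regs])
    (by simp [Prog.regs]) (fun a k => if a = 3 then
      (if s.cell 10 (s.cell 0 k) = s.cell 1 k + 1 then 1 else 0) else s.cell a k) ?_).mono ?_ ?_
  · intro k hk s' hx hs' hc a j
    have e10 : s'.cell 10 = s.cell 10 := hs'.2 10 (by simp [Prog.arrays])
    by_cases h : s.cell 10 (s.cell 0 k) = s.cell 1 k + 1 <;>
    by_cases ha : a = 3 <;> by_cases hj : j = k <;>
    simp [Prog.run, Test.holds, Expr.eval, Store.cell_setCell, hx, hc, e10, h, ha, hj]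
  · refine Nat.mul_le_mul_right _ ?_
    simp [Prog.maxTime, Expr.cost, Test.cost]
  · rintro s' ⟨h1, h2⟩
    exact ⟨fun k hk => by rw [h1, if_pos hk, if_pos rfl],
      h2.mono (by simp [Prog.regs]) (by simp [Prog.arrays])⟩

/-! ### The program for a stage -/

/-- A stage of the vertex-deletion algorithm. -/
def stageProgram : Prog :=
  .seq (.setReg 4 (.succ (.reg 4))) (.seq clearHeads (.seq buildLists (.seq carryEdges
    (.seq findLost (.seq clearMarks (.seq augmentLost (.seq computeLabels
      (.seq labelVertices deleteEdges))))))))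

section Programs

variable {A : Type u} {P : Type v} {G : RankInstance A P} {ν : CellNumbering G} {r i : ℕ}
  {d : A ⊕ P} {s s' : Store} {M L N F : Set (A × P)}

/-- The memory after `i` stages, where `L` is the current matching. The cells of edges and vertices
tell how they have fared in the stages so far; the edges incident to `d` are marked as deleted. -/
structure StageInv (ν : CellNumbering G) (r : ℕ) (M : Set (A × P)) (d : A ⊕ P) (i : ℕ)
    (L : Set (A × P)) (s : Store) : Prop where
  holds : s.HoldsInstance ν r d
  marks : s.HoldsMarks ν M
  stage : s.reg 4 = i
  mate : MateArray ν (s.cell 10) L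
  incident : ∀ e ∈ G.edges, Incident e d → s.cell 4 (ν.edge e) ≠ 0
  edge : ∀ e ∈ (G.delete d).edges, (s.cell 4 (ν.edge e) = 0 ∧ e ∈ (G.delete d).alive i) ∨
    ∃ k < i, s.cell 4 (ν.edge e) = k + 1 ∧ e ∈ (G.delete d).alive k ∧
      e ∉ (G.delete d).alive (k + 1)
  vertex : ∀ x ∈ (G.delete d).vertices,
    (s.cell 5 (ν.vertex x) = 0 ∧ x ∉ (G.delete d).closedSet i) ∨
    ∃ k < i, s.cell 5 (ν.vertex x) = k + 1 ∧ x ∉ (G.delete d).closedSet k ∧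
      x ∈ (G.delete d).blockedSet ((G.delete d).stageGraph (k + 1)) ∧
      (x ∈ (G.delete d).oddSet ((G.delete d).stageGraph (k + 1)) → s.cell 6 (ν.vertex x) = 0) ∧
      (x ∉ (G.delete d).oddSet ((G.delete d).stageGraph (k + 1)) → s.cell 6 (ν.vertex x) = 1)

/-- The edges that take part in the next stage. -/
theorem StageInv.mem_stageGraph_iff (h : StageInv ν r M d i L s) {k : ℕ} (hk : k < G.numEdges) :
    (∃ e ∈ (G.delete d).stageGraph (i + 1), ν.edge e = k) ↔
      s.cell 4 k = 0 ∧ s.cell 2 k ≤ i + 1 := by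
  obtain ⟨e, he, rfl⟩ := ν.exists_edge hk
  rw [h.holds.rank e he]
  constructor
  · rintro ⟨f, ⟨hf, hr⟩, hfe⟩
    have hfE := RankInstance.alive_subset_edges hf
    obtain rfl := ν.edge_inj hfE.1 he hfe
    refine ⟨?_, hr⟩
    rcases h.edge f hfE with h0 | ⟨j, hj, -, -, hn⟩
    · exact h0.1
    · exact absurd (RankInstance.alive_anti hj hf) hn
  · rintro ⟨h4, hr⟩
    refine ⟨e, ⟨?_, hr⟩, rfl⟩
    rcases h.edge e ⟨he, fun hd => h.incident e he hd h4⟩ with h0 | ⟨j, hj, h0, -⟩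
    · exact h0.2
    · omega

theorem mem_uselessSet_iff {I : RankInstance A P} {e : A × P} : e ∈ I.uselessSet F ↔
    (Sum.inl e.1 ∈ I.oddSet F ∧ Sum.inr e.2 ∈ I.blockedSet F) ∨
      (Sum.inr e.2 ∈ I.oddSet F ∧ Sum.inl e.1 ∈ I.blockedSet F) := by
  constructor
  · rintro ⟨x, y, ⟨rfl, rfl⟩ | ⟨rfl, rfl⟩, hx, hy⟩
    · exact Or.inl ⟨hx, hy⟩
    · exact Or.inr ⟨hx, hy⟩
  · rintro (⟨hx, hy⟩ | ⟨hx, hy⟩)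
    · exact ⟨_, _, joins_mk e, hx, hy⟩
    · exact ⟨_, _, (joins_mk e).symm, hx, hy⟩

/-- The last two loops of a stage turn the marks of the search into labels and deletions. -/
theorem StageInv.update (h : StageInv ν r M d i L s) {s₁ s₂ s₃ : Store}
    (hs₁ : (s.setReg 4 (i + 1)).AgreesOff [5, 6, 7, 8, 9, 10, 11, 12, 14] [7, 8, 9, 10, 11, 12, 13]
      s₁)
    (hmate : MateArray ν (s₁.cell 10) N)
    (hlab : ∀ x ∈ (G.delete d).vertices,
      (s₁.cell 12 (ν.vertex x) ≠ 0 ↔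
        x ∈ (G.delete d).evenSet ((G.delete d).stageGraph (i + 1))) ∧
      (s₁.cell 11 (ν.vertex x) ≠ 0 ↔ x ∈ (G.delete d).oddSet ((G.delete d).stageGraph (i + 1))))
    (h₂ : ∀ k < s₁.reg 0, (s₁.cell 5 k = 0 ∧ s₁.cell 12 k = 0 → s₂.cell 5 k = s₁.reg 4 ∧
        s₂.cell 6 k = if s₁.cell 11 k = 0 then 1 else 0) ∧
      (¬ (s₁.cell 5 k = 0 ∧ s₁.cell 12 k = 0) →
        s₂.cell 5 k = s₁.cell 5 k ∧ s₂.cell 6 k = s₁.cell 6 k))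
    (hs₂ : s₁.AgreesOff [5] [5, 6] s₂)
    (h₃ : ∀ k < s₂.reg 1, open Classical in
      s₃.cell 4 k = if s₂.cell 4 k = 0 ∧ s₂.Deletes k then s₂.reg 4 else s₂.cell 4 k)
    (hs₃ : s₂.AgreesOff [5] [4] s₃) : StageInv ν r M d (i + 1) N s₃ := by
  have hset : s.AgreesOff [4] [] (s.setReg 4 (i + 1)) :=
    ⟨fun x hx => by
      rw [Store.reg_setReg, if_neg]
      rintro rfl
      simp at hx, fun _ _ => rfl⟩
  have c₁ : ∀ a ∈ [0, 1, 2, 3, 4, 5, 6], s₁.cell a = s.cell a := fun a ha =>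
    hs₁.2 a (by fin_cases ha <;> simp)
  have hall : s.AgreesOff [4, 5, 6, 7, 8, 9, 10, 11, 12, 14] [4, 5, 6, 7, 8, 9, 10, 11, 12, 13]
      s₃ :=
    (((hset.mono (by simp) (by simp)).trans (hs₁.mono (by simp) (by simp))).trans
      (hs₂.mono (by simp) (by simp))).trans (hs₃.mono (by simp) (by simp))
  have hall₂ : s.AgreesOff [4, 5, 6, 7, 8, 9, 10, 11, 12, 14] [5, 6, 7, 8, 9, 10, 11, 12, 13] s₂ :=
    ((hset.mono (by simp) (by simp)).trans (hs₁.mono (by simp) (by simp))).trans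
      (hs₂.mono (by simp) (by simp))
  have r4₁ : s₁.reg 4 = i + 1 := by
    rw [hs₁.1 4 (by simp)]
    simp [Store.reg_setReg]
  have r4₂ : s₂.reg 4 = i + 1 := (hs₂.1 4 (by simp)).trans r4₁
  have r4₃ : s₃.reg 4 = i + 1 := (hs₃.1 4 (by simp)).trans r4₂
  have hVG : ∀ {x}, x ∈ (G.delete d).vertices → ν.vertex x < s₁.reg 0 := fun hx => by
    rw [hs₁.1 0 (by simp), hset.1 0 (by simp), h.holds.numVertices]
    exact ν.vertex_lt (RankInstance.mem_vertices_delete.1 hx).1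
  have hEG : ∀ {e}, e ∈ G.edges → ν.edge e < s₂.reg 1 := fun he => by
    rw [hall₂.1 1 (by simp), h.holds.numEdges]
    exact ν.edge_lt he
  refine ⟨h.holds.congr hall (by simp) (by simp), h.marks.congr hall (by simp), r4₃, ?_, ?_, ?_, ?_⟩
  · rwa [hs₃.2 10 (by simp), hs₂.2 10 (by simp)]
  · intro e he hd
    have := h.incident e he hd
    have h4 : s₂.cell 4 (ν.edge e) ≠ 0 := by rwa [hall₂.2 4 (by simp)]
    rw [h₃ _ (hEG he), if_neg fun hc => h4 hc.1]
    exact h4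
  · intro e he
    have hV := RankInstance.joins_mem_vertices he (joins_mk e)
    have h4 : s₂.cell 4 (ν.edge e) = s.cell 4 (ν.edge e) := by rw [hall₂.2 4 (by simp)]
    rw [h₃ _ (hEG he.1), h4, r4₂]
    rcases h.edge e he with ⟨h0, hal⟩ | ⟨k, hk, h0, hal⟩
    · have hdel : s₂.Deletes (ν.edge e) ↔ e ∉ (G.delete d).alive (i + 1) := by
        have e0 := h.holds.applicant e he.1
        have e1 := h.holds.post e he.1
        have e2 := h.holds.rank e he.1
        rw [← hall₂.2 0 (by simp)] at e0
        rw [← hall₂.2 1 (by simp)] at e1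
        rw [← hall₂.2 2 (by simp)] at e2
        have hbl : ∀ x ∈ (G.delete d).vertices, (s₂.cell 12 (ν.vertex x) = 0 ↔
            x ∈ (G.delete d).blockedSet ((G.delete d).stageGraph (i + 1))) := by
          intro x hx
          rw [hs₂.2 12 (by simp), ← not_iff_not, RankInstance.blockedSet, Set.mem_sdiff]
          have := (hlab x hx).1
          tauto
        have hod : ∀ x ∈ (G.delete d).vertices, (s₂.cell 11 (ν.vertex x) ≠ 0 ↔
            x ∈ (G.delete d).oddSet ((G.delete d).stageGraph (i + 1))) := by
          intro x hx
          rw [hs₂.2 11 (by simp)]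
          exact (hlab x hx).2
        rw [Store.Deletes, e0, e1, e2, r4₂, hbl _ hV.1, hbl _ hV.2, hod _ hV.1, hod _ hV.2,
          ← mem_uselessSet_iff, RankInstance.mem_alive_succ]
        have hor : (∀ x, Incident e x →
            x ∉ (G.delete d).blockedSet ((G.delete d).stageGraph (i + 1))) ↔
            ¬ (Sum.inl e.1 ∈ (G.delete d).blockedSet ((G.delete d).stageGraph (i + 1)) ∨
              Sum.inr e.2 ∈ (G.delete d).blockedSet ((G.delete d).stageGraph (i + 1))) := by
          constructor
          · rintro hx (hc | hc)
            · exact hx _ (Or.inl rfl) hc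
            · exact hx _ (Or.inr rfl) hc
          · rintro hc x (rfl | rfl) hx
            · exact hc (Or.inl hx)
            · exact hc (Or.inr hx)
        rw [hor]
        change (G.rank e ≤ i + 1 ∧ _) ∨ (i + 1 < G.rank e ∧ _) ↔
          ¬ (_ ∧ (G.rank e ≤ i + 1 → _) ∧ (i + 1 < G.rank e → _))
        by_cases hr : G.rank e ≤ i + 1
        · simp [hr, hal, Nat.not_lt.2 hr]
        · simp [hr, hal, Nat.lt_of_not_le hr, or_iff_not_imp_left]
      by_cases hc : e ∈ (G.delete d).alive (i + 1)
      · exact Or.inl ⟨by rw [if_neg fun hc' => hdel.1 hc'.2 hc, h0], hc⟩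
      · exact Or.inr ⟨i, Nat.lt_succ_self i, by rw [if_pos ⟨h0, hdel.2 hc⟩], hal, hc⟩
    · refine Or.inr ⟨k, hk.trans (Nat.lt_succ_self i), ?_, hal⟩
      rw [if_neg fun hc => by omega, h0]
  · intro x hx
    obtain ⟨hpos, hneg⟩ := h₂ _ (hVG hx)
    rw [hs₃.2 5 (by simp), hs₃.2 6 (by simp)]
    rw [c₁ 5 (by simp), r4₁] at hpos
    rw [c₁ 5 (by simp), c₁ 6 (by simp)] at hneg
    rcases h.vertex x hx with ⟨h0, hcl⟩ | ⟨k, hk, h0, hcl, hb, hodd, hun⟩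
    · by_cases hev : s₁.cell 12 (ν.vertex x) = 0
      · obtain ⟨e5, e6⟩ := hpos ⟨h0, hev⟩
        refine Or.inr ⟨i, Nat.lt_succ_self i, e5, hcl,
          ⟨hx, fun hc => (hlab x hx).1.2 hc hev⟩, fun ho => ?_, fun ho => ?_⟩
        · rw [e6, if_neg ((hlab x hx).2.2 ho)]
        · rw [e6, if_pos (not_not.1 (mt (hlab x hx).2.1 ho))]
      · refine Or.inl ⟨(hneg fun hc => hev hc.2).1.trans h0, fun hc => ?_⟩
        rcases RankInstance.mem_closedSet_succ.1 hc with hc | hc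
        · exact hcl hc
        · exact hc.2 ((hlab x hx).1.1 hev)
    · obtain ⟨e5, e6⟩ := hneg fun hc => by omega
      exact Or.inr ⟨k, hk.trans (Nat.lt_succ_self i), e5.trans h0, hcl, hb,
        fun ho => e6.trans (hodd ho), fun ho => e6.trans (hun ho)⟩

/-- A stage of the program performs a stage of the algorithm, in linear time. -/
theorem stageProgram_spec (hM : G.RankMaximal M) (hd : d ∈ G.vertices)
    (hL : G.DeletionState M d i L) (h : StageInv ν r M d i L s) :
    Reaches stageProgram s (2000 * (G.numVertices + G.numEdges + 1)) (fun s' =>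
      ∃ N, G.DeletionStep M d (i + 1) L N ∧ StageInv ν r M d (i + 1) N s') := by
  have : Nonempty (A ⊕ P) := ⟨d⟩
  have hFH : (G.delete d).stageGraph (i + 1) ⊆ (G.delete d).edges :=
    RankInstance.stageGraph_subset_edges
  have hFG : (G.delete d).stageGraph (i + 1) ⊆ G.edges := fun e he => (hFH he).1
  have hC := RankInstance.isMatching_carry hM hL
  have hCG : G.carry M d L (i + 1) ⊆ G.edges := hC.1.trans hFG
  have hLG : L ⊆ G.edges := Set.subset_union_left.trans hCG
  have hap := h.holds.applicant
  have hpo := h.holds.post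
  set X := G.numVertices + G.numEdges + 1 with hX
  set s₀ := s.setReg 4 (i + 1) with hs₀
  have hset : s.AgreesOff [4] [] s₀ := ⟨fun x hx => by
      rw [hs₀, Store.reg_setReg, if_neg]
      rintro rfl
      simp at hx, fun _ _ => rfl⟩
  have r4 : s₀.reg 4 = i + 1 := by simp [hs₀, Store.reg_setReg]
  have inst₀ := h.holds.congr hset (by simp) (by simp)
  have marks₀ := h.marks.congr hset (by simp)
  have hinst : ∀ {s'}, s₀.AgreesOff [5, 6, 7, 8, 9, 10, 11, 12, 14] [7, 8, 9, 10, 11, 12, 13] s' →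
      s'.HoldsInstance ν r d ∧ s'.HoldsMarks ν M ∧ s'.reg 4 = i + 1 := fun hs' =>
    ⟨inst₀.congr hs' (by simp) (by simp), marks₀.congr hs' (by simp),
      (hs'.1 4 (by simp)).trans r4⟩
  have hfirst : Reaches (.setReg 4 (.succ (.reg 4))) s 3 (fun s' => s' = s₀) := by
    refine (Reaches.of_loopFree (by trivial) ?_).mono (by simp [Prog.maxTime, Expr.cost])
      fun s' h => h
    simp [Prog.run, Expr.eval, h.stage, hs₀]
  refine Reaches.mono (hfirst.seq (T' := 1900 * X) ?_) (by omega) fun s' h => h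
  rintro _ rfl
  -- the adjacency lists
  have hA := clearHeads_spec s₀
  rw [inst₀.numVertices] at hA
  refine Reaches.mono (hA.seq (T' := 1800 * X) ?_) (by omega) fun s' h => h
  rintro s₁ ⟨hheads, hs₁⟩
  have hs₁' := hs₁.mono (R' := [5, 6, 7, 8, 9, 10, 11, 12, 14]) (B' := [7, 8, 9, 10, 11, 12, 13])
    (by simp) (by simp)
  obtain ⟨inst₁, -, r4₁⟩ := hinst hs₁'
  have hB := buildLists_spec (s := s₁) (n := G.numVertices) (ap := s.cell 0) (po := s.cell 1)
    (active := fun k => ∃ e ∈ (G.delete d).stageGraph (i + 1), ν.edge e = k)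
  rw [inst₁.numEdges, hs₁.2 0 (by simp), hs₁.2 1 (by simp), hs₁.2 2 (by simp), hs₁.2 4 (by simp),
    r4₁] at hB
  have hends : ∀ k < G.numEdges, s.cell 0 k ≠ s.cell 1 k ∧ s.cell 0 k < G.numVertices ∧
      s.cell 1 k < G.numVertices := by
    intro k hk
    obtain ⟨e, he, rfl⟩ := ν.exists_edge hk
    have hV := RankInstance.joins_mem_vertices he (joins_mk e)
    rw [hap e he, hpo e he]
    exact ⟨fun hc => (joins_mk e).ne (ν.vertex_inj hV.1 hV.2 hc), ν.vertex_lt hV.1,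
      ν.vertex_lt hV.2⟩
  refine Reaches.mono ((hB hheads (fun _ _ => rfl) (fun _ _ => rfl) (fun k hk => (hends k hk).1)
    (fun k hk => (hends k hk).2.1) (fun k hk => (hends k hk).2.2)
    fun k hk => h.mem_stageGraph_iff hk).seq (T' := 1700 * X) ?_) (by omega) fun s' h => h
  rintro s₂ ⟨⟨hhead, hlink⟩, hs₂⟩
  have hs₂' := hs₁'.trans (hs₂.mono (by simp) (by simp))
  obtain ⟨inst₂, marks₂, r4₂⟩ := hinst hs₂'
  have hgraph : ∀ {s' N}, s₂.AgreesOff [5, 6, 7, 8, 9, 10, 11, 12, 14] [10, 11, 12, 13] s' →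
      ∀ (hN : N ⊆ G.edges) (hm : MateArray ν (s'.cell 10) N), s'.HoldsGraph
        (ν.graph ((G.delete d).stageGraph (i + 1)) hap hpo hN hm) := by
    intro s' N hs' hN hm
    refine ⟨fun e _ => ?_, fun e _ => ?_, fun _ _ => rfl, ?_, fun e he hact => ?_,
      fun e he hact => ?_⟩
    · rw [hs'.2 0 (by simp), hs₂'.2 0 (by simp)]
      rfl
    · rw [hs'.2 1 (by simp), hs₂'.2 1 (by simp)]
      rfl
    · rw [hs'.2 7 (by simp)]
      exact hhead
    · rw [hs'.2 8 (by simp)]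
      exact (hlink e he hact).1
    · rw [hs'.2 9 (by simp)]
      exact (hlink e he hact).2
  -- the matching at the beginning of the stage
  have hmate₂ : MateArray ν (s₂.cell 10) L := by
    rw [hs₂.2 10 (by simp), hs₁.2 10 (by simp)]
    exact h.mate
  have hcarry := carryEdges_spec inst₂ hd marks₂ hM.1 hLG hmate₂
  rw [inst₂.numEdges, r4₂] at hcarry
  refine Reaches.mono (hcarry.seq (T' := 1600 * X) ?_) (by omega) fun s' h => h
  rintro s₃ ⟨hmate₃, hs₃⟩
  have hs₃' := hs₂'.trans (hs₃.mono (by simp) (by simp))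
  obtain ⟨inst₃, marks₃, r4₃⟩ := hinst hs₃'
  have hlost := findLost_spec (L := L) inst₃ hd marks₃ hM.1.1 (by rwa [r4₃])
  rw [inst₃.numEdges, r4₃] at hlost
  refine Reaches.mono (hlost.seq (T' := 1500 * X) ?_) (by omega) fun s' h => h
  rintro s₄ ⟨hlost, hs₄⟩
  have hs₄' := hs₃'.trans (hs₄.mono (by simp) (by simp))
  obtain ⟨inst₄, -, -⟩ := hinst hs₄'
  -- the augmentation
  have hclear := clearMarks_spec s₄
  rw [inst₄.numVertices] at hclear
  refine Reaches.mono (hclear.seq (T' := 1400 * X) ?_) (by omega) fun s' h => h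
  rintro s₅ ⟨hmarks, hs₅⟩
  have hs₅' := hs₄'.trans (hs₅.mono (by simp) (by simp))
  have hs₂₅ : s₂.AgreesOff [5, 6, 7, 8, 9, 10, 11, 12, 14] [10, 11, 12, 13] s₅ :=
    ((hs₃.mono (by simp) (by simp)).trans (hs₄.mono (by simp) (by simp))).trans
      (hs₅.mono (by simp) (by simp))
  have hmate₅ : MateArray ν (s₅.cell 10) (G.carry M d L (i + 1)) := by
    rw [hs₅.2 10 (by simp), hs₄.2 10 (by simp)]
    exact hmate₃
  have r11 : s₅.reg 11 = s₄.reg 11 := hs₅.1 11 (by simp)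
  have hΓ₅ := hgraph hs₂₅ hCG hmate₅
  refine Reaches.mono ((augmentLost_spec hFG hC hΓ₅ (fun v hv => (hmarks v hv).1)
    (fun v hv => (hmarks v hv).2) ?_).frame.seq (T' := 900 * X) ?_) (by omega) fun s' h => h
  · rw [r11]
    rcases hlost with hl | ⟨x, hx, hl⟩
    · exact Or.inl hl.1
    · exact Or.inr ⟨x, (RankInstance.mem_vertices_delete.1 hx.1).1, hx.2.2, hl⟩
  rintro s₆ ⟨⟨hnone, hsome⟩, hs₆⟩
  have hs₆'' : s₅.AgreesOff [5, 6, 7, 8, 9, 10, 11, 12, 14] [10, 11, 12, 13] s₆ :=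
    hs₆.mono (by simp [augmentLost, startLost, searchLoop, searchBody, augmentLoop, Prog.regs])
      (by simp [augmentLost, startLost, searchLoop, searchBody, augmentLoop, Prog.arrays])
  have hs₆' := hs₅'.trans (hs₆''.mono (by simp) (by simp))
  obtain ⟨N, hstep, hmate₆⟩ : ∃ N, G.DeletionStep M d (i + 1) L N ∧
      MateArray ν (s₆.cell 10) N := by
    rw [r11] at hnone hsome
    -- at most one vertex is lost
    have huniq : ∀ x ∈ G.lost M d L (i + 1), ∀ y ∈ G.lost M d L (i + 1), y = x := by
      intro x hx y hy
      rcases RankInstance.carry_cases hM hL with ⟨-, hc⟩ | ⟨-, ⟨z, hz⟩ | ⟨z, hz⟩⟩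
      · exact absurd (hc ▸ hx.2.1) hx.2.2
      · rw [RankInstance.lost_eq_singleton hM hz] at hx hy
        rw [Set.mem_singleton_iff.1 hx, Set.mem_singleton_iff.1 hy]
      · exact absurd ((hz.2.2 x).2 (Or.inl ⟨hx.2.1,
          (RankInstance.mem_vertices_delete.1 hx.1).2⟩)) hx.2.2
    rcases hlost with ⟨h0, hempty⟩ | ⟨x, hx, h0⟩
    · refine ⟨_, Or.inr ⟨?_, rfl⟩, hnone h0⟩
      rintro ⟨x, hx, -⟩
      rw [hempty] at hx
      exact hx
    · rcases hsome x (RankInstance.mem_vertices_delete.1 hx.1).1 h0 with ⟨N, hN, hm⟩ | ⟨hN, hm⟩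
      · exact ⟨N, Or.inl ⟨x, hx, hN⟩, hm⟩
      · refine ⟨_, Or.inr ⟨?_, rfl⟩, hm⟩
        rintro ⟨y, hy, hN'⟩
        exact hN (huniq x hx y hy ▸ hN')
  -- the labels
  have hNmax := (hL.step hM hstep).1.maximum
  have hΓ₆ := hgraph (hs₂₅.trans hs₆'') (hNmax.1.1.trans hFG) hmate₆
  refine Reaches.mono ((computeLabels_spec hFH hNmax hΓ₆ (hinst hs₆').1.numVertices).frame.seq
    (T' := 300 * X) ?_) (by omega) fun s' h => h
  rintro s₇ ⟨hlab, hs₇⟩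
  have hs₇'' : s₆.AgreesOff [5, 6, 7, 8, 9, 10, 11, 12, 14] [11, 12, 13] s₇ :=
    hs₇.mono (by simp [computeLabels, clearMarks, startFree, searchLoop, searchBody, Prog.forLoop,
        Prog.regs])
      (by simp [computeLabels, clearMarks, startFree, searchLoop, searchBody, Prog.forLoop,
        Prog.arrays])
  have hs₇' := hs₆'.trans (hs₇''.mono (by simp) (by simp))
  obtain ⟨inst₇, -, -⟩ := hinst hs₇'
  have hlabel := labelVertices_spec s₇
  rw [inst₇.numVertices] at hlabel
  refine Reaches.mono (hlabel.seq (T' := 200 * X) ?_) (by omega) fun s' h => h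
  rintro s₈ ⟨hl₈, hs₈⟩
  have inst₈ := inst₇.congr hs₈ (by simp) (by simp)
  have hdelete := deleteEdges_spec s₈
  rw [inst₈.numEdges] at hdelete
  refine hdelete.mono (by omega) ?_
  rintro s₉ ⟨hl₉, hs₉⟩
  refine ⟨N, hstep, h.update hs₇' ?_ hlab ?_ hs₈ ?_ hs₉⟩
  · rw [hs₇''.2 10 (by simp)]
    exact hmate₆
  · rw [inst₇.numVertices]
    exact hl₈
  · rw [inst₈.numEdges]
    exact hl₉

end Programs

/-! ### The stored information -/

section StoredInformation

variable {A : Type u} {P : Type v} {I : RankInstance A P} {r k : ℕ} {t : Trace A P}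

namespace RankInstance

theorem edgeStage_eq_zero (ht : ∀ k, 1 ≤ k → k ≤ r → I.FollowsAt t k ∧ t.red k = I.reducedGraph k)
    {e : A × P} (h : e ∈ I.alive r) : I.edgeStage r t e = 0 ∧
      ∀ k, 1 ≤ k → k ≤ r → ¬ ((k < I.rank e ∧ ∃ x, Incident e x ∧ I.BlockedAt t k x) ∨
        (I.rank e ≤ k ∧ e ∉ t.red k)) := by
  have hno : ∀ k, 1 ≤ k → k ≤ r → ¬ ((k < I.rank e ∧ ∃ x, Incident e x ∧ I.BlockedAt t k x) ∨
      (I.rank e ≤ k ∧ e ∉ t.red k)) := by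
    intro k h1 h2
    have hal := alive_anti h2 h
    rintro (⟨hr, x, hx, hb⟩ | ⟨hr, hred⟩)
    · obtain ⟨k, rfl⟩ : ∃ l, k = l + 1 := ⟨k - 1, by omega⟩
      exact (mem_alive_succ.1 hal).2.2 hr x hx ((ht _ h1 h2).1.blockedAt_iff.1 hb)
    · rw [(ht k h1 h2).2] at hred
      exact hred ⟨hal, hr⟩
  refine ⟨?_, hno⟩
  rw [edgeStage, Set.eq_empty_of_forall_notMem (s := {k | _}) fun k hk => hno k hk.1 hk.2.1 hk.2.2,
    Nat.sInf_empty]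

theorem edgeStage_eq_succ (ht : ∀ k, 1 ≤ k → k ≤ r → I.FollowsAt t k ∧ t.red k = I.reducedGraph k)
    (hk : k < r) {e : A × P} (h : e ∈ I.alive k) (h' : e ∉ I.alive (k + 1)) :
    I.edgeStage r t e = k + 1 := by
  refine IsLeast.csInf_eq ⟨⟨Nat.succ_pos k, hk, ?_⟩, fun j hj => ?_⟩
  · rw [(ht (k + 1) (Nat.succ_pos k) hk).2]
    by_cases hr : I.rank e ≤ k + 1
    · exact Or.inr ⟨hr, fun hc => h' hc.1⟩
    · refine Or.inl ⟨by omega, ?_⟩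
      by_contra! hc
      refine h' (mem_alive_succ.2 ⟨h, fun hc' => absurd hc' hr, fun _ x hx hb => hc x hx ?_⟩)
      exact (ht (k + 1) (Nat.succ_pos k) hk).1.blockedAt_iff.2 hb
  · by_contra! hlt
    exact (edgeStage_eq_zero (fun i h1 h2 => ht i h1 (by omega)) h).2 j hj.1 (by omega) hj.2.2

theorem vertexStage_eq_zero (ht : ∀ k, 1 ≤ k → k ≤ r → I.FollowsAt t k) {x : A ⊕ P}
    (h : x ∉ I.closedSet r) : I.vertexStage r t x = 0 := by
  rw [vertexStage, Set.eq_empty_of_forall_notMem (s := {k | _}) fun k hk => h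
    ⟨k, hk.1, hk.2.1, (ht k hk.1 hk.2.1).blockedAt_iff.1 hk.2.2⟩, Nat.sInf_empty]

theorem vertexStage_eq_succ (ht : ∀ k, 1 ≤ k → k ≤ r → I.FollowsAt t k) (hk : k < r) {x : A ⊕ P}
    (h : x ∉ I.closedSet k) (h' : x ∈ I.blockedSet (I.stageGraph (k + 1))) :
    I.vertexStage r t x = k + 1 := by
  refine IsLeast.csInf_eq ⟨⟨Nat.succ_pos k, hk,
    (ht (k + 1) (Nat.succ_pos k) hk).blockedAt_iff.2 h'⟩, fun j hj => ?_⟩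
  by_contra! hlt
  exact h ⟨j, hj.1, by omega, (ht j hj.1 hj.2.1).blockedAt_iff.1 hj.2.2⟩

end RankInstance

end StoredInformation

/-! ### The whole program -/

/-- The program for the deletion of a vertex. -/
def deletionProgram : Prog :=
  .seq initEdges (.seq initVertices (.seq (.setReg 4 (.lit 0))
    (.seq (.loop (.lt (.reg 4) (.reg 2)) stageProgram) markMatching)))

section Programs

variable {A : Type u} {P : Type v} {G : RankInstance A P} {ν : CellNumbering G} {r i : ℕ}
  {d : A ⊕ P} {s s' : Store} {M N : Set (A × P)} {g : Trace A P}

theorem Store.IsInput.holdsInstance (h : s.IsInput ν r M g d) : s.HoldsInstance ν r d :=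
  ⟨h.numVertices, h.numEdges, h.stages, h.deleted, h.holds.applicant, h.holds.post, h.holds.rank⟩

theorem Store.IsInput.holdsMarks (h : s.IsInput ν r M g d) : s.HoldsMarks ν M := by
  refine fun e he => ⟨fun h1 => ?_, h.holds.mem e he⟩
  by_contra hM
  rw [h.holds.notMem e he hM] at h1
  omega

theorem init_spec (h : s.IsInput ν r M g d) (hd : d ∈ G.vertices) :
    Reaches (.seq initEdges (.seq initVertices (.setReg 4 (.lit 0)))) s
      (100 * (G.numVertices + G.numEdges + 1)) (StageInv ν r M d 0 ∅) := by
  have inst := h.holdsInstance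
  have he := initEdges_spec s
  rw [inst.numEdges] at he
  refine Reaches.mono (he.seq (T' := 60 * (G.numVertices + 1)) ?_) (by omega) fun s' h => h
  rintro s₁ ⟨h4, hs₁⟩
  have inst₁ := inst.congr hs₁ (by simp) (by simp)
  have hv := initVertices_spec s₁
  rw [inst₁.numVertices] at hv
  refine Reaches.mono (hv.seq (T' := 2) ?_) (by omega) fun s' h => h
  rintro s₂ ⟨h5, hs₂⟩
  refine (Reaches.of_loopFree (by trivial) ?_).mono (by simp [Prog.maxTime, Expr.cost])
    fun s' h => h
  have hset : s₂.AgreesOff [4] [] (s₂.setReg 4 0) := ⟨fun x hx => by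
      rw [Store.reg_setReg, if_neg]
      rintro rfl
      simp at hx, fun _ _ => rfl⟩
  have hall : s.AgreesOff [4, 5] [4, 5, 6, 10] (s₂.setReg 4 0) :=
    ((hs₁.mono (by simp) (by simp)).trans (hs₂.mono (by simp) (by simp))).trans
      (hset.mono (by simp) (by simp))
  have h4' : ∀ e ∈ G.edges, ((s₂.setReg 4 0).cell 4 (ν.edge e) ≠ 0 ↔ Incident e d) := by
    intro e he
    rw [Store.cell_setReg, hs₂.2 4 (by simp), h4 _ (ν.edge_lt he), inst.applicant e he,
      inst.post e he, inst.deleted, incident_iff_vertex (ν := ν) he hd]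
    simp [or_iff_not_imp_left]
  refine ⟨inst.congr hall (by simp) (by simp), h.holdsMarks.congr hall (by simp), ?_, ⟨?_, ?_⟩,
    fun e he => (h4' e he).2, fun e he => Or.inl ⟨?_, he⟩, fun x hx => Or.inl ⟨?_, ?_⟩⟩
  · simp [Prog.run, Expr.eval, Store.reg_setReg]
  · exact fun e he => absurd he (Set.notMem_empty e)
  · exact fun x hx _ => (h5 _ (ν.vertex_lt hx)).2
  · exact not_not.1 (mt (h4' e he.1).1 he.2)
  · exact (h5 _ (ν.vertex_lt (RankInstance.mem_vertices_delete.1 hx).1)).1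
  · exact RankInstance.notMem_closedSet_zero

/-- The loop over the stages produces a sequence of matchings that are linked by stages of the
algorithm. -/
theorem stages_spec (hM : G.RankMaximal M) (hd : d ∈ G.vertices) (h : StageInv ν r M d 0 ∅ s) :
    Reaches (.loop (.lt (.reg 4) (.reg 2)) stageProgram) s
      ((2000 * (G.numVertices + G.numEdges + 1) + 3) * r + 3) (fun s' =>
        ∃ L : ℕ → Set (A × P), L 0 = ∅ ∧
          (∀ j < r, G.DeletionStep M d (j + 1) (L j) (L (j + 1))) ∧
          StageInv ν r M d r (L r) s') := by
  refine (Reaches.loop (K := 2000 * (G.numVertices + G.numEdges + 1)) (fun s' => ∃ i ≤ r,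
    ∃ L : ℕ → Set (A × P), L 0 = ∅ ∧ (∀ j < i, G.DeletionStep M d (j + 1) (L j) (L (j + 1))) ∧
      StageInv ν r M d i (L i) s') (fun s' => r - s'.reg 4) ?_ ?_).mono ?_ ?_
  · rintro s' ⟨i, hi, L, h0, hL, hinv⟩ hc
    simp only [Test.holds, Expr.eval, hinv.stage, hinv.holds.stages] at hc
    refine (stageProgram_spec hM hd (RankInstance.DeletionStep.states hM h0 hL i le_rfl)
      hinv).mono le_rfl ?_
    rintro s'' ⟨N, hstep, hinv'⟩
    refine ⟨⟨i + 1, hc, Function.update L (i + 1) N, ?_, fun j hj => ?_, ?_⟩, ?_⟩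
    · rwa [Function.update_of_ne (Nat.succ_ne_zero i).symm]
    · rw [Function.update_of_ne (by omega)]
      rcases Nat.eq_or_lt_of_le (Nat.lt_succ_iff.1 hj) with rfl | hj
      · rwa [Function.update_self]
      · rw [Function.update_of_ne (by omega)]
        exact hL j hj
    · rwa [Function.update_self]
    · rw [hinv.stage, hinv'.stage]
      omega
  · exact ⟨0, Nat.zero_le r, fun _ => ∅, rfl, fun j hj => absurd hj (Nat.not_lt_zero j), h⟩
  · simp [h.stage, Test.cost, Expr.cost]
  · rintro s' ⟨⟨i, hi, L, h0, hL, hinv⟩, hc⟩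
    simp only [Test.holds, Expr.eval, hinv.stage, hinv.holds.stages] at hc
    obtain rfl : i = r := by omega
    exact ⟨L, h0, hL, hinv⟩

theorem StageInv.holds_output {L : ℕ → Set (A × P)} (h : StageInv ν r M d r (L r) s)
    (hL : ∀ i ≤ r, G.DeletionState M d i (L i))
    (h3 : ∀ k < G.numEdges, s'.cell 3 k = if s.cell 10 (s.cell 0 k) = s.cell 1 k + 1 then 1 else 0)
    (hs' : s.AgreesOff [5] [3] s') : s'.Holds ν (G.delete d) r (L r)
      ⟨L, (G.delete d).stageGraph, (G.delete d).reducedGraph⟩ := by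
  classical
  set t : Trace A P := ⟨L, (G.delete d).stageGraph, (G.delete d).reducedGraph⟩ with ht
  have hfol : ∀ k, 1 ≤ k → k ≤ r → (G.delete d).FollowsAt t k := fun k _ hk =>
    ⟨rfl, (hL k hk).maximum⟩
  have hfol' : ∀ k, 1 ≤ k → k ≤ r → (G.delete d).FollowsAt t k ∧
      t.red k = (G.delete d).reducedGraph k := fun k h1 h2 => ⟨hfol k h1 h2, rfl⟩
  have hLG : L r ⊆ G.edges := fun e he =>
    (RankInstance.stageGraph_subset_edges ((hL r le_rfl).maximum.1.1 he)).1
  have inst := h.holds.congr hs' (by simp) (by simp)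
  have hmem : ∀ e ∈ G.edges, s'.cell 3 (ν.edge e) = if e ∈ L r then 1 else 0 := by
    intro e he
    rw [h3 _ (ν.edge_lt he), h.holds.applicant e he, h.holds.post e he]
    exact if_congr (h.mate.mem_iff hLG he).symm rfl rfl
  -- the entries of a vertex that is odd or unreachable at some stage
  have hvertex : ∀ x ∈ (G.delete d).vertices, (G.delete d).vertexStage r t x ≠ 0 →
      (s'.cell 5 (ν.vertex x) = (G.delete d).vertexStage r t x ∧
        ((G.delete d).OddAt t ((G.delete d).vertexStage r t x) x → s'.cell 6 (ν.vertex x) = 0) ∧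
        ((G.delete d).UnreachableAt t ((G.delete d).vertexStage r t x) x →
          s'.cell 6 (ν.vertex x) = 1)) := by
    intro x hx hne
    rw [hs'.2 5 (by simp), hs'.2 6 (by simp)]
    rcases h.vertex x hx with ⟨-, hcl⟩ | ⟨k, hk, h5, hcl, hb, hodd, hun⟩
    · exact absurd (RankInstance.vertexStage_eq_zero hfol hcl) hne
    · have hf := hfol (k + 1) (Nat.succ_pos k) hk
      rw [RankInstance.vertexStage_eq_succ hfol hk hcl hb, hf.oddAt_iff, hf.unreachableAt_iff]
      exact ⟨h5, hodd, fun hu => hun hu.2⟩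
  refine ⟨fun e he => inst.applicant e he.1, fun e he => inst.post e he.1,
    fun e he => inst.rank e he.1, fun e he heL => ?_, fun e he heL => ?_, fun e he => ?_,
    fun x hx => ?_, fun x hx hne => (hvertex x hx hne).2.1, fun x hx hne => (hvertex x hx hne).2.2⟩
  · rw [hmem e he.1, if_pos heL]
  · rw [hmem e he.1, if_neg heL]
  · rw [hs'.2 4 (by simp)]
    rcases h.edge e he with ⟨h0, hal⟩ | ⟨k, hk, h0, hal, hn⟩
    · rw [h0, (RankInstance.edgeStage_eq_zero hfol' hal).1]
    · rw [h0, RankInstance.edgeStage_eq_succ hfol' hk hal hn]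
  · by_cases hne : (G.delete d).vertexStage r t x = 0
    · rw [hne, hs'.2 5 (by simp)]
      rcases h.vertex x hx with ⟨h0, -⟩ | ⟨k, hk, -, hcl, hb, -⟩
      · exact h0
      · rw [RankInstance.vertexStage_eq_succ hfol hk hcl hb] at hne
        omega
    · exact (hvertex x hx hne).1

/-- The program is correct, and it runs in time `O(r (m + n))`. -/
theorem deletionProgram_spec (hM : G.RankMaximal M) (hd : d ∈ G.vertices) (hr : 1 ≤ r)
    (hMr : ∀ e ∈ M, G.rank e ≤ r) (hg : G.IsIrvingRun r g) (h : s.IsInput ν r M g d) :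
    Reaches deletionProgram s (5000 * (r * (G.numEdges + G.numVertices))) (fun s' =>
      ∃ t, G.IsDeletionRun r M g d t ∧ s'.Holds ν (G.delete d) r (t.M r) t) := by
  have hn : 1 ≤ G.numVertices := Nat.one_le_of_lt (ν.vertex_lt hd)
  set Y := G.numEdges + G.numVertices with hY
  have hX : G.numVertices + G.numEdges + 1 ≤ 2 * Y := by omega
  have h1 : Y ≤ r * Y := Nat.le_mul_of_pos_left Y hr
  have h2 : (2000 * (G.numVertices + G.numEdges + 1) + 3) * r ≤ 4003 * (r * Y) := by
    calc (2000 * (G.numVertices + G.numEdges + 1) + 3) * r ≤ (4003 * Y) * r :=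
          Nat.mul_le_mul_right r (by omega)
      _ = 4003 * (r * Y) := by ring
  obtain ⟨s₁, t₁, hex, ht₁, hinv⟩ := init_spec h hd
  have hrest : Reaches (.seq (.loop (.lt (.reg 4) (.reg 2)) stageProgram) markMatching) s₁
      (4003 * (r * Y) + 3 + 30 * (G.numEdges + 1)) (fun s' =>
      ∃ t, G.IsDeletionRun r M g d t ∧ s'.Holds ν (G.delete d) r (t.M r) t) := by
    refine ((stages_spec hM hd hinv).mono (Nat.add_le_add_right h2 3) fun s' h => h).seq ?_
    rintro s₂ ⟨L, h0, hL, hinv₂⟩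
    have hmark := markMatching_spec s₂
    rw [hinv₂.holds.numEdges] at hmark
    refine hmark.mono le_rfl ?_
    rintro s₃ ⟨h3, hs₃⟩
    exact ⟨_, RankInstance.isDeletionRun_of_steps hM hMr hg h0 hL,
      hinv₂.holds_output (RankInstance.DeletionStep.states hM h0 hL) h3 hs₃⟩
  obtain ⟨s₂, t₂, hex₂, ht₂, hQ⟩ := hrest
  cases hex with
  | seq e1 e2 =>
    cases e2 with
    | seq e2 e3 =>
      refine ⟨s₂, _, .seq e1 (.seq e2 (.seq e3 hex₂)), ?_, hQ⟩
      omega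

end Programs

/-- The stages of the algorithm can be carried out one after the other. -/
theorem RankInstance.exists_deletionSteps {A : Type u} {P : Type v} (G : RankInstance A P)
    (M : Set (A × P)) (d : A ⊕ P) :
    ∃ L : ℕ → Set (A × P), L 0 = ∅ ∧ ∀ i, G.DeletionStep M d (i + 1) (L i) (L (i + 1)) := by
  have hstep : ∀ i L, ∃ N, G.DeletionStep M d i L N := by
    intro i L
    by_cases h : ∃ x ∈ G.lost M d L i, ∃ N,
        AugmentsFrom ((G.delete d).stageGraph i) (G.carry M d L i) x N
    · obtain ⟨x, hx, N, hN⟩ := h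
      exact ⟨N, Or.inl ⟨x, hx, hN⟩⟩
    · exact ⟨_, Or.inr ⟨h, rfl⟩⟩
  choose f hf using hstep
  exact ⟨fun i => Nat.rec ∅ (fun i L => f (i + 1) L) i, rfl, fun i => hf (i + 1) _⟩

theorem mainTheorem3 :
    ∃ (prog : Prog) (C : ℕ), ∀ (A : Type u) (P : Type v) (G : RankInstance A P) (d : A ⊕ P)
      (r : ℕ) (M : Set (A × P)) (g : Trace A P),
      d ∈ G.vertices → 1 ≤ r →
      (∀ N, G.RankMaximal N → ∀ e ∈ N, G.rank e ≤ r) →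
      (∀ N, (G.delete d).RankMaximal N → ∀ e ∈ N, G.rank e ≤ r) →
      G.RankMaximal M → G.IsIrvingRun r g →
      -- the vertex-deletion algorithm can be executed, and every execution is correct
      (∃ t, G.IsDeletionRun r M g d t) ∧
      (∀ t, G.IsDeletionRun r M g d t →
        (G.delete d).IsIrvingRun r t ∧ (G.delete d).RankMaximal (t.M r) ∧
          ∀ t', (G.delete d).IsIrvingRun r t' → ∀ i, 1 ≤ i → i ≤ r → t'.red i = t.red i) ∧
      -- it runs in time `O(r (m + n))`
      (∀ (ν : CellNumbering G) (s : Store), s.IsInput ν r M g d →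
        ∃ s' time t, Exec prog s s' time ∧ time ≤ C * (r * (G.numEdges + G.numVertices)) ∧
          G.IsDeletionRun r M g d t ∧ s'.Holds ν (G.delete d) r (t.M r) t) := by
  refine ⟨deletionProgram, 5000, ?_⟩
  intro A P G d r M g hd hr hGr hHr hM hg
  have hMr := hGr M hM
  refine ⟨?_, fun t ht => RankInstance.IsDeletionRun.correct hM hHr hg ht, fun ν s hs => ?_⟩
  · obtain ⟨L, h0, hL⟩ := G.exists_deletionSteps M d
    exact ⟨_, RankInstance.isDeletionRun_of_steps hM hMr hg h0 fun i _ => hL i⟩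
  · obtain ⟨s', time, hex, htime, t, ht, hs'⟩ := deletionProgram_spec hM hd hr hMr hg hs
    exact ⟨s', time, t, hex, htime, ht, hs'⟩
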